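/- Let $m\ge 0$ and let $\lambda$ be a partition. For a partition $\kappa$, let $B_\kappa$ (with respect to $s$) denote the set of semistandard Young tableaux of shape $\kappa$ with entries in $\{1,\dots,s\}$; we take $s=2m$ for $\lambda$ and $s=m$ for all other partitions below. Let $e_i,f_i\ (1\le i\le s-1)$ be the usual $\mathfrak{sl}_s$-crystal (raising and lowering) operators on $B_\kappa\sqcup\{0\}$, and let $\xi\colon B_\kappa\to B_\kappa$ be the Schützenberger involution (evacuation), defined by iterated jeu-de-taquin demotion. Let $\operatorname{Rect}$ denote jeu-de-taquin rectification of semistandard skew tableaux. For $T\in B_\lambda$ let $\varphi_0(T)$ be the tableau formed by the boxes of $T$ with entries in $\{1,\dots,m\}$, let $\varphi_1(T)$ be the skew tableau formed by the boxes of $T$ with entries in $\{m+1,\dots,2m\}$, with $m$ subtracted from every entry, and put $\varphi(T)=(\varphi_0(T),\operatorname{Rect}(\varphi_1(T)))$, a pair of semistandard tableaux with entries in $\{1,\dots,m\}$. Regard $B_\lambda$ as an $(\mathfrak{sl}_m\oplus\mathfrak{sl}_m)$-crystal with raising operators $f_1,\dots,f_{m-1},e_{m+1},\dots,e_{2m-1}$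 and lowering operators $e_1,\dots,e_{m-1},f_{m+1},\dots,f_{2m-1}$. For a partition $\beta=(\beta_1,\dots,\beta_m)$ with at most $m$ positive parts, let $B_{(\overline\beta,\beta)}=B_\beta\times B_\beta$ be the $(\mathfrak{sl}_m\oplus\mathfrak{sl}_m)$-crystal in which the operators with index $i<m$ act as $e_i,f_i$ on the first factor, those with index $i>m$ act as $e_{i-m},f_{i-m}$ on the second factor, and the raising and lowering operators are the same as above (interchanged for $i<m$). Let $b_\beta$ and $b_{\overline\beta}$ be the unique tableaux of shape $\beta$ with contents $(\beta_1,\dots,\beta_m)$ and $(\beta_m,\dots,\beta_1)$, respectively. A highest weight element is one at which all raising operators vanish, and an isomorphism of crystals is a bijection commuting with all raising and lowering operators. 1. For every $T\in B_\lambda$ we have $\xi(T)\in B_\lambda$ and $$\varphi(\xi(T))=\bigl(\xi(\operatorname{Rect}(\varphi_1(T))),\ \xi(\varphi_0(T))\bigr).$$ 2. Every connected component $\mathcal C$ of the $(\mathfrak{sl}_m\oplus\mathfrak{sl}_m)$-crystal $B_\lambda$ has a unique highest weight element $b$. If $\xi(b)\ne b$, then $\{T\in\mathcal C:\xi(T)=T\}$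 is empty. If $\xi(b)=b$, then there is a partition $\beta=(\beta_1,\dots,\beta_m)$ such that $\varphi(b)=(b_{\overline\beta},b_\beta)$, the map $\varphi$ restricts to an isomorphism of crystals $\mathcal C\to B_{(\overline\beta,\beta)}$, and this isomorphism restricts to a bijection $$\{T\in\mathcal C:\xi(T)=T\}\ \longrightarrow\ \{(U,U')\in B_\beta\times B_\beta:\ U'=\xi(U)\}.$$ -/

import Mathlib

noncomputable section

open Classical

namespace EvacCrystal

/-! ### Tableaux

Rows and columns are numbered from `0`, downwards and rightwards; entries are positive. -/

/-- A filling of finitely many boxes `(row, column)` by positive integers. The value `0` means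
that the box does not belong to the filling, so the diagram of `T` is `T.support`. -/
abbrev Filling : Type := (ℕ × ℕ) →₀ ℕ

/-- Rows weakly increase from left to right, columns strictly increase from top to bottom. -/
def IsSemistandard (T : Filling) : Prop :=
  (∀ i j₁ j₂ : ℕ, j₁ < j₂ → (i, j₁) ∈ T.support → (i, j₂) ∈ T.support → T (i, j₁) ≤ T (i, j₂)) ∧
  (∀ i₁ i₂ j : ℕ, i₁ < i₂ → (i₁, j) ∈ T.support → (i₂, j) ∈ T.support → T (i₁, j) < T (i₂, j))

/-- `B_κ`: the semistandard tableaux of shape `κ` with entries in `{1, …, s}`. -/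
def tableaux (κ : YoungDiagram) (s : ℕ) : Set Filling :=
  {T | T.support = κ.cells ∧ IsSemistandard T ∧ ∀ c, T c ≤ s}

/-- The number of boxes of `T` with entry `a`. -/
def content (T : Filling) (a : ℕ) : ℕ := (T.support.filter fun c => T c = a).card

/-! ### Jeu de taquin -/

/-- The moves of a jeu-de-taquin slide whose current empty box is `(i, j)`, at most `n` of them.
The entry below moves up if it is at most the entry to the right or if there is no box to the
right; otherwise the entry to the right moves left; if there is neither, the slide has ended. -/
def slideAux : ℕ → Filling → ℕ × ℕ → Filling
  | 0, T, _ => T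
  | n + 1, T, (i, j) =>
    if T (i + 1, j) = 0 ∧ T (i, j + 1) = 0 then T
    else if T (i + 1, j) ≠ 0 ∧ (T (i, j + 1) = 0 ∨ T (i + 1, j) ≤ T (i, j + 1)) then
      slideAux n ((T.update (i, j) (T (i + 1, j))).update (i + 1, j) 0) (i + 1, j)
    else
      slideAux n ((T.update (i, j) (T (i, j + 1))).update (i, j + 1) 0) (i, j + 1)

/-- The jeu-de-taquin slide on `T` starting from the empty box `c`. Each move empties another box
of the original diagram, so the number of boxes bounds the number of moves. -/
def slide (T : Filling) (c : ℕ × ℕ) : Filling := slideAux T.support.card T c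

/-- The boxes outside the diagram of `T` that lie weakly northwest of one of its boxes. If the
diagram is `κ / ι`, this is `ι` without the boxes that have no box of `κ / ι` to their southeast
(a slide started from such a box would change nothing). It is empty if and only if the diagram is
left-justified. -/
def inner (T : Filling) : Finset (ℕ × ℕ) :=
  (T.support.biUnion fun d => Finset.Iic d) \ T.support

/-- The inside corner used for the next slide: the last box in the lowest row of `inner T`. (The
rectification does not depend on the choice of the inside corners.) -/
def corner (T : Filling) : ℕ × ℕ :=
  ((inner T).sup Prod.fst, ((inner T).filter fun c => c.1 = (inner T).sup Prod.fst).sup Prod.snd)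

/-- Perform one slide, unless the diagram is already left-justified. -/
def rectStep (T : Filling) : Filling :=
  if inner T = ∅ then T else slide T (corner T)

/-- The rectification `Rect T`: slides are performed until the diagram is left-justified. Each
slide removes at least one box from `inner T`, so `(inner T).card` steps suffice. -/
def rect (T : Filling) : Filling := rectStep^[(inner T).card] T

/-! ### Demotion and evacuation -/

/-- Remove the boxes with an entry greater than `a`. -/
def restrictLE (a : ℕ) (T : Filling) : Filling := T.filter fun c => T c ≤ a

/-- Remove the boxes with an entry at most `a`, and subtract `a` from the remaining entries
(in truncated subtraction the former become `0`, that is, disappear). -/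
def dropLE (a : ℕ) (T : Filling) : Filling := T.mapRange (fun x => x - a) (Nat.zero_sub a)

/-- Jeu-de-taquin demotion on tableaux with entries in `{1, …, s}`: delete the `1`s, decrement the
other entries, rectify, and fill the vacated boxes of the original shape with `s`. -/
def demote (s : ℕ) (T : Filling) : Filling :=
  rect (dropLE 1 T) +
    Finsupp.indicator (T.support \ (rect (dropLE 1 T)).support) (fun _ _ => s)

/-- The tableau under examination after the demotion with entry upper bound `s - k`. -/
def evacStage (s : ℕ) (T : Filling) : ℕ → Filling
  | 0 => demote s T
  | k + 1 => demote (s - (k + 1)) (restrictLE (s - (k + 1)) (evacStage s T k))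

/-- The shape `κ_i` noted at entry upper bound `i`; `κ_0` is empty. -/
def evacShape (s : ℕ) (T : Filling) (i : ℕ) : Finset (ℕ × ℕ) :=
  if i = 0 then ∅ else (evacStage s T (s - i)).support

/-- Evacuation (the Schützenberger involution) on tableaux with entries in `{1, …, s}`: the boxes
of `κ_i / κ_{i-1}` are filled with `i`, for `1 ≤ i ≤ s`. -/
def evac (s : ℕ) (T : Filling) : Filling :=
  ∑ i ∈ Finset.Icc 1 s,
    Finsupp.indicator (evacShape s T i \ evacShape s T (i - 1)) (fun _ _ => i)

/-! ### Raising and lowering operators on tableaux -/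

/-- The number of entries `i + 1` minus the number of entries `i` in column `j` or to the right. -/
def hStat (i : ℕ) (T : Filling) (j : ℕ) : ℤ :=
  ((T.support.filter fun c => j ≤ c.2 ∧ T c = i + 1).card : ℤ) -
    ((T.support.filter fun c => j ≤ c.2 ∧ T c = i).card : ℤ)

/-- The number of entries `i` minus the number of entries `i + 1` in column `j` or to the left. -/
def kStat (i : ℕ) (T : Filling) (j : ℕ) : ℤ :=
  ((T.support.filter fun c => c.2 ≤ j ∧ T c = i).card : ℤ) -
    ((T.support.filter fun c => c.2 ≤ j ∧ T c = i + 1).card : ℤ)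

/-- `j` is the rightmost column at which `hStat i T` is maximal, and the maximum is positive. -/
def IsRaisingColumn (i : ℕ) (T : Filling) (j : ℕ) : Prop :=
  0 < hStat i T j ∧ (∀ j', hStat i T j' ≤ hStat i T j) ∧ ∀ j', j < j' → hStat i T j' < hStat i T j

/-- `j` is the leftmost column at which `kStat i T` is maximal, and the maximum is positive. -/
def IsLoweringColumn (i : ℕ) (T : Filling) (j : ℕ) : Prop :=
  0 < kStat i T j ∧ (∀ j', kStat i T j' ≤ kStat i T j) ∧ ∀ j', j' < j → kStat i T j' < kStat i T j

/-- Put `b` in place of the entry `a` in column `j`. -/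
def replaceInColumn (j a b : ℕ) (T : Filling) : Filling :=
  Finsupp.onFinset T.support
    (fun c => if c ∈ T.support ∧ c.2 = j ∧ T c = a then b else T c)
    (fun c hc => by
      by_contra h
      simp_all)

/-- The operator `e_i`; `none` stands for `0`. -/
def eOp (i : ℕ) (T : Filling) : Option Filling :=
  if h : ∃ j, IsRaisingColumn i T j then some (replaceInColumn h.choose (i + 1) i T) else none

/-- The operator `f_i`; `none` stands for `0`. -/
def fOp (i : ℕ) (T : Filling) : Option Filling :=
  if h : ∃ j, IsLoweringColumn i T j then some (replaceInColumn h.choose i (i + 1) T) else none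

/-! ### Crystals -/

/-- A set with raising and lowering operators indexed by `I`, where `none` stands for `0`. The
weight map is left out because connected components, highest weight elements and morphisms do not
involve it. -/
structure CrystalOps (I X : Type) where
  /-- The underlying set. -/
  carrier : Set X
  /-- The raising operators. -/
  raising : I → X → Option X
  /-- The lowering operators. -/
  lowering : I → X → Option X

namespace CrystalOps

variable {I X Y : Type}

/-- There is an edge from `a` to `b`: some raising operator takes `a` to `b`. -/
def Edge (K : CrystalOps I X) (a b : X) : Prop :=
  a ∈ K.carrier ∧ b ∈ K.carrier ∧ ∃ i, K.raising i a = some b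

/-- `C` is a connected component of the underlying graph. -/
def IsComponent (K : CrystalOps I X) (C : Set X) : Prop :=
  ∃ a ∈ K.carrier, C = {b | Relation.EqvGen K.Edge a b}

/-- All raising operators vanish at `b`. -/
def IsHighestWeight (K : CrystalOps I X) (b : X) : Prop :=
  b ∈ K.carrier ∧ ∀ i, K.raising i b = none

/-- The same operators on the subset `C`. -/
def restrict (K : CrystalOps I X) (C : Set X) : CrystalOps I X where
  carrier := C
  raising := K.raising
  lowering := K.lowering

/-- `π` is an isomorphism of crystals: a bijection of the underlying sets that commutes with all
raising and lowering operators, where `π 0 = 0`. -/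
def IsIso (K : CrystalOps I X) (L : CrystalOps I Y) (π : X → Y) : Prop :=
  Set.BijOn π K.carrier L.carrier ∧
    ∀ i, ∀ b ∈ K.carrier,
      (K.raising i b).map π = L.raising i (π b) ∧ (K.lowering i b).map π = L.lowering i (π b)

end CrystalOps

/-- The index set `{1, …, m-1} ∪ {m+1, …, 2m-1}` of the simple roots of `sl_m ⊕ sl_m`. -/
abbrev BlockIndex (m : ℕ) : Type := {i : ℕ // (1 ≤ i ∧ i < m) ∨ (m < i ∧ i < 2 * m)}

/-- `B_κ`, for entries in `{1, …, 2m}`, as an `(sl_m ⊕ sl_m)`-crystal: the raising operators are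
`f_1, …, f_{m-1}, e_{m+1}, …, e_{2m-1}`, the lowering operators are
`e_1, …, e_{m-1}, f_{m+1}, …, f_{2m-1}`. -/
def blockCrystal (m : ℕ) (κ : YoungDiagram) : CrystalOps (BlockIndex m) Filling where
  carrier := tableaux κ (2 * m)
  raising i T := if i.1 < m then fOp i.1 T else eOp i.1 T
  lowering i T := if i.1 < m then eOp i.1 T else fOp i.1 T

/-- `B_β × B_γ`, for entries in `{1, …, m}`, as an `(sl_m ⊕ sl_m)`-crystal. The operators with
index `i < m` act on the first factor, with raising and lowering exchanged, and those with index
`i > m` act on the second factor as the operators with index `i - m`. -/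
def prodCrystal (m : ℕ) (β γ : YoungDiagram) :
    CrystalOps (BlockIndex m) (Filling × Filling) where
  carrier := tableaux β m ×ˢ tableaux γ m
  raising i P :=
    if i.1 < m then (fOp i.1 P.1).map fun U => (U, P.2)
    else (eOp (i.1 - m) P.2).map fun V => (P.1, V)
  lowering i P :=
    if i.1 < m then (eOp i.1 P.1).map fun U => (U, P.2)
    else (fOp (i.1 - m) P.2).map fun V => (P.1, V)

/-! ### The splitting map -/

/-- `φ_0 T`: the part of `T` with entries in `{1, …, m}`. -/
def phi0 (m : ℕ) (T : Filling) : Filling := restrictLE m T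

/-- `φ_1 T`: the part of `T` with entries in `{m+1, …, 2m}`, all entries lowered by `m`. -/
def phi1 (m : ℕ) (T : Filling) : Filling := dropLE m T

/-- `φ T = (φ_0 T, Rect (φ_1 T))`. -/
def phi (m : ℕ) (T : Filling) : Filling × Filling := (phi0 m T, rect (phi1 m T))

end EvacCrystal

end

open EvacCrystal

/-!
The proof translates everything into Gelfand–Tsetlin patterns. A semistandard (skew) tableau is
recorded by the shapes `L k` formed by its boxes with entry at most `k`, consecutive shapes differing
by a horizontal strip. On patterns a jeu-de-taquin slide becomes a rule that passes the row of the
empty box from each level to the next (`pSlide`), and the operators `e_i`, `f_i` change one row of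
one level, selected by a statistic of three consecutive levels (`Raise`, `Lower`). The translation
is made in `Rep.rect`, `Rep.evac` and `Rep.op_eq_some_iff`.

Three facts about patterns carry the argument.

* *Slides commute with the operators* (`Step.slides`, `Step.of_slides`). A slide changes the statistic
  of three consecutive levels in at most one row, so this is a local verification. Since a straight
  tableau of highest weight is determined by its content, a relation compatible with contents and
  raising operators is contained in equality (`eq_of_bisimulation`); hence the rectification does not
  depend on the order of the slides, and iterated demotion is the rectification of the part with
  large entries (`slides_shift_slides`, `slides_shift_eq_dem_iterate`).
* *Demotion is a toggle* (`dem_succ`): each level of the demoted pattern is obtained from the level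
  before it and two levels of the pattern by the reflection `toggle`. The rule is symmetric, so the
  growth diagram of the iterated demotions of the evacuated pattern is the reflection of that of the
  pattern (`dem_iterate_pEvac`). Therefore evacuation is an involution. It exchanges `e_i` and
  `f_{s-i}` (`step_pEvac_iff`): for `i > 1` by induction through demotion, which commutes with the
  operators, and for `i = 1` by applying the involution, the case `s = 2` being a direct computation.
* *Slides can be undone when the shape before the slide is known* (`pSlide_injective`). The operators
  do not change the shapes met during a rectification, so rectification is injective on patterns
  connected by operators (`slides_injective`).

By the definition of evacuation, the part of `evac T` with entries at most `m` is the evacuation of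
the rectified part with large entries of `T`; the formula for `phi (evac T)` follows from this and
from the involution property (`phi_evac`). The splitting map commutes with the operators
(`phi_arrow`) and is injective on each component (`Connected.phi_injective`). The operators of the
two factors lift along it, and in each factor every tableau is connected to the unique extremal
tableau of its shape; so each component has exactly one highest weight element `b` and is mapped
bijectively onto a product of two sets of tableaux. Evacuation permutes the components and preserves
highest weight elements, so a component with a fixed point has `evac b = b`. In that case the halves
of `b` are interchanged by evacuation and have one shape `β`, and by the formula for `phi (evac T)`
the fixed points in the component are the tableaux lying over the pairs `(U, evac U)`.
-/

namespace EvacCrystal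

/-! ### Gelfand–Tsetlin patterns and slides on them -/

/-- An array of natural numbers. A semistandard skew tableau is encoded by letting `L k r` be the
number of boxes of row `r` that lie in the inner shape or have an entry at most `k`; so `L 0` is the
inner shape, and `L 0 = 0` for a straight shape. -/
abbrev Pattern : Type := ℕ → ℕ → ℕ

/-- The interlacing conditions satisfied by the pattern of a semistandard skew tableau with at most
`N` rows and entries at most `s`: consecutive levels differ by a horizontal strip, the levels are
constant from `s` on, and rows from `N` on are empty. -/
structure IsPattern (N s : ℕ) (L : Pattern) : Prop where
  up : ∀ k r, L k r ≤ L (k + 1) r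
  il : ∀ k r, L (k + 1) (r + 1) ≤ L k r
  stab : ∀ k r, s ≤ k → L k r = L s r
  fin : ∀ k r, N ≤ r → L k r = 0

namespace IsPattern

variable {N s : ℕ} {L : Pattern}

theorem mono (h : IsPattern N s L) (r : ℕ) : Monotone fun k => L k r :=
  monotone_nat_of_le_succ fun k => h.up k r

theorem anti (h : IsPattern N s L) (k r : ℕ) : L k (r + 1) ≤ L k r :=
  (h.up k (r + 1)).trans (h.il k r)

theorem antitone (h : IsPattern N s L) (k : ℕ) : Antitone (L k) :=
  antitone_nat_of_succ_le fun r => h.anti k r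

theorem eq_zero (h : IsPattern N s L) (h0 : L 0 = 0) : ∀ k r, k ≤ r → L k r = 0
  | 0, r, _ => by simp [h0]
  | k + 1, 0, hr => by omega
  | k + 1, r + 1, hr => by
    have := h.il k r
    have := h.eq_zero h0 k r (by omega)
    omega

theorem eq_zero_row (h : IsPattern N s L) (h0 : L 0 = 0) (k r : ℕ) (hr : s ≤ r) : L k r = 0 := by
  rcases le_total s k with hk | hk
  · rw [h.stab k r hk, h.eq_zero h0 s r hr]
  · exact h.eq_zero h0 k r (hk.trans hr)

end IsPattern

/-- Forget the entries at most `k` (they are absorbed in the inner shape), lowering the others by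
`k`. -/
def shift (k : ℕ) (L : Pattern) : Pattern := fun j => L (j + k)

/-- Forget the entries greater than `m`. -/
def trunc (m : ℕ) (L : Pattern) : Pattern := fun k => L (min k m)

theorem IsPattern.shift {N s k : ℕ} {L : Pattern} (h : IsPattern N s L) :
    IsPattern N (s - k) (shift k L) where
  up j r := by
    have := h.up (j + k) r
    rwa [show j + k + 1 = j + 1 + k by omega] at this
  il j r := by
    have := h.il (j + k) r
    rwa [show j + k + 1 = j + 1 + k by omega] at this
  stab j r hj := by
    have h1 := h.stab (j + k) r (by omega)
    have h2 := h.stab (s - k + k) r (by omega)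
    simp only [EvacCrystal.shift]
    omega
  fin j r := h.fin _ r

theorem IsPattern.trunc {N s m : ℕ} {L : Pattern} (h : IsPattern N s L) :
    IsPattern N m (trunc m L) where
  up k r := h.mono r (by omega)
  il k r := by
    simp only [EvacCrystal.trunc]
    rcases lt_or_ge k m with hk | hk
    · rw [min_eq_left hk.le, min_eq_left (by omega)]; exact h.il k r
    · rw [min_eq_right hk, min_eq_right (by omega)]; exact h.anti m r
  stab k r hk := by simp [EvacCrystal.trunc, hk]
  fin k r := h.fin _ r

/-- The row of the empty box of a jeu-de-taquin slide, started in row `p`, at the moment when it has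
passed all entries at most `k`. The empty box is then the last box of its row at level `k`. It moves
down if there is an entry `k + 1` directly below it; otherwise it moves along its row to the end of
the entries `k + 1`. -/
def slideRow (L : Pattern) (p : ℕ) : ℕ → ℕ
  | 0 => p
  | k + 1 =>
    if L (k + 1) (slideRow L p k + 1) = L k (slideRow L p k) then slideRow L p k + 1
    else slideRow L p k

/-- The jeu-de-taquin slide on patterns, started at the last box of row `p` of the inner shape. -/
def pSlide (p : ℕ) (L : Pattern) : Pattern :=
  fun k r => if r = slideRow L p k then L k r - 1 else L k r

/-- The number of boxes at level `k`. -/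
def size (N : ℕ) (L : Pattern) (k : ℕ) : ℕ := ∑ r ∈ Finset.range N, L k r

theorem slideRow_succ (L : Pattern) (p k : ℕ) :
    (slideRow L p (k + 1) = slideRow L p k + 1 ∧
      L (k + 1) (slideRow L p k + 1) = L k (slideRow L p k)) ∨
    (slideRow L p (k + 1) = slideRow L p k ∧
      L (k + 1) (slideRow L p k + 1) ≠ L k (slideRow L p k)) := by
  rw [slideRow]
  split_ifs with h
  · exact Or.inl ⟨rfl, h⟩
  · exact Or.inr ⟨rfl, h⟩

theorem slideRow_corner {N s : ℕ} {L : Pattern} (h : IsPattern N s L) {p : ℕ}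
    (hp : L 0 (p + 1) < L 0 p) (k : ℕ) :
    L k (slideRow L p k + 1) < L k (slideRow L p k) := by
  induction k with
  | zero => exact hp
  | succ k ih =>
    have h1 := h.il k (slideRow L p k + 1)
    have h2 := h.il k (slideRow L p k)
    have h3 := h.up k (slideRow L p k)
    rcases slideRow_succ L p k with ⟨e, h4⟩ | ⟨e, h4⟩ <;> rw [e] <;> omega

theorem slideRow_stab {N s : ℕ} {L : Pattern} (h : IsPattern N s L) {p : ℕ}
    (hp : L 0 (p + 1) < L 0 p) (k : ℕ) (hk : s ≤ k) : slideRow L p k = slideRow L p s := by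
  induction k, hk using Nat.le_induction with
  | base => rfl
  | succ k hk ih =>
    have h1 := slideRow_corner h hp k
    have h2 := h.stab k (slideRow L p k + 1) hk
    have h3 := h.stab (k + 1) (slideRow L p k + 1) (by omega)
    rcases slideRow_succ L p k with ⟨e, h4⟩ | ⟨e, h4⟩ <;> omega

theorem IsPattern.pSlide {N s : ℕ} {L : Pattern} (h : IsPattern N s L) {p : ℕ}
    (hp : L 0 (p + 1) < L 0 p) : IsPattern N s (pSlide p L) where
  up k r := by
    have h0 := h.up k r
    have h1 := slideRow_corner h hp k
    have h2 := slideRow_corner h hp (k + 1)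
    simp only [EvacCrystal.pSlide]
    rcases slideRow_succ L p k with ⟨e, h4⟩ | ⟨e, h4⟩ <;> rw [e] at h2 ⊢ <;> split_ifs <;>
      subst_vars <;> omega
  il k r := by
    have h0 := h.il k r
    have h1 := slideRow_corner h hp k
    have h2 := slideRow_corner h hp (k + 1)
    simp only [EvacCrystal.pSlide]
    rcases slideRow_succ L p k with ⟨e, h4⟩ | ⟨e, h4⟩ <;> rw [e] at h2 ⊢ <;> split_ifs <;>
      subst_vars <;> omega
  stab k r hk := by
    simp only [EvacCrystal.pSlide, slideRow_stab h hp k hk, h.stab k r hk]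
  fin k r hr := by
    have := h.fin k r hr
    simp only [EvacCrystal.pSlide]
    split_ifs <;> omega

theorem pSlide_le (p : ℕ) (L : Pattern) (k r : ℕ) : pSlide p L k r ≤ L k r := by
  simp only [pSlide]
  split_ifs <;> omega

theorem size_pSlide {N s : ℕ} {L : Pattern} (h : IsPattern N s L) {p : ℕ}
    (hp : L 0 (p + 1) < L 0 p) (k : ℕ) : size N (pSlide p L) k + 1 = size N L k := by
  have h1 := slideRow_corner h hp k
  have hN : slideRow L p k ∈ Finset.range N := by
    by_contra hc
    have := h.fin k (slideRow L p k) (by simpa using hc)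
    omega
  simp only [size]
  rw [← Finset.add_sum_erase _ _ hN, ← Finset.add_sum_erase _ (fun r => L k r) hN]
  have : ∑ x ∈ (Finset.range N).erase (slideRow L p k), pSlide p L k x =
      ∑ x ∈ (Finset.range N).erase (slideRow L p k), L k x :=
    Finset.sum_congr rfl fun x hx => by simp [pSlide, Finset.ne_of_mem_erase hx]
  rw [this]
  simp only [pSlide, if_true]
  omega

/-- Remove the last box of row `p`. -/
def removeBox (p : ℕ) (μ : ℕ → ℕ) : ℕ → ℕ := fun r => if r = p then μ r - 1 else μ r

theorem pSlide_zero (p : ℕ) (L : Pattern) : pSlide p L 0 = removeBox p (L 0) := rfl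

/-- `l` lists the rows of a sequence of removals of corners that exhausts the shape `μ`. -/
def Exhausts : List ℕ → (ℕ → ℕ) → Prop
  | [], μ => μ = 0
  | p :: l, μ => μ (p + 1) < μ p ∧ Exhausts l (removeBox p μ)

/-- Slides started in the rows listed in `l`, one after the other. -/
def slides : List ℕ → Pattern → Pattern
  | [], L => L
  | p :: l, L => slides l (pSlide p L)

theorem IsPattern.slides {N s : ℕ} {l : List ℕ} {L : Pattern} (h : IsPattern N s L)
    (hl : Exhausts l (L 0)) : IsPattern N s (slides l L) := by
  induction l generalizing L with
  | nil => exact h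
  | cons p l ih => exact ih (h.pSlide hl.1) (by rw [pSlide_zero]; exact hl.2)

theorem slides_zero {l : List ℕ} {L : Pattern} (hl : Exhausts l (L 0)) : slides l L 0 = 0 := by
  induction l generalizing L with
  | nil => exact hl
  | cons p l ih => exact ih (by rw [pSlide_zero]; exact hl.2)

theorem slides_le (l : List ℕ) (L : Pattern) (k r : ℕ) : slides l L k r ≤ L k r := by
  induction l generalizing L with
  | nil => exact le_rfl
  | cons p l ih => exact (ih _).trans (pSlide_le p L k r)

theorem size_slides {N s : ℕ} {l : List ℕ} {L : Pattern} (h : IsPattern N s L)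
    (hl : Exhausts l (L 0)) (k : ℕ) : size N (slides l L) k + size N L 0 = size N L k := by
  induction l generalizing L with
  | nil =>
    have : L 0 = 0 := hl
    simp [slides, size, this]
  | cons p l ih =>
    have h1 := ih (h.pSlide hl.1) (by rw [pSlide_zero]; exact hl.2)
    have h2 := size_pSlide h hl.1 k
    have h3 := size_pSlide h hl.1 0
    simp only [slides]
    omega

/-- A slide can be undone once the shape before the slide is known. -/
theorem pSlide_injective {N s : ℕ} {L L' : Pattern} (h : IsPattern N s L) (h' : IsPattern N s L')
    {p : ℕ} (hp : L 0 (p + 1) < L 0 p) (hp' : L' 0 (p + 1) < L' 0 p) (hs : L s = L' s)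
    (e : pSlide p L = pSlide p L') : L = L' := by
  have key : ∀ k, L k = L' k → slideRow L p k = slideRow L' p k := by
    intro k hk
    by_contra hne
    have h1 := congrFun (congrFun e k) (slideRow L p k)
    have h2 := slideRow_corner h hp k
    simp only [pSlide, hk, if_true, if_neg hne] at h1
    rw [hk] at h2
    omega
  have main : ∀ d k, k + d = s → L k = L' k ∧ slideRow L p k = slideRow L' p k := by
    intro d
    induction d with
    | zero => rintro k rfl; exact ⟨hs, key _ hs⟩
    | succ d ih =>
      intro k hk
      obtain ⟨e1, e2⟩ := ih (k + 1) (by omega)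
      have hrow : slideRow L p k = slideRow L' p k := by
        by_contra hne
        have g1 := congrFun (congrFun e k) (slideRow L p k)
        have g2 := congrFun (congrFun e k) (slideRow L' p k)
        simp only [pSlide, if_true, if_neg hne, if_neg (Ne.symm hne)] at g1 g2
        have c1 := slideRow_corner h hp k
        have c2 := slideRow_corner h' hp' k
        have i1 := h.il k (slideRow L p k)
        have i2 := h'.il k (slideRow L' p k)
        have i3 := h.il k (slideRow L' p k)
        have i4 := h'.il k (slideRow L p k)
        rw [e1] at i1 i3
        rcases slideRow_succ L p k with ⟨a, b⟩ | ⟨a, b⟩ <;>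
          rcases slideRow_succ L' p k with ⟨a', b'⟩ | ⟨a', b'⟩ <;> rw [e1] at b <;>
          omega
      refine ⟨?_, hrow⟩
      funext r
      have g := congrFun (congrFun e k) r
      simp only [pSlide, ← hrow] at g
      have c1 := slideRow_corner h hp k
      have c2 := slideRow_corner h' hp' k
      rw [← hrow] at c2
      split_ifs at g with hr
      · subst hr; omega
      · exact g
  funext k r
  rcases le_total k s with hk | hk
  · exact congrFun (main (s - k) k (by omega)).1 r
  · rw [h.stab k r hk, h'.stab k r hk, hs]

/-! ### Crystal operators on patterns -/

/-- For the consecutive levels `y`, `x`, `b` that bound the entries `i` (between `y` and `x`) and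
`i + 1` (between `x` and `b`): the number of entries `i + 1` in the rows up to `r` minus the number
of entries `i` in the rows above `r`. -/
def hRow (y x b : ℕ → ℕ) : ℕ → ℤ
  | 0 => b 0 - x 0
  | r + 1 => hRow y x b r + (b (r + 1) - x (r + 1)) - (x r - y r)

/-- `r` is the topmost row at which `hRow` is maximal, and the maximum is positive. -/
def IsRaiseRow (y x b : ℕ → ℕ) (r : ℕ) : Prop :=
  0 < hRow y x b r ∧ (∀ q < r, hRow y x b q < hRow y x b r) ∧ ∀ q, hRow y x b q ≤ hRow y x b r

/-- `r` is the bottommost row at which `hRow` is maximal. -/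
def IsLowerRow (y x b : ℕ → ℕ) (r : ℕ) : Prop :=
  (∀ q, hRow y x b q ≤ hRow y x b r) ∧ ∀ q > r, hRow y x b q < hRow y x b r

/-- The operator `e_{n+1}` on patterns, as a partial function: an entry `n + 2` becomes `n + 1`. -/
def Raise (n : ℕ) (L L' : Pattern) : Prop :=
  ∃ r, IsRaiseRow (L n) (L (n + 1)) (L (n + 2)) r ∧
    L' = fun k q => if k = n + 1 ∧ q = r then L k q + 1 else L k q

/-- The operator `f_{n+1}` on patterns, as a partial function: an entry `n + 1` becomes `n + 2`. -/
def Lower (n : ℕ) (L L' : Pattern) : Prop :=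
  ∃ r, IsLowerRow (L n) (L (n + 1)) (L (n + 2)) r ∧
    L' = fun k q => if k = n + 1 ∧ q = r then L k q - 1 else L k q

/-- Two consecutive horizontal strips `x / y` and `b / x`. -/
structure Strips (N : ℕ) (y x b : ℕ → ℕ) : Prop where
  yx : ∀ r, y r ≤ x r
  xb : ∀ r, x r ≤ b r
  xy : ∀ r, x (r + 1) ≤ y r
  bx : ∀ r, b (r + 1) ≤ x r
  fin : ∀ r, N ≤ r → b r = 0

theorem IsPattern.strips {N s : ℕ} {L : Pattern} (h : IsPattern N s L) (n : ℕ) :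
    Strips N (L n) (L (n + 1)) (L (n + 2)) :=
  ⟨h.up n, h.up (n + 1), h.il n, h.il (n + 1), h.fin (n + 2)⟩

theorem hRow_change {y x b y' x' b' : ℕ → ℕ} {p q t : ℕ} {α β γ : ℤ}
    (hy : ∀ r, (y' r : ℤ) = y r - if r = p then α else 0)
    (hx : ∀ r, (x' r : ℤ) = x r - if r = q then β else 0)
    (hb : ∀ r, (b' r : ℤ) = b r - if r = t then γ else 0) (j : ℕ) :
    hRow y' x' b' j = hRow y x b j - (if t ≤ j then γ else 0) + (if q ≤ j then β else 0) +
      (if q < j then β else 0) - (if p < j then α else 0) := by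
  have key : ∀ (a j : ℕ) (δ : ℤ), (if a ≤ j + 1 then δ else 0) =
      (if a ≤ j then δ else 0) + (if j + 1 = a then δ else 0) := by
    intro a j δ
    split_ifs <;> omega
  have key' : ∀ (a j : ℕ) (δ : ℤ), (if a < j + 1 then δ else 0) =
      (if a < j then δ else 0) + (if j = a then δ else 0) := by
    intro a j δ
    split_ifs <;> omega
  have key'' : ∀ (a j : ℕ) (δ : ℤ), (if a ≤ j then δ else 0) =
      (if a < j then δ else 0) + (if j = a then δ else 0) := by
    intro a j δ
    split_ifs <;> omega
  induction j with
  | zero =>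
    have h1 := hx 0
    have h2 := hb 0
    simp only [hRow, key'', Nat.not_lt_zero, if_false]
    omega
  | succ j ih =>
    have h1 := hx j
    have h2 := hx (j + 1)
    have h3 := hb (j + 1)
    have h4 := hy j
    simp only [hRow, ih, key, key', key'' q j]
    omega

namespace Strips

variable {N : ℕ} {y x b : ℕ → ℕ}

theorem xfin (h : Strips N y x b) {r : ℕ} (hr : N ≤ r) : x r = 0 := by
  have := h.xb r
  have := h.fin r hr
  omega

theorem yfin (h : Strips N y x b) {r : ℕ} (hr : N ≤ r) : y r = 0 := by
  have := h.yx r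
  have := h.xfin hr
  omega

theorem hRow_eventually (h : Strips N y x b) {r : ℕ} (hr : N ≤ r) :
    hRow y x b r = hRow y x b N := by
  induction r, hr using Nat.le_induction with
  | base => rfl
  | succ r hr ih =>
    have h1 := h.xfin hr
    have h2 := h.yfin hr
    have h3 := h.xfin (r := r + 1) (by omega)
    have h4 := h.fin (r + 1) (by omega)
    simp only [hRow]
    omega

/-- A row at which `hRow` is maximal. -/
theorem exists_max (h : Strips N y x b) : ∃ r ≤ N, ∀ q, hRow y x b q ≤ hRow y x b r := by
  obtain ⟨r, hr, hmax⟩ := Finset.exists_max_image (Finset.range (N + 1)) (hRow y x b) ⟨0, by simp⟩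
  refine ⟨r, by simpa [Nat.lt_succ_iff] using hr, fun q => ?_⟩
  rcases le_total N q with hq | hq
  · rw [h.hRow_eventually hq]; exact hmax N (by simp)
  · exact hmax q (by simpa [Nat.lt_succ_iff] using hq)

theorem exists_raiseRow_iff (h : Strips N y x b) :
    (∃ r, IsRaiseRow y x b r) ↔ ∃ j, 0 < hRow y x b j := by
  constructor
  · rintro ⟨r, hr⟩
    exact ⟨r, hr.1⟩
  · rintro ⟨j, hj⟩
    obtain ⟨r, -, hr⟩ := h.exists_max
    have hex : ∃ r, ∀ q, hRow y x b q ≤ hRow y x b r := ⟨r, hr⟩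
    classical
    refine ⟨Nat.find hex, hj.trans_le (Nat.find_spec hex j), fun q hq => ?_, Nat.find_spec hex⟩
    by_contra hc
    exact Nat.find_min hex hq fun q' => (Nat.find_spec hex q').trans (not_lt.1 hc)

theorem exists_lowerRow_iff (h : Strips N y x b) :
    (∃ r, IsLowerRow y x b r) ↔ ∃ j, ∀ q ≥ N, hRow y x b q < hRow y x b j := by
  constructor
  · rintro ⟨r, hr⟩
    refine ⟨r, fun q hq => ?_⟩
    rw [h.hRow_eventually hq, ← h.hRow_eventually (r := max N (r + 1)) (by omega)]
    exact hr.2 _ (by omega)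
  · rintro ⟨j, hj⟩
    obtain ⟨r, hrN, hr⟩ := h.exists_max
    classical
    set P : ℕ → Prop := fun r => ∀ q, hRow y x b q ≤ hRow y x b r
    have hspec : P (Nat.findGreatest P N) := Nat.findGreatest_spec hrN hr
    refine ⟨Nat.findGreatest P N, hspec, fun q hq => ?_⟩
    rcases le_total N q with hqN | hqN
    · exact (hj q hqN).trans_le (hspec j)
    · by_contra hc
      exact Nat.findGreatest_is_greatest hq hqN fun q' => (hspec q').trans (not_lt.1 hc)

theorem hRow_nonneg_of_max (h : Strips N y x b) {r : ℕ} (hr : ∀ q, hRow y x b q ≤ hRow y x b r) :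
    0 ≤ hRow y x b r := by
  have h1 := hr 0
  have h2 := h.xb 0
  simp only [hRow] at h1
  omega

/-- The box changed by a raising operator can be changed without leaving the semistandard
fillings. -/
theorem raise_bounds (h : Strips N y x b) {r : ℕ} (hr : IsRaiseRow y x b r) :
    x r < b r ∧ ∀ q, r = q + 1 → x r < y q := by
  cases r with
  | zero =>
    have := hr.1
    simp only [hRow] at this
    exact ⟨by omega, fun q hq => by omega⟩
  | succ r =>
    have h1 := hr.2.1 r (by omega)
    have h2 := h.yx r
    have h3 := h.bx r
    simp only [hRow] at h1
    refine ⟨by omega, fun q hq => ?_⟩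
    obtain rfl : r = q := by omega
    omega

theorem lower_bounds (h : Strips N y x b) {r : ℕ} (hr : IsLowerRow y x b r) :
    y r < x r ∧ b (r + 1) < x r := by
  have h1 := hr.2 (r + 1) (by omega)
  have h2 := h.xy r
  have h3 := h.xb (r + 1)
  simp only [hRow] at h1
  omega

end Strips

theorem Lower.raise {N s n : ℕ} {L L' : Pattern} (h : IsPattern N s L) (hn : n + 1 < s)
    (hL : Lower n L L') : IsPattern N s L' ∧ Raise n L' L := by
  obtain ⟨r, hr, rfl⟩ := hL
  have hst := h.strips n
  obtain ⟨b1, b2⟩ := hst.lower_bounds hr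
  refine ⟨⟨fun k q => ?_, fun k q => ?_, fun k q hk => ?_, fun k q hq => ?_⟩, r, ?_, ?_⟩
  · have h1 := h.up k q
    split_ifs with c1 c2 c2
    · omega
    · omega
    · obtain ⟨h2, rfl⟩ := c2
      obtain rfl : k = n := by omega
      omega
    · omega
  · have h1 := h.il k q
    split_ifs with c1 c2 c2
    · omega
    · omega
    · obtain ⟨rfl, rfl⟩ := c2
      have : L (n + 2) (q + 1) = L (n + 1 + 1) (q + 1) := rfl
      omega
    · omega
  · simp only [show k ≠ n + 1 by omega, show s ≠ n + 1 by omega, false_and, if_false]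
    exact h.stab k q hk
  · have := h.fin k q hq
    split_ifs <;> omega
  · have key := hRow_change (y := L n) (x := L (n + 1)) (b := L (n + 2)) (y' := L n)
      (x' := fun q => if q = r then L (n + 1) q - 1 else L (n + 1) q) (b' := L (n + 2))
      (p := 0) (q := r) (t := 0) (α := 0) (β := 1) (γ := 0) (by simp) (fun q => by
        split_ifs with hq
        · subst hq; omega
        · omega) (by simp)
    have h0 := hst.hRow_nonneg_of_max hr.1
    simp only [IsRaiseRow, show ¬ n = n + 1 by omega, show ¬ n + 2 = n + 1 by omega, false_and,
      if_false, true_and, key, lt_irrefl, le_refl, if_true, ite_self]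
    refine ⟨by omega, fun q hq => ?_, fun q => ?_⟩
    · have := hr.1 q
      split_ifs <;> omega
    · have h1 := hr.1 q
      have h2 := hr.2 q
      split_ifs <;> omega
  · funext k q
    beta_reduce
    split_ifs with c
    · obtain ⟨rfl, rfl⟩ := c
      omega
    · rfl

theorem Raise.lower {N s n : ℕ} {L L' : Pattern} (h : IsPattern N s L) (hn : n + 1 < s)
    (hL : Raise n L L') : IsPattern N s L' ∧ Lower n L' L := by
  obtain ⟨r, hr, rfl⟩ := hL
  have hst := h.strips n
  obtain ⟨b1, b2⟩ := hst.raise_bounds hr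
  refine ⟨⟨fun k q => ?_, fun k q => ?_, fun k q hk => ?_, fun k q hq => ?_⟩, r, ?_, ?_⟩
  · have h1 := h.up k q
    split_ifs with c1 c2 c2
    · omega
    · obtain ⟨rfl, rfl⟩ := c1
      exact b1
    · omega
    · omega
  · have h1 := h.il k q
    split_ifs with c1 c2 c2
    · omega
    · obtain ⟨h2, h3⟩ := c1
      obtain rfl : k = n := by omega
      have := b2 q h3.symm
      rw [← h3] at this
      omega
    · omega
    · omega
  · simp only [show k ≠ n + 1 by omega, show s ≠ n + 1 by omega, false_and, if_false]
    exact h.stab k q hk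
  · have h1 := h.fin k q hq
    split_ifs with c
    · obtain ⟨rfl, rfl⟩ := c
      have := h.fin (n + 2) q hq
      omega
    · exact h1
  · have key := hRow_change (y := L n) (x := L (n + 1)) (b := L (n + 2)) (y' := L n)
      (x' := fun q => if q = r then L (n + 1) q + 1 else L (n + 1) q) (b' := L (n + 2))
      (p := 0) (q := r) (t := 0) (α := 0) (β := -1) (γ := 0) (by simp) (fun q => by
        split_ifs with hq <;> push_cast <;> omega) (by simp)
    simp only [IsLowerRow, show ¬ n = n + 1 by omega, show ¬ n + 2 = n + 1 by omega, false_and,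
      if_false, true_and, key, lt_irrefl, le_refl, if_true, ite_self]
    refine ⟨fun q => ?_, fun q hq => ?_⟩
    · have h1 := hr.2.2 q
      have h2 := hr.2.1 q
      split_ifs <;> omega
    · have := hr.2.2 q
      split_ifs <;> omega
  · funext k q
    beta_reduce
    split_ifs with c
    · omega
    · rfl

theorem Raise.unique {n : ℕ} {L A B : Pattern} (hA : Raise n L A) (hB : Raise n L B) : A = B := by
  obtain ⟨r, hr, rfl⟩ := hA
  obtain ⟨r', hr', rfl⟩ := hB
  obtain rfl : r = r' := by
    rcases lt_trichotomy r r' with h | h | h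
    · exact absurd (hr'.2.1 r h) (not_lt.2 (hr.2.2 r'))
    · exact h
    · exact absurd (hr.2.1 r' h) (not_lt.2 (hr'.2.2 r))
  rfl

theorem Lower.unique {n : ℕ} {L A B : Pattern} (hA : Lower n L A) (hB : Lower n L B) : A = B := by
  obtain ⟨r, hr, rfl⟩ := hA
  obtain ⟨r', hr', rfl⟩ := hB
  obtain rfl : r = r' := by
    rcases lt_trichotomy r r' with h | h | h
    · exact absurd (hr.2 r' h) (not_lt.2 (hr'.1 r))
    · exact h
    · exact absurd (hr'.2 r h) (not_lt.2 (hr.1 r'))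
  rfl

/-! ### Crystal operators commute with slides -/

/-- The effect of a slide on three consecutive levels: the empty box is in row `p`, `q`, `t` after
passing the levels `y`, `x`, `b`. -/
structure SlideRows (y x b : ℕ → ℕ) (p q t : ℕ) : Prop where
  cy : y (p + 1) < y p
  cx : x (q + 1) < x q
  cb : b (t + 1) < b t
  q_eq : q = if x (p + 1) = y p then p + 1 else p
  t_eq : t = if b (q + 1) = x q then q + 1 else q

theorem IsPattern.slideRows {N s : ℕ} {L : Pattern} (h : IsPattern N s L) {p : ℕ}
    (hp : L 0 (p + 1) < L 0 p) (n : ℕ) :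
    SlideRows (L n) (L (n + 1)) (L (n + 2)) (slideRow L p n) (slideRow L p (n + 1))
      (slideRow L p (n + 2)) :=
  ⟨slideRow_corner h hp n, slideRow_corner h hp _, slideRow_corner h hp _, rfl, rfl⟩

theorem removeBox_cast {x : ℕ → ℕ} {q : ℕ} (h : 0 < x q) (r : ℕ) :
    (removeBox q x r : ℤ) = x r - if r = q then 1 else 0 := by
  simp only [removeBox]
  split_ifs with hr
  · subst hr; omega
  · omega

/-- A slide changes `hRow` at most in one row. -/
theorem SlideRows.hRow_removeBox {y x b : ℕ → ℕ} {p q t : ℕ} (h : SlideRows y x b p q t) (j : ℕ) :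
    hRow (removeBox p y) (removeBox q x) (removeBox t b) j =
      hRow y x b j + if j = q then (t - q : ℤ) - (q - p : ℤ) else 0 := by
  have hc1 := h.cy
  have hc2 := h.cx
  have hc3 := h.cb
  rw [hRow_change (removeBox_cast (x := y) (q := p) (by omega))
    (removeBox_cast (x := x) (q := q) (by omega)) (removeBox_cast (x := b) (q := t) (by omega))]
  have h1 := h.q_eq
  have h2 := h.t_eq
  split_ifs at h1 h2 <;> subst h2 <;> split_ifs <;> omega

/-- Lowering the middle level commutes with a slide: the slide enters and leaves the two strips in
the same rows, and the lowered row changes only when the empty box passes it. -/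
theorem SlideRows.lower {N : ℕ} {y x b : ℕ → ℕ} {p q t : ℕ} (h : SlideRows y x b p q t)
    (hs : Strips N y x b) {r : ℕ} (hr : IsLowerRow y x b r) :
    ∃ q' r', SlideRows y (removeBox r x) b p q' t ∧
      IsLowerRow (removeBox p y) (removeBox q x) (removeBox t b) r' ∧
      removeBox q' (removeBox r x) = removeBox r' (removeBox q x) := by
  obtain ⟨b1, b2⟩ := hs.lower_bounds hr
  have hc1 := h.cy
  have hc2 := h.cx
  have hc3 := h.cb
  have h1 := h.q_eq
  have h2 := h.t_eq
  have hq1 := hr.2 (q + 1)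
  have hq0 := hr.1 (q + 1)
  have e1 : hRow y x b (q + 1) = hRow y x b q + (b (q + 1) - x (q + 1)) - (x q - y q) := rfl
  have e0 : hRow y x b (p + 1) = hRow y x b p + (b (p + 1) - x (p + 1)) - (x p - y p) := rfl
  have i1 := hs.yx p
  have i2 := hs.xb (p + 1)
  have i3 := hs.xy q
  have i4 := hs.bx p
  have i5 := hs.xb q
  have i6 := hs.yx q
  by_cases hspecial : q = p + 1 ∧ t = q ∧ r = q
  · -- the empty box moves down past the lowered entry
    obtain ⟨rfl, rfl, rfl⟩ := hspecial
    have hp := hr.1 p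
    have hxy : x (p + 1) = y p := by
      by_contra hc
      rw [if_neg hc] at h1
      omega
    refine ⟨p, p, ⟨hc1, ?_, hc3, ?_, ?_⟩, ⟨fun j => ?_, fun j hj => ?_⟩, ?_⟩
    · simp only [removeBox]
      split_ifs <;> omega
    · simp only [removeBox, if_true]
      split_ifs <;> omega
    · simp only [removeBox]
      split_ifs <;> omega
    · rw [h.hRow_removeBox, h.hRow_removeBox]
      have := hr.1 j
      split_ifs <;> push_cast <;> omega
    · rw [h.hRow_removeBox, h.hRow_removeBox]
      have := hr.1 j
      have := hr.2 j
      split_ifs <;> push_cast <;> omega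
    · rfl
  · have i7 := hs.xb (q + 1)
    refine ⟨q, r, ⟨hc1, ?_, hc3, ?_, ?_⟩, ⟨fun j => ?_, fun j hj => ?_⟩, ?_⟩
    · simp only [removeBox]
      split_ifs at h1 h2 ⊢ <;> subst_vars <;> omega
    · simp only [removeBox]
      split_ifs at h1 h2 ⊢ <;> subst_vars <;> omega
    · simp only [removeBox]
      split_ifs at h1 h2 ⊢ <;> subst_vars <;> omega
    · rw [h.hRow_removeBox, h.hRow_removeBox]
      have g1 := hr.1 j
      split_ifs at h1 h2 <;> split_ifs <;> subst_vars <;> push_cast <;> omega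
    · rw [h.hRow_removeBox, h.hRow_removeBox]
      have g1 := hr.2 j hj
      split_ifs at h1 h2 <;> split_ifs <;> subst_vars <;> push_cast <;> omega
    · funext j
      simp only [removeBox]
      split_ifs <;> omega

theorem slideRow_congr {L L' : Pattern} {p k : ℕ} (h : ∀ j ≤ k, L j = L' j) :
    slideRow L p k = slideRow L' p k := by
  induction k with
  | zero => rfl
  | succ k ih =>
    simp only [slideRow, ih fun j hj => h j (by omega), h (k + 1) le_rfl, h k (by omega)]

theorem slideRow_eq_of_lower {n p : ℕ} {L L' : Pattern} (hL : ∀ k, k ≠ n + 1 → L' k = L k)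
    (h2 : slideRow L' p (n + 2) = slideRow L p (n + 2)) (k : ℕ) (hk : k ≠ n + 1) :
    slideRow L' p k = slideRow L p k := by
  rcases lt_or_gt_of_ne hk with h | h
  · exact slideRow_congr fun j hj => hL j (by omega)
  · induction k, (show n + 2 ≤ k by omega) using Nat.le_induction with
    | base => exact h2
    | succ k hk' ih =>
      simp only [slideRow, ih (by omega) (by omega), hL k (by omega), hL (k + 1) (by omega)]

theorem Lower.pSlide {N s n p : ℕ} {L L' : Pattern} (h : IsPattern N s L)
    (hp : L 0 (p + 1) < L 0 p) (hL : Lower n L L') :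
    Lower n (pSlide p L) (pSlide p L') := by
  obtain ⟨r, hr, hL'⟩ := hL
  obtain ⟨q', r', h1, h2, h3⟩ := (h.slideRows hp n).lower (h.strips n) hr
  have hlev : ∀ k, k ≠ n + 1 → L' k = L k := by
    intro k hk
    subst hL'
    funext q
    simp [hk]
  have hmid : L' (n + 1) = removeBox r (L (n + 1)) := by
    subst hL'
    funext q
    simp [removeBox]
  have hn : slideRow L' p n = slideRow L p n :=
    slideRow_congr fun j hj => hlev j (by omega)
  have hq' : slideRow L' p (n + 1) = q' := by
    rw [slideRow, hn, hmid, hlev n (by omega), h1.q_eq]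
  have ht' : slideRow L' p (n + 2) = slideRow L p (n + 2) := by
    rw [slideRow, hq', hmid, hlev (n + 2) (by omega)]
    exact h1.t_eq.symm
  refine ⟨r', h2, ?_⟩
  funext k j
  by_cases hk : k = n + 1
  · subst hk
    have := congrFun h3 j
    simp only [removeBox] at this
    simp only [EvacCrystal.pSlide, hq', hmid, removeBox, true_and]
    exact this
  · simp only [EvacCrystal.pSlide, hk, false_and, if_false, hlev k hk,
      slideRow_eq_of_lower hlev ht' k hk]

theorem Raise.pSlide {N s n p : ℕ} {L L' : Pattern} (h : IsPattern N s L) (hn : n + 1 < s)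
    (hp : L 0 (p + 1) < L 0 p) (hL : Raise n L L') : Raise n (pSlide p L) (pSlide p L') := by
  obtain ⟨h1, h2⟩ := hL.lower h hn
  have h0 : L' 0 = L 0 := by
    obtain ⟨r, -, rfl⟩ := hL
    rfl
  exact ((h2.pSlide h1 (by rwa [h0])).raise (h1.pSlide (by rwa [h0])) hn).2

theorem Raise.exists_of_pSlide {N s n p : ℕ} {L M : Pattern} (h : IsPattern N s L)
    (hp : L 0 (p + 1) < L 0 p) (hM : Raise n (EvacCrystal.pSlide p L) M) : ∃ L', Raise n L L' := by
  obtain ⟨r, hr, -⟩ := hM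
  have hs := h.slideRows hp n
  have hst := h.strips n
  suffices ∃ r, IsRaiseRow (L n) (L (n + 1)) (L (n + 2)) r by
    obtain ⟨r, hr⟩ := this
    exact ⟨_, r, hr, rfl⟩
  rw [hst.exists_raiseRow_iff]
  have h1 : 0 < hRow (removeBox (slideRow L p n) (L n))
    (removeBox (slideRow L p (n + 1)) (L (n + 1)))
    (removeBox (slideRow L p (n + 2)) (L (n + 2))) r := hr.1
  rw [hs.hRow_removeBox] at h1
  generalize slideRow L p n = a at *
  generalize slideRow L p (n + 1) = q at *
  generalize slideRow L p (n + 2) = t at *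
  by_contra! hc
  have g1 := hc r
  have g2 := hc (q + 1)
  have e1 : hRow (L n) (L (n + 1)) (L (n + 2)) (q + 1) = hRow (L n) (L (n + 1)) (L (n + 2)) q +
    (L (n + 2) (q + 1) - L (n + 1) (q + 1)) - (L (n + 1) q - L n q) := rfl
  have c1 := hs.q_eq
  have c2 := hs.t_eq
  have i1 := hst.xy q
  split_ifs at c1 c2 <;> split_ifs at h1 <;> subst_vars <;> push_cast at * <;> omega

theorem Lower.exists_of_pSlide {N s n p : ℕ} {L M : Pattern} (h : IsPattern N s L)
    (hp : L 0 (p + 1) < L 0 p) (hM : Lower n (EvacCrystal.pSlide p L) M) : ∃ L', Lower n L L' := by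
  obtain ⟨r, hr, -⟩ := hM
  have hs := h.slideRows hp n
  have hst := h.strips n
  suffices ∃ r, IsLowerRow (L n) (L (n + 1)) (L (n + 2)) r by
    obtain ⟨r, hr⟩ := this
    exact ⟨_, r, hr, rfl⟩
  rw [hst.exists_lowerRow_iff]
  have h1 : ∀ j > r, hRow (removeBox (slideRow L p n) (L n))
    (removeBox (slideRow L p (n + 1)) (L (n + 1)))
    (removeBox (slideRow L p (n + 2)) (L (n + 2))) j < hRow (removeBox (slideRow L p n) (L n))
    (removeBox (slideRow L p (n + 1)) (L (n + 1)))
    (removeBox (slideRow L p (n + 2)) (L (n + 2))) r := hr.2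
  simp only [hs.hRow_removeBox] at h1
  generalize slideRow L p n = a at *
  generalize slideRow L p (n + 1) = q at *
  generalize slideRow L p (n + 2) = t at *
  by_contra! hc
  obtain ⟨j, hj, g1⟩ := hc r
  obtain ⟨j', hj', g2⟩ := hc (q + 1)
  have e1 : hRow (L n) (L (n + 1)) (L (n + 2)) (q + 1) = hRow (L n) (L (n + 1)) (L (n + 2)) q +
    (L (n + 2) (q + 1) - L (n + 1) (q + 1)) - (L (n + 1) q - L n q) := rfl
  have c1 := hs.q_eq
  have c2 := hs.t_eq
  have i1 := hst.xy q
  have g3 := h1 (max N (max r q) + 1) (by omega)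
  have g4 := hst.hRow_eventually hj
  have g5 := hst.hRow_eventually hj'
  have g6 := hst.hRow_eventually (r := max N (max r q) + 1) (by omega)
  rw [if_neg (by omega)] at g3
  split_ifs at c1 c2 <;> split_ifs at g3 <;> subst_vars <;> push_cast at * <;> omega

/-- The operators `e_{n+1}` (for `true`) and `f_{n+1}` (for `false`) as partial functions on
patterns. -/
def Step : Bool → ℕ → Pattern → Pattern → Prop
  | true => Raise
  | false => Lower

namespace Step

variable {N s n : ℕ} {d : Bool} {L L' : Pattern}

theorem symm (h : IsPattern N s L) (hn : n + 1 < s) (hL : Step d n L L') :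
    IsPattern N s L' ∧ Step (!d) n L' L := by
  cases d
  · exact Lower.raise h hn hL
  · exact Raise.lower h hn hL

theorem symm_iff (h : IsPattern N s L) (h' : IsPattern N s L') (hn : n + 1 < s) :
    Step d n L L' ↔ Step (!d) n L' L :=
  ⟨fun hL => (hL.symm h hn).2, fun hL => by simpa using (hL.symm h' hn).2⟩

theorem unique {A B : Pattern} (hA : Step d n L A) (hB : Step d n L B) : A = B := by
  cases d
  · exact Lower.unique hA hB
  · exact Raise.unique hA hB

theorem level (hL : Step d n L L') {k : ℕ} (hk : k ≠ n + 1) : L' k = L k := by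
  cases d <;> obtain ⟨r, -, rfl⟩ := hL <;> simp [hk]

theorem pSlide {p : ℕ} (h : IsPattern N s L) (hn : n + 1 < s) (hp : L 0 (p + 1) < L 0 p)
    (hL : Step d n L L') : Step d n (EvacCrystal.pSlide p L) (EvacCrystal.pSlide p L') := by
  cases d
  · exact Lower.pSlide h hp hL
  · exact Raise.pSlide h hn hp hL

theorem exists_of_pSlide {p : ℕ} {M : Pattern} (h : IsPattern N s L) (hp : L 0 (p + 1) < L 0 p)
    (hM : Step d n (EvacCrystal.pSlide p L) M) : ∃ L', Step d n L L' := by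
  cases d
  · exact Lower.exists_of_pSlide h hp hM
  · exact Raise.exists_of_pSlide h hp hM

/-- A step involves only the levels `n`, `n + 1`, `n + 2`. -/
theorem congr {A A' : Pattern} (hL : Step d n L L') (h0 : A n = L n) (h1 : A (n + 1) = L (n + 1))
    (h2 : A (n + 2) = L (n + 2)) (h1' : A' (n + 1) = L' (n + 1))
    (hA : ∀ k, k ≠ n + 1 → A' k = A k) : Step d n A A' := by
  cases d <;> obtain ⟨r, hr, rfl⟩ := hL <;>
  · refine ⟨r, by rwa [h0, h1, h2], ?_⟩
    funext k q
    by_cases hk : k = n + 1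
    · subst hk
      simp [h1', h1]
    · simp [hk, hA k hk]

theorem shift {k : ℕ} (hL : Step d (n + k) L L') :
    Step d n (EvacCrystal.shift k L) (EvacCrystal.shift k L') := by
  have e1 : n + 1 + k = n + k + 1 := by omega
  have e2 : n + 2 + k = n + k + 2 := by omega
  cases d <;> obtain ⟨r, hr, rfl⟩ := hL <;>
  · refine ⟨r, by simpa only [EvacCrystal.shift, e1, e2] using hr, ?_⟩
    funext j q
    simp only [EvacCrystal.shift, show j + k = n + k + 1 ↔ j = n + 1 by omega]

theorem of_shift {k : ℕ} {M : Pattern} (hM : Step d n (EvacCrystal.shift k L) M) :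
    ∃ L', Step d (n + k) L L' ∧ M = EvacCrystal.shift k L' := by
  have e1 : n + 1 + k = n + k + 1 := by omega
  have e2 : n + 2 + k = n + k + 2 := by omega
  cases d <;> obtain ⟨r, hr, rfl⟩ := hM <;>
  · refine ⟨_, ⟨r, by simpa only [EvacCrystal.shift, e1, e2] using hr, rfl⟩, ?_⟩
    funext j q
    simp only [EvacCrystal.shift, show j + k = n + k + 1 ↔ j = n + 1 by omega]

theorem slides {l : List ℕ} (h : IsPattern N s L) (hn : n + 1 < s) (hl : Exhausts l (L 0))
    (hL : Step d n L L') : Step d n (EvacCrystal.slides l L) (EvacCrystal.slides l L') := by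
  induction l generalizing L L' with
  | nil => exact hL
  | cons p l ih => exact ih (h.pSlide hl.1) (by rw [pSlide_zero]; exact hl.2) (hL.pSlide h hn hl.1)

theorem of_slides {l : List ℕ} {M : Pattern} (h : IsPattern N s L) (hn : n + 1 < s)
    (hl : Exhausts l (L 0)) (hM : Step d n (EvacCrystal.slides l L) M) :
    ∃ L', Step d n L L' ∧ M = EvacCrystal.slides l L' := by
  suffices ∃ L', Step d n L L' by
    obtain ⟨L', hL'⟩ := this
    exact ⟨L', hL', hM.unique (hL'.slides h hn hl)⟩
  induction l generalizing L with
  | nil => exact ⟨M, hM⟩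
  | cons p l ih =>
    obtain ⟨L', hL'⟩ := ih (h.pSlide hl.1) (by rw [pSlide_zero]; exact hl.2) hM
    exact exists_of_pSlide h hl.1 hL'

end Step

theorem Raise.size {N s n : ℕ} {L L' : Pattern} (h : IsPattern N s L) (hL : Raise n L L') (k : ℕ) :
    size N L' k = size N L k + if k = n + 1 then 1 else 0 := by
  obtain ⟨r, hr, rfl⟩ := hL
  have hb := ((h.strips n).raise_bounds hr).1
  have hrN : r < N := by
    by_contra hc
    have := h.fin (n + 2) r (by omega)
    omega
  have : ∀ q, (if k = n + 1 ∧ q = r then L k q + 1 else L k q) =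
      L k q + if q = r then (if k = n + 1 then 1 else 0) else 0 := by
    intro q
    split_ifs <;> omega
  simp only [EvacCrystal.size, this, Finset.sum_add_distrib, Finset.sum_ite_eq', Finset.mem_range,
    hrN, if_true]

theorem size_mono {N s : ℕ} {L : Pattern} (h : IsPattern N s L) {k : ℕ} (hk : k ≤ s) :
    size N L k ≤ size N L s :=
  Finset.sum_le_sum fun r _ => h.mono r hk

/-- The sum of all entries of the Gelfand–Tsetlin pattern; raising operators increase it. -/
def potential (N s : ℕ) (L : Pattern) : ℕ := ∑ k ∈ Finset.range s, size N L k

theorem potential_le {N s : ℕ} {L : Pattern} (h : IsPattern N s L) :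
    potential N s L ≤ s * size N L s := by
  have := Finset.sum_le_card_nsmul (Finset.range s) (size N L) (size N L s) fun k hk =>
    size_mono h (Finset.mem_range.1 hk).le
  simpa [potential] using this

theorem Raise.potential {N s n : ℕ} {L L' : Pattern} (h : IsPattern N s L) (hn : n + 1 < s)
    (hL : Raise n L L') : potential N s L' = potential N s L + 1 := by
  simp [EvacCrystal.potential, hL.size h, Finset.sum_add_distrib, hn]

/-! ### Extremal patterns and confluence of slides -/

/-- In a straight pattern without raisable entries, row `r` contains only the entry `r + 1`. -/
theorem highest_form {N s : ℕ} {A : Pattern} (h : IsPattern N s A)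
    (hA : ∀ n M, n + 1 < s → ¬ Raise n A M) {k r : ℕ} (hr : r < k) (hk : k ≤ s) :
    A k r = A s r := by
  have key : ∀ i, i < s → ∀ r < i, A i r = A (i + 1) r := by
    intro i
    induction i with
    | zero => intro _ r hr; omega
    | succ n ih =>
      intro hn
      have hst := h.strips n
      have hneg : ∀ j, hRow (A n) (A (n + 1)) (A (n + 2)) j ≤ 0 := by
        intro j
        by_contra! hc
        obtain ⟨r, hr⟩ := hst.exists_raiseRow_iff.2 ⟨j, hc⟩
        exact hA n _ hn ⟨r, hr, rfl⟩
      have main : ∀ r < n + 1, A (n + 1) r = A (n + 2) r ∧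
          hRow (A n) (A (n + 1)) (A (n + 2)) r = 0 := by
        intro r
        induction r with
        | zero =>
          intro _
          have h1 := hneg 0
          have h2 := hst.xb 0
          simp only [hRow] at h1 ⊢
          omega
        | succ r ihr =>
          intro hr
          obtain ⟨h1, h2⟩ := ihr (by omega)
          have h3 := hneg (r + 1)
          have h4 := hst.xb (r + 1)
          have h5 := ih (by omega) r (by omega)
          simp only [hRow] at h3 ⊢
          omega
      exact fun r hr => (main r hr).1
  induction hk using Nat.decreasingInduction with
  | self => rfl
  | of_succ k hk ih => rw [key k hk r hr, ih (by omega)]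

/-- In a straight pattern without lowerable entries, each column is filled with the greatest
possible entries. -/
theorem lowest_form {N s : ℕ} {A : Pattern} (h : IsPattern N s A) (h0 : A 0 = 0)
    (hA : ∀ n M, n + 1 < s → ¬ Lower n A M) {k : ℕ} (r : ℕ) (hk : k ≤ s) :
    A k r = A s (r + (s - k)) := by
  have key : ∀ i, i < s → ∀ r, A i r = A (i + 1) (r + 1) := by
    intro i
    induction i with
    | zero =>
      intro _ r
      rw [h.eq_zero h0 1 (r + 1) (by omega), h0]
      rfl
    | succ n ih =>
      intro hn
      have hst := h.strips n
      have hmax : ∀ j, hRow (A n) (A (n + 1)) (A (n + 2)) j ≤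
          hRow (A n) (A (n + 1)) (A (n + 2)) N := by
        intro j
        by_contra! hc
        obtain ⟨r, hr⟩ := hst.exists_lowerRow_iff.2
          ⟨j, fun q hq => by rwa [hst.hRow_eventually hq]⟩
        exact hA n _ hn ⟨r, hr, rfl⟩
      have hstep : ∀ r, hRow (A n) (A (n + 1)) (A (n + 2)) (r + 1) =
          hRow (A n) (A (n + 1)) (A (n + 2)) r + (A (n + 2) (r + 1) - A (n + 1) r) := by
        intro r
        have := ih (by omega) r
        simp only [hRow]
        omega
      have hanti : Antitone (hRow (A n) (A (n + 1)) (A (n + 2))) :=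
        antitone_nat_of_succ_le fun r => by
          have := hst.bx r
          rw [hstep]
          omega
      intro r
      have h1 := hmax r
      have h2 := hst.hRow_eventually (r := max N (r + 1)) (by omega)
      have h3 := hanti (show r + 1 ≤ max N (r + 1) by omega)
      have h4 := hstep r
      have h5 := hst.bx r
      have h6 : A (n + 1 + 1) (r + 1) = A (n + 2) (r + 1) := rfl
      omega
  induction hk using Nat.decreasingInduction generalizing r with
  | self => simp
  | of_succ k hk ih =>
    rw [key k hk r, ih (r + 1)]
    congr 1
    omega

/-- The content of a highest weight pattern is its shape. -/
theorem size_succ_of_highest {N s : ℕ} {A : Pattern} (h : IsPattern N s A) (h0 : A 0 = 0)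
    (hA : ∀ k r, r < k → k ≤ s → A k r = A s r) {r : ℕ} (hr : r < s) :
    size N A (r + 1) = size N A r + A s r := by
  have key : ∀ q, A (r + 1) q = A r q + if q = r then A s r else 0 := by
    intro q
    rcases lt_trichotomy q r with hq | rfl | hq
    · rw [if_neg hq.ne, hA _ q (by omega) hr, hA _ q hq hr.le, add_zero]
    · rw [if_pos rfl, hA _ q (by omega) hr, h.eq_zero h0 q q le_rfl, zero_add]
    · rw [if_neg hq.ne', h.eq_zero h0 (r + 1) q hq, h.eq_zero h0 r q hq.le]
  simp only [size, key, Finset.sum_add_distrib, Finset.sum_ite_eq', Finset.mem_range]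
  split_ifs with hN
  · rfl
  · rw [h.fin s r (by omega)]

/-- A relation that is compatible with contents and raising operators relates a straight pattern
only to itself, since highest weight patterns are determined by their content. -/
theorem eq_of_bisimulation {N s : ℕ} (R : Pattern → Pattern → Prop)
    (hR : ∀ A B, R A B → IsPattern N s A ∧ IsPattern N s B ∧ A 0 = 0 ∧ B 0 = 0 ∧
      ∀ k, size N A k = size N B k)
    (hstep : ∀ A B, R A B → ∀ n, n + 1 < s →
      (∀ A', Raise n A A' → ∃ B', Raise n B B' ∧ R A' B') ∧
      ∀ B', Raise n B B' → ∃ A', Raise n A A') {A B : Pattern} (hAB : R A B) : A = B := by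
  induction hd : s * size N A s - potential N s A using Nat.strong_induction_on
    generalizing A B with
  | _ d ih =>
    obtain ⟨pA, pB, zA, zB, hsize⟩ := hR A B hAB
    by_cases hex : ∃ n A', n + 1 < s ∧ Raise n A A'
    · obtain ⟨n, A', hn, hA'⟩ := hex
      obtain ⟨B', hB', hAB'⟩ := (hstep A B hAB n hn).1 A' hA'
      have pA' := (hA'.lower pA hn).1
      have h1 := potential_le pA'
      have h2 := hA'.potential pA hn
      have h3 := hA'.size pA s
      rw [if_neg (by omega), add_zero] at h3
      rw [h3] at h1
      have := ih _ (by rw [h3]; omega) hAB' rfl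
      subst this
      exact (hA'.lower pA hn).2.unique (hB'.lower pB hn).2
    · push Not at hex
      have fA := fun k r => highest_form pA (fun n M hn hM => hex n M hn hM) (k := k) (r := r)
      have fB := fun k r => highest_form pB (fun n M hn hM => by
        obtain ⟨A', hA'⟩ := (hstep A B hAB n hn).2 M hM
        exact hex n A' hn hA') (k := k) (r := r)
      have htop : ∀ r, A s r = B s r := by
        intro r
        rcases lt_or_ge r s with hr | hr
        · have h1 := size_succ_of_highest pA zA fA hr
          have h2 := size_succ_of_highest pB zB fB hr
          have h3 := hsize r
          have h4 := hsize (r + 1)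
          omega
        · rw [pA.eq_zero zA s r hr, pB.eq_zero zB s r hr]
      funext k r
      rcases le_total s k with hk | hk
      · rw [pA.stab k r hk, pB.stab k r hk, htop]
      · rcases lt_or_ge r k with hr | hr
        · rw [fA k r hr hk, fB k r hr hk, htop]
        · rw [pA.eq_zero zA k r hr, pB.eq_zero zB k r hr]

theorem shift_zero (k : ℕ) (L : Pattern) : shift k L 0 = L k := by
  simp [shift]

/-- Rectifying before forgetting the small entries does not change the rectification of the rest,
and the rectification does not depend on the order of the slides. -/
theorem slides_shift_slides {N s k : ℕ} {L : Pattern} {l l₁ l₂ : List ℕ} (h : IsPattern N s L)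
    (hl : Exhausts l (L 0)) (h₁ : Exhausts l₁ (slides l L k)) (h₂ : Exhausts l₂ (L k)) :
    slides l₁ (shift k (slides l L)) = slides l₂ (shift k L) := by
  refine eq_of_bisimulation (N := N) (s := s - k) (fun A B => ∃ M : Pattern, IsPattern N s M ∧
    M 0 = L 0 ∧ M k = L k ∧ slides l M k = slides l L k ∧
    A = slides l₁ (shift k (slides l M)) ∧ B = slides l₂ (shift k M)) ?_ ?_
    ⟨L, h, rfl, rfl, rfl, rfl, rfl⟩
  · rintro _ _ ⟨M, hM, e0, ek, ek', rfl, rfl⟩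
    have g := hM.slides (l := l) (by rwa [e0])
    have g₁ : Exhausts l₁ (shift k (slides l M) 0) := by rwa [shift_zero, ek']
    have g₂ : Exhausts l₂ (shift k M 0) := by rwa [shift_zero, ek]
    refine ⟨g.shift.slides g₁, hM.shift.slides g₂, slides_zero g₁, slides_zero g₂, fun j => ?_⟩
    have s1 := size_slides g.shift g₁ j
    have s2 := size_slides hM.shift g₂ j
    have s3 := size_slides hM (l := l) (by rwa [e0]) (j + k)
    have s4 := size_slides hM (l := l) (by rwa [e0]) k
    simp only [size, shift, zero_add] at s1 s2 s3 s4 ⊢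
    omega
  · rintro _ _ ⟨M, hM, e0, ek, ek', rfl, rfl⟩ n hn
    have g := hM.slides (l := l) (by rwa [e0])
    have g₀ : Exhausts l (M 0) := by rwa [e0]
    have g₁ : Exhausts l₁ (shift k (slides l M) 0) := by rwa [shift_zero, ek']
    have g₂ : Exhausts l₂ (shift k M 0) := by rwa [shift_zero, ek]
    constructor
    · intro A' hA'
      obtain ⟨X, hX, rfl⟩ := Step.of_slides (d := true) g.shift hn g₁ hA'
      obtain ⟨Y, hY, rfl⟩ := hX.of_shift
      obtain ⟨M', hM', rfl⟩ := hY.of_slides hM (show n + k + 1 < s by omega) g₀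
      refine ⟨_, Step.slides (d := true) hM.shift hn g₂ hM'.shift, M',
        (hM'.symm hM (show n + k + 1 < s by omega)).1, ?_, ?_, ?_, rfl, rfl⟩
      · rw [hM'.level (by omega), e0]
      · rw [hM'.level (by omega), ek]
      · rw [hY.level (by omega), ek']
    · intro B' hB'
      obtain ⟨X, hX, rfl⟩ := Step.of_slides (d := true) hM.shift hn g₂ hB'
      obtain ⟨M', hM', rfl⟩ := hX.of_shift
      have hM'' := hM'.slides hM (show n + k + 1 < s by omega) g₀
      exact ⟨_, Step.slides (d := true) g.shift hn g₁ hM''.shift⟩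

theorem exists_last_row {N : ℕ} {μ : ℕ → ℕ} (hμ : Antitone μ) (hN : ∀ r, N ≤ r → μ r = 0)
    (h0 : μ ≠ 0) : ∃ p, 0 < μ p ∧ μ (p + 1) = 0 := by
  by_contra! hc
  have hpos : 0 < μ 0 := by
    by_contra! h
    exact h0 (funext fun r => Nat.le_zero.1 ((hμ (Nat.zero_le r)).trans h))
  have : ∀ r, 0 < μ r := by
    intro r
    induction r with
    | zero => exact hpos
    | succ r ih => exact Nat.pos_of_ne_zero (hc r ih)
  exact (this N).ne' (hN N le_rfl)

/-- Every shape can be exhausted by removing corners. -/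
theorem exists_exhausts {N : ℕ} {μ : ℕ → ℕ} (hμ : Antitone μ) (hN : ∀ r, N ≤ r → μ r = 0) :
    ∃ l, Exhausts l μ := by
  induction hd : ∑ r ∈ Finset.range N, μ r using Nat.strong_induction_on generalizing μ with
  | _ d ih =>
    by_cases h0 : μ = 0
    · exact ⟨[], h0⟩
    · obtain ⟨p, hp, hp1⟩ := exists_last_row hμ hN h0
      have hpN : p ∈ Finset.range N := by
        by_contra hc
        exact hp.ne' (hN p (by simpa using hc))
      have hanti : Antitone (removeBox p μ) := by
        refine antitone_nat_of_succ_le fun r => ?_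
        have h1 := hμ (Nat.le_succ r)
        simp only [removeBox, Nat.succ_eq_add_one] at h1 ⊢
        split_ifs <;> subst_vars <;> omega
      obtain ⟨l, hl⟩ := ih (∑ r ∈ Finset.range N, removeBox p μ r) (by
        rw [← hd]
        refine Finset.sum_lt_sum (fun r _ => ?_) ⟨p, hpN, ?_⟩
        · simp only [removeBox]
          split_ifs <;> omega
        · simp only [removeBox, if_true]
          omega) hanti (fun r hr => by
        simp only [removeBox, hN r hr]
        split_ifs <;> rfl) rfl
      exact ⟨p :: l, by omega, hl⟩

theorem eq_nil_of_exhausts_zero {l : List ℕ} (h : Exhausts l 0) : l = [] := by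
  cases l with
  | nil => rfl
  | cons p l => exact absurd h.1 (by simp)

/-! ### Demotion on patterns -/

/-- The pattern of the tableau obtained by deleting the entries `1`, lowering the others by `1`, and
rectifying. -/
def dem (L : Pattern) : Pattern := slides (List.replicate (L 1 0) 0) (shift 1 L)

theorem exhausts_replicate {μ : ℕ → ℕ} (hμ : ∀ r, μ (r + 1) = 0) :
    Exhausts (List.replicate (μ 0) 0) μ := by
  induction ha : μ 0 generalizing μ with
  | zero =>
    funext r
    cases r with
    | zero => exact ha
    | succ r => exact hμ r
  | succ a ih =>
    refine ⟨by rw [hμ]; omega, ih (fun r => ?_) ?_⟩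
    · simp [removeBox, hμ]
    · simp [removeBox, ha]

theorem exhausts_dem {N s : ℕ} {L : Pattern} (h : IsPattern N s L) (h0 : L 0 = 0) :
    Exhausts (List.replicate (L 1 0) 0) (shift 1 L 0) := by
  rw [shift_zero]
  exact exhausts_replicate fun r => h.eq_zero h0 1 (r + 1) (by omega)

theorem dem_zero {N s : ℕ} {L : Pattern} (h : IsPattern N s L) (h0 : L 0 = 0) : dem L 0 = 0 :=
  slides_zero (exhausts_dem h h0)

theorem IsPattern.dem {N s : ℕ} {L : Pattern} (h : IsPattern N s L) (h0 : L 0 = 0) :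
    IsPattern N (s - 1) (dem L) :=
  h.shift.slides (exhausts_dem h h0)

theorem IsPattern.dem_iterate {N s : ℕ} {L : Pattern} (h : IsPattern N s L) (h0 : L 0 = 0)
    (j : ℕ) : IsPattern N (s - j) (EvacCrystal.dem^[j] L) ∧ EvacCrystal.dem^[j] L 0 = 0 := by
  induction j with
  | zero => exact ⟨h, h0⟩
  | succ j ih =>
    rw [Function.iterate_succ_apply']
    exact ⟨ih.1.dem ih.2, dem_zero ih.1 ih.2⟩

/-- Iterated demotion is the rectification of the tableau without its small entries. -/
theorem slides_shift_eq_dem_iterate {N s : ℕ} {L : Pattern} (h : IsPattern N s L) (h0 : L 0 = 0)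
    (j : ℕ) {l : List ℕ} (hl : Exhausts l (L j)) : slides l (shift j L) = dem^[j] L := by
  induction j generalizing l with
  | zero =>
    rw [h0] at hl
    rw [eq_nil_of_exhausts_zero hl]
    rfl
  | succ j ih =>
    obtain ⟨l', hl'⟩ := exists_exhausts (h.antitone j) (h.fin j)
    obtain ⟨hp, hz⟩ := h.dem_iterate h0 j
    rw [Function.iterate_succ_apply', dem, ← ih hl']
    have h1 := exhausts_dem hp hz
    rw [shift_zero, ← ih hl'] at h1
    have h2 : shift (j + 1) L = shift 1 (shift j L) := by
      funext i
      simp only [shift]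
      congr 1
      omega
    rw [h2]
    refine (slides_shift_slides (h.shift (k := j)) (by rwa [shift_zero]) h1 ?_).symm
    simpa only [shift, show 1 + j = j + 1 by omega] using hl

theorem Step.dem {N s n : ℕ} {d : Bool} {L L' : Pattern} (h : IsPattern N s L) (h0 : L 0 = 0)
    (hn : n + 2 < s) (hL : Step d (n + 1) L L') :
    Step d n (EvacCrystal.dem L) (EvacCrystal.dem L') := by
  have := hL.shift.slides h.shift (by omega) (exhausts_dem h h0)
  rwa [EvacCrystal.dem, EvacCrystal.dem, hL.level (k := 1) (by omega)]

theorem Step.of_dem {N s n : ℕ} {d : Bool} {L M : Pattern} (h : IsPattern N s L) (h0 : L 0 = 0)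
    (hn : n + 2 < s) (hM : Step d n (EvacCrystal.dem L) M) :
    ∃ L', Step d (n + 1) L L' ∧ M = EvacCrystal.dem L' := by
  obtain ⟨X, hX, rfl⟩ := hM.of_slides h.shift (by omega) (exhausts_dem h h0)
  obtain ⟨L', hL', rfl⟩ := hX.of_shift
  exact ⟨L', hL', by rw [EvacCrystal.dem, hL'.level (k := 1) (by omega)]⟩

/-! ### The toggle rule for demotion -/

/-- The reflection of `x r` in the interval of values allowed by the horizontal strips `x / y` and
`b / x`. -/
def toggle (y b x : ℕ → ℕ) : ℕ → ℕ
  | 0 => b 0 + max (b 1) (y 0) - x 0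
  | r + 1 => min (b (r + 1)) (y r) + max (b (r + 2)) (y (r + 1)) - x (r + 1)

/-- Later slides from the same row of the inner shape stay weakly below the earlier ones. -/
theorem slideRow_le_slideRow_pSlide {N s : ℕ} {P : Pattern} (h : IsPattern N s P) {p : ℕ}
    (hp : P 0 (p + 1) < P 0 p) (k : ℕ) :
    slideRow P p k ≤ slideRow (pSlide p P) p k := by
  induction k with
  | zero => exact le_rfl
  | succ k ih =>
    rcases ih.eq_or_lt with e | e
    · have h1 := slideRow_succ P p k
      have h2 := slideRow_succ (pSlide p P) p k
      have h3 := slideRow_corner h hp k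
      simp only [← e] at h2
      rcases h1 with ⟨a, b⟩ | ⟨a, b⟩ <;> rcases h2 with ⟨a', b'⟩ | ⟨a', b'⟩ <;> try omega
      refine absurd ?_ b'
      simp only [pSlide, a, if_true]
      omega
    · rcases slideRow_succ P p k with ⟨a, -⟩ | ⟨a, -⟩ <;>
        rcases slideRow_succ (pSlide p P) p k with ⟨a', -⟩ | ⟨a', -⟩ <;> omega

/-- Slides from one row of the inner shape do not change the rows above the path of the first
slide. -/
theorem slides_replicate_of_lt {N s : ℕ} {P : Pattern} (h : IsPattern N s P) {a k r : ℕ}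
    (ha : Exhausts (List.replicate a 0) (P 0)) (hr : 0 < a → r < slideRow P 0 k) :
    slides (List.replicate a 0) P k r = P k r := by
  induction a generalizing P with
  | zero => rfl
  | succ a ih =>
    have hr' := hr (by omega)
    have h1 := slideRow_le_slideRow_pSlide h ha.1 k
    rw [List.replicate_succ, slides, ih (h.pSlide ha.1) ha.2 fun _ => by omega]
    simp [pSlide, hr'.ne]

/-- One slide does not affect the toggle, provided that it removes the rightmost box of `x / y'`.
-/
theorem toggle_removeBox {N : ℕ} {y x b y' : ℕ → ℕ} {p q t : ℕ} (h : SlideRows y x b p q t)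
    (hs : Strips N y x b) (h1 : ∀ r, y' r ≤ removeBox q x r)
    (h2 : ∀ r < q, y' r = x r) (h3 : ∀ r, x (r + 1) ≤ y' r) :
    toggle y' (removeBox t b) (removeBox q x) = toggle y' b x := by
  have hc := h.cx
  have hb := h.cb
  have hx : ∀ r, removeBox q x r + (if r = q then 1 else 0) = x r := by
    intro r
    simp only [removeBox]
    split_ifs <;> subst_vars <;> omega
  have hb' : ∀ r, removeBox t b r + (if r = t then 1 else 0) = b r := by
    intro r
    simp only [removeBox]
    split_ifs <;> subst_vars <;> omega
  have hy := h1 q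
  have hxq := hx q
  rw [if_pos rfl] at hxq
  have ht : (t = q + 1 ∧ b (q + 1) = x q) ∨ (t = q ∧ b (q + 1) < x q) := by
    have h1 := h.t_eq
    have h2 := hs.bx q
    split_ifs at h1 <;> omega
  have htop : ∀ r, r + 1 = q → b q ≤ y' r := by
    rintro r rfl
    rw [h2 r (by omega)]
    exact hs.bx r
  funext r
  have a1 := hx r
  have a2 := hb' r
  have a3 := hb' (r + 1)
  have a4 := h1 r
  have a5 := hs.xb r
  have a6 := hs.bx r
  have a7 : r < q → b (r + 1) ≤ y' r := fun hr => by rw [h2 r hr]; exact a6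
  have a8 := h3 r
  have a9 : r = q → x r = x q ∧ y' r = y' q ∧ b (r + 1) = b (q + 1) := by rintro rfl; simp
  have hw : r = q + 1 → b r = b (q + 1) ∧ x r = x (q + 1) := by rintro rfl; simp
  have a10 : r = q → b r = b q := by rintro rfl; rfl
  cases r with
  | zero =>
    simp only [toggle, zero_add] at *
    split_ifs at a1 a2 a3 <;> omega
  | succ r =>
    have i1 := h3 r
    have i2 := hs.bx r
    have i3 := htop r
    have i4 : r + 1 = q + 1 → y' r = y' q := by rintro ⟨⟩; rfl
    simp only [toggle]
    simp only [show r + 1 + 1 = r + 2 from rfl] at *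
    split_ifs at a1 a2 a3 <;> omega

theorem toggle_self {N : ℕ} {y x b : ℕ → ℕ} (hs : Strips N y x b) : toggle x b x = b := by
  funext r
  cases r with
  | zero =>
    have := hs.bx 0
    simp only [toggle, zero_add] at this ⊢
    omega
  | succ r =>
    have i1 := hs.bx r
    have i2 : b (r + 2) ≤ x (r + 1) := hs.bx (r + 1)
    simp only [toggle]
    omega

theorem slides_replicate_succ {N s : ℕ} {P : Pattern} (h : IsPattern N s P) {a k : ℕ}
    (ha : Exhausts (List.replicate a 0) (P 0))
    (hk : ∀ b (Q : Pattern), IsPattern N s Q → Exhausts (List.replicate b 0) (Q 0) →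
      ∀ r, Q k (r + 1) ≤ slides (List.replicate b 0) Q k r) :
    slides (List.replicate a 0) P (k + 1) =
      toggle (slides (List.replicate a 0) P k) (P (k + 1)) (P k) := by
  induction a generalizing P with
  | zero =>
    refine (toggle_self (N := N) (y := P k) ⟨fun r => le_rfl, h.up k, h.anti k, h.il k, ?_⟩).symm
    exact h.fin (k + 1)
  | succ a ih =>
    have hp := ha.1
    rw [List.replicate_succ, slides, ih (h.pSlide hp) ha.2]
    have hrows : SlideRows (P k) (P k) (P (k + 1)) (slideRow P 0 k) (slideRow P 0 k)
        (slideRow P 0 (k + 1)) :=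
      ⟨slideRow_corner h hp k, slideRow_corner h hp k, slideRow_corner h hp _,
        by rw [if_neg (slideRow_corner h hp k).ne], rfl⟩
    refine toggle_removeBox (N := N) hrows
      ⟨fun r => le_rfl, h.up k, h.anti k, h.il k, h.fin (k + 1)⟩ (fun r => slides_le _ _ k r)
      (fun r hr => ?_) (hk (a + 1) P h ha)
    exact slides_replicate_of_lt h ha fun _ => hr

theorem le_slides_replicate {N s : ℕ} {P : Pattern} (h : IsPattern N s P) {a : ℕ}
    (ha : Exhausts (List.replicate a 0) (P 0)) (k r : ℕ) :
    P k (r + 1) ≤ slides (List.replicate a 0) P k r := by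
  induction k generalizing P a r with
  | zero =>
    have hz : P 0 (r + 1) = 0 := by
      clear h
      induction a generalizing P with
      | zero =>
        have : P 0 = 0 := ha
        simp [this]
      | succ a ih =>
        have := ih (P := pSlide 0 P) ha.2
        simpa [pSlide, slideRow] using this
    omega
  | succ k ih =>
    rw [slides_replicate_succ h ha fun b Q hQ hb r => ih hQ hb r]
    have h1 := ih h ha
    have h2 := slides_le (List.replicate a 0) P k
    have h3 := h.up k
    have h4 := h.il k
    cases r with
    | zero =>
      have := h3 0
      simp only [toggle, zero_add]
      omega
    | succ r =>
      have g1 := h3 (r + 1)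
      have g2 := h1 r
      have g3 : P (k + 1) (r + 1 + 1) = P (k + 1) (r + 2) := rfl
      simp only [toggle]
      omega

theorem dem_succ {N s : ℕ} {L : Pattern} (h : IsPattern N s L) (h0 : L 0 = 0) (k : ℕ) :
    dem L (k + 1) = toggle (dem L k) (L (k + 2)) (L (k + 1)) :=
  slides_replicate_succ h.shift (exhausts_dem h h0) fun _ _ hQ hb r => le_slides_replicate hQ hb k r

theorem dem_interlace {N s : ℕ} {L : Pattern} (h : IsPattern N s L) (h0 : L 0 = 0) (k r : ℕ) :
    dem L k r ≤ L (k + 1) r ∧ L (k + 1) (r + 1) ≤ dem L k r :=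
  ⟨slides_le _ _ k r, le_slides_replicate h.shift (exhausts_dem h h0) k r⟩

theorem toggle_toggle {N : ℕ} {y x b : ℕ → ℕ} (hs : Strips N y x b) :
    toggle y b (toggle y b x) = x := by
  funext r
  cases r with
  | zero =>
    have h1 := hs.yx 0
    have h2 := hs.xb 0
    have h3 := hs.bx 0
    simp only [toggle, zero_add] at h3 ⊢
    omega
  | succ r =>
    have h1 := hs.yx (r + 1)
    have h2 := hs.xb (r + 1)
    have h3 : b (r + 2) ≤ x (r + 1) := hs.bx (r + 1)
    have h4 := hs.xy r
    simp only [toggle]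
    omega

/-! ### Evacuation on patterns -/

/-- Evacuation: level `k` of the evacuated pattern is the shape of the tableau after `s - k`
demotions. -/
def pEvac (s : ℕ) (L : Pattern) : Pattern := fun k => dem^[s - k] L k

theorem pEvac_zero {N s : ℕ} {L : Pattern} (h : IsPattern N s L) (h0 : L 0 = 0) :
    pEvac s L 0 = 0 :=
  (h.dem_iterate h0 _).2

theorem pEvac_of_le {s k : ℕ} {L : Pattern} (hk : s ≤ k) : pEvac s L k = L k := by
  simp [pEvac, Nat.sub_eq_zero_of_le hk]

theorem IsPattern.pEvac {N s : ℕ} {L : Pattern} (h : IsPattern N s L) (h0 : L 0 = 0) :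
    IsPattern N s (pEvac s L) := by
  have key : ∀ k < s, ∀ r, EvacCrystal.pEvac s L k r ≤ EvacCrystal.pEvac s L (k + 1) r ∧
      EvacCrystal.pEvac s L (k + 1) (r + 1) ≤ EvacCrystal.pEvac s L k r := by
    intro k hk r
    obtain ⟨d, rfl⟩ : ∃ d, s = k + 1 + d := Nat.exists_eq_add_of_le hk
    have e1 : k + 1 + d - k = d + 1 := by omega
    have e2 : k + 1 + d - (k + 1) = d := by omega
    obtain ⟨g1, g2⟩ := h.dem_iterate h0 d
    simp only [EvacCrystal.pEvac, e1, e2, Function.iterate_succ_apply']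
    exact dem_interlace g1 g2 k r
  refine ⟨fun k r => ?_, fun k r => ?_, fun k r hk => ?_, fun k r hr => ?_⟩
  · rcases lt_or_ge k s with hk | hk
    · exact (key k hk r).1
    · rw [pEvac_of_le hk, pEvac_of_le (by omega)]
      exact h.up k r
  · rcases lt_or_ge k s with hk | hk
    · exact (key k hk r).2
    · rw [pEvac_of_le hk, pEvac_of_le (by omega)]
      exact h.il k r
  · rw [pEvac_of_le hk, pEvac_of_le le_rfl]
    exact h.stab k r hk
  · exact (h.dem_iterate h0 _).1.fin k r hr

/-- The growth diagram of the evacuated pattern is the reflection of the growth diagram of the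
pattern, since the toggle rule is symmetric. -/
theorem dem_iterate_pEvac {N s : ℕ} {L : Pattern} (h : IsPattern N s L) (h0 : L 0 = 0)
    (j k : ℕ) (hjk : j + k ≤ s) : dem^[j] (pEvac s L) k = dem^[s - j - k] L k := by
  have hE := h.pEvac h0
  have hE0 := pEvac_zero h h0
  induction j generalizing k with
  | zero => rfl
  | succ j ih =>
    obtain ⟨p1, p2⟩ := hE.dem_iterate hE0 j
    rw [Function.iterate_succ_apply']
    induction k with
    | zero => rw [dem_zero p1 p2, (h.dem_iterate h0 _).2]
    | succ k ihk =>
      obtain ⟨d, rfl⟩ : ∃ d, s = j + 1 + (k + 1) + d := Nat.exists_eq_add_of_le hjk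
      rw [dem_succ p1 p2, ihk (by omega), ih (k + 1) (by omega), ih (k + 2) (by omega),
        show j + 1 + (k + 1) + d - (j + 1) - k = d + 1 by omega,
        show j + 1 + (k + 1) + d - j - (k + 1) = d + 1 by omega,
        show j + 1 + (k + 1) + d - j - (k + 2) = d by omega,
        show j + 1 + (k + 1) + d - (j + 1) - (k + 1) = d by omega, Function.iterate_succ_apply']
      obtain ⟨q1, q2⟩ := h.dem_iterate h0 d
      rw [dem_succ q1 q2]
      refine toggle_toggle (N := N) ⟨fun r => (dem_interlace q1 q2 k r).1, q1.up _,
        fun r => (dem_interlace q1 q2 k r).2, q1.il _, q1.fin _⟩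

theorem pEvac_pEvac {N s : ℕ} {L : Pattern} (h : IsPattern N s L) (h0 : L 0 = 0) :
    pEvac s (pEvac s L) = L := by
  funext k
  rcases le_total s k with hk | hk
  · rw [pEvac_of_le hk, pEvac_of_le hk]
  · rw [pEvac, dem_iterate_pEvac h h0 _ _ (by omega), show s - (s - k) - k = 0 by omega]
    rfl

theorem pEvac_dem {s k : ℕ} {L : Pattern} (hk : k ≤ s) :
    pEvac s (dem L) k = pEvac (s + 1) L k := by
  simp only [pEvac, show s + 1 - k = s - k + 1 by omega, Function.iterate_succ_apply]

/-- A pattern is determined by its demotion and its shape. -/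
theorem dem_injective {N s : ℕ} {A B : Pattern} (hA : IsPattern N s A) (hA0 : A 0 = 0)
    (hB : IsPattern N s B) (hB0 : B 0 = 0) (hs : A s = B s) (h : dem A = dem B) : A = B := by
  rw [← pEvac_pEvac hA hA0, ← pEvac_pEvac hB hB0]
  congr 1
  funext k
  rcases le_or_gt s k with hk | hk
  · rw [pEvac_of_le hk, pEvac_of_le hk]
    funext r
    rw [hA.stab k r hk, hB.stab k r hk, hs]
  · obtain ⟨s, rfl⟩ : ∃ t, s = t + 1 := ⟨s - 1, by omega⟩
    rw [← pEvac_dem (by omega), ← pEvac_dem (by omega), h]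

theorem raise_two_iff {N : ℕ} {L L' : Pattern} (h : IsPattern N 2 L) (h0 : L 0 = 0)
    (h' : IsPattern N 2 L') (h0' : L' 0 = 0) :
    Raise 0 L L' ↔ L' 1 0 = L 1 0 + 1 ∧ L' 2 = L 2 := by
  have hst := h.strips 0
  have e1 : ∀ r, L 1 (r + 1) = 0 := fun r => h.eq_zero h0 1 _ (by omega)
  constructor
  · rintro ⟨r, hr, rfl⟩
    have hb := (hst.raise_bounds hr).2
    obtain rfl : r = 0 := by
      cases r with
      | zero => rfl
      | succ r =>
        have := hb r rfl
        simp [h0] at this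
    simp
  · rintro ⟨h1, h2⟩
    refine ⟨0, ⟨?_, by simp, fun q => ?_⟩, ?_⟩
    · have : L' 1 0 ≤ L' 2 0 := h'.up 1 0
      have h3 := congrFun h2 0
      simp only [hRow, zero_add]
      omega
    · induction q with
      | zero => exact le_rfl
      | succ q ih =>
        refine le_trans ?_ ih
        have i1 := e1 q
        have i2 : L 2 (q + 1) ≤ L 1 q := h.il 1 q
        simp only [hRow, h0, Pi.zero_apply, zero_add] at i1 i2 ⊢
        omega
    · funext k r
      by_cases hk : k = 0 + 1 ∧ r = 0
      · obtain ⟨rfl, rfl⟩ := hk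
        simpa using h1
      · rw [if_neg hk]
        match k, r with
        | 0, r => rw [h0, h0']
        | 1, 0 => simp at hk
        | 1, r + 1 => rw [e1, h'.eq_zero h0' 1 _ (by omega)]
        | k + 2, r => rw [h.stab (k + 2) r (by omega), h'.stab (k + 2) r (by omega), h2]

theorem pEvac_two {N : ℕ} {L : Pattern} (h : IsPattern N 2 L) (h0 : L 0 = 0) :
    pEvac 2 L 1 0 + L 1 0 = L 2 0 + L 2 1 := by
  have h1 : pEvac 2 L 1 = dem L (0 + 1) := rfl
  have h2 : L 1 0 ≤ L 2 0 := h.up 1 0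
  rw [h1, dem_succ h h0, dem_zero h h0]
  simp only [toggle, Pi.zero_apply, zero_add]
  omega

/-- Evacuation exchanges `e_i` and `f_{s-i}`. For `i > 1` this is inherited from the evacuation of
the demotion; for `i = 1` it follows because evacuation is an involution. -/
theorem step_pEvac_iff {N s n : ℕ} {d : Bool} {L L' : Pattern} (h : IsPattern N s L) (h0 : L 0 = 0)
    (h' : IsPattern N s L') (h0' : L' 0 = 0) (hn : n + 1 < s) :
    Step d n L L' ↔ Step (!d) (s - 2 - n) (pEvac s L) (pEvac s L') := by
  induction s generalizing n d L L' with
  | zero => omega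
  | succ s ih =>
    have main : ∀ {n : ℕ} {d : Bool} {L L' : Pattern}, IsPattern N (s + 1) L → L 0 = 0 →
        IsPattern N (s + 1) L' → L' 0 = 0 → n + 2 < s + 1 →
        (Step d (n + 1) L L' ↔
          Step (!d) (s - 2 - n) (pEvac (s + 1) L) (pEvac (s + 1) L')) := by
      intro n d L L' h h0 h' h0' hn
      have hd := h.dem h0
      have hd' := h'.dem h0'
      rw [Nat.add_sub_cancel] at hd hd'
      have hd0 := dem_zero h h0
      have hd0' := dem_zero h' h0'
      have hIH := ih (n := n) (d := d) hd hd0 hd' hd0' (by omega)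
      constructor
      · intro hL
        have h1 := hIH.1 (hL.dem h h0 (by omega))
        refine h1.congr (pEvac_dem (by omega)).symm (pEvac_dem (by omega)).symm
          (pEvac_dem (by omega)).symm (pEvac_dem (by omega)).symm fun k hk => ?_
        rcases le_or_gt k s with hks | hks
        · rw [← pEvac_dem hks, ← pEvac_dem hks, h1.level hk]
        · rw [pEvac_of_le (by omega), pEvac_of_le (by omega), hL.level (by omega)]
      · intro hL
        have htop : L' (s + 1) = L (s + 1) := by
          rw [← pEvac_of_le (L := L') (le_refl (s + 1)), hL.level (by omega), pEvac_of_le le_rfl]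
        have h1 : Step (!d) (s - 2 - n) (pEvac s (dem L)) (pEvac s (dem L')) := by
          refine hL.congr (pEvac_dem (by omega)) (pEvac_dem (by omega))
            (pEvac_dem (by omega)) (pEvac_dem (by omega)) fun k hk => ?_
          rcases le_or_gt k s with hks | hks
          · rw [pEvac_dem hks, pEvac_dem hks, hL.level hk]
          · funext r
            rw [(hd.pEvac hd0).stab k r hks.le, (hd'.pEvac hd0').stab k r hks.le,
              pEvac_dem le_rfl, pEvac_dem le_rfl, hL.level (by omega)]
        obtain ⟨M, hM, hLM⟩ := (hIH.2 h1).of_dem h h0 (by omega)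
        have hMp := (hM.symm h (by omega)).1
        have : L' = M := by
          refine dem_injective h' h0' hMp ?_ ?_ hLM
          · rw [hM.level (by omega), h0]
          · rw [hM.level (by omega), htop]
        rwa [this]
    cases n with
    | succ n =>
      rw [show s + 1 - 2 - (n + 1) = s - 2 - n by omega]
      exact main h h0 h' h0' hn
    | zero =>
      have hE := h.pEvac h0
      have hE' := h'.pEvac h0'
      have hE0 := pEvac_zero h h0
      have hE0' := pEvac_zero h' h0'
      rcases (show s = 1 ∨ 2 ≤ s by omega) with rfl | hs
      · have key : ∀ {L L' : Pattern}, IsPattern N 2 L → L 0 = 0 → IsPattern N 2 L' → L' 0 = 0 →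
            (Step true 0 L L' ↔ Step true 0 (pEvac 2 L') (pEvac 2 L)) := by
          intro L L' h h0 h' h0'
          have g1 := pEvac_two h h0
          have g2 := pEvac_two h' h0'
          have g3 : L 1 0 ≤ L 2 0 := h.up 1 0
          have g4 : L' 1 0 ≤ L' 2 0 := h'.up 1 0
          simp only [Step]
          rw [raise_two_iff h h0 h' h0', raise_two_iff (h'.pEvac h0') (pEvac_zero h' h0')
            (h.pEvac h0) (pEvac_zero h h0), pEvac_of_le le_rfl, pEvac_of_le le_rfl,
            eq_comm (a := L' 2)]
          refine and_congr_left fun e => ?_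
          have e0 := congrFun e 0
          have e1 := congrFun e 1
          omega
        cases d
        · rw [Step.symm_iff h h' hn]
          simpa using key h' h0' h h0
        · rw [Step.symm_iff (s := 2) hE hE' (by omega)]
          simpa using key h h0 h' h0'
      · obtain ⟨t, rfl⟩ : ∃ t, s = t + 2 := ⟨s - 2, by omega⟩
        have := main (n := t) (d := !d) hE hE0 hE' hE0' (by omega)
        rw [pEvac_pEvac h h0, pEvac_pEvac h' h0', Bool.not_not, Nat.add_sub_cancel,
          Nat.sub_self] at this
        exact this.symm

/-! ### Injectivity of rectification on connected patterns -/

/-- Patterns that are connected by crystal operators and have the same rectification are equal: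
the operators do not change the shapes that occur during the rectification, so the slides can be
undone simultaneously. -/
theorem slides_injective {N s : ℕ} {l : List ℕ} {L L' : Pattern} (hl : Exhausts l (L 0))
    (hL : Relation.EqvGen (fun A B => IsPattern N s A ∧ ∃ d n, n + 1 < s ∧ Step d n A B) L L')
    (h : IsPattern N s L) (e : slides l L = slides l L') : L = L' := by
  have key : ∀ {A B : Pattern},
      Relation.EqvGen (fun A B => IsPattern N s A ∧ ∃ d n, n + 1 < s ∧ Step d n A B) A B →
      (IsPattern N s A ↔ IsPattern N s B) ∧ A 0 = B 0 ∧ A s = B s := by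
    intro A B hAB
    induction hAB with
    | rel A B hAB =>
      obtain ⟨hA, d, n, hn, hd⟩ := hAB
      exact ⟨⟨fun _ => (hd.symm hA hn).1, fun _ => hA⟩, (hd.level (by omega)).symm,
        (hd.level (by omega)).symm⟩
    | refl A => exact ⟨Iff.rfl, rfl, rfl⟩
    | symm A B _ ih => exact ⟨ih.1.symm, ih.2.1.symm, ih.2.2.symm⟩
    | trans A B C _ _ ih ih' =>
      exact ⟨ih.1.trans ih'.1, ih.2.1.trans ih'.2.1, ih.2.2.trans ih'.2.2⟩
  induction l generalizing L L' with
  | nil => exact e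
  | cons p l ih =>
    obtain ⟨k1, k2, k3⟩ := key hL
    refine pSlide_injective h (k1.1 h) hl.1 (by rw [← k2]; exact hl.1) k3 ?_
    refine ih (by rw [pSlide_zero]; exact hl.2) ?_ (h.pSlide hl.1) e
    have hp := hl.1
    clear e hl
    induction hL with
    | rel A B hAB =>
      obtain ⟨hA, d, n, hn, hd⟩ := hAB
      exact Relation.EqvGen.rel _ _ ⟨hA.pSlide hp, d, n, hn, hd.pSlide hA hn hp⟩
    | refl A => exact Relation.EqvGen.refl _
    | symm A B hAB ih =>
      obtain ⟨k1, k2, k3⟩ := key hAB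
      exact (ih (k1.2 h) k1 k2 k3 (by rwa [k2])).symm
    | trans A B C hAB hBC ih ih' =>
      obtain ⟨k1, k2, k3⟩ := key hAB
      obtain ⟨k1', k2', k3'⟩ := key hBC
      exact (ih h k1 k2 k3 hp).trans _ _ _ (ih' (k1.1 h) k1' k2' k3' (by rwa [← k2]))

/-! ### Patterns of tableaux -/

/-- The filling `T` is the tableau with pattern `L`: the boxes with entry `k + 1` are those between
the levels `k` and `k + 1`. -/
def Rep (L : Pattern) (T : Filling) : Prop :=
  ∀ r c k, T (r, c) = k + 1 ↔ L k r ≤ c ∧ c < L (k + 1) r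

namespace Rep

variable {N s : ℕ} {L L' : Pattern} {T T' : Filling}

theorem unique (h : Rep L T) (h' : Rep L T') : T = T' := by
  ext ⟨r, c⟩
  rcases Nat.eq_zero_or_eq_succ_pred (T (r, c)) with e | e
  · rcases Nat.eq_zero_or_eq_succ_pred (T' (r, c)) with e' | e'
    · rw [e, e']
    · exact ((h r c _).2 ((h' r c _).1 e')).trans e'.symm
  · exact e.trans ((h' r c _).2 ((h r c _).1 e)).symm

theorem ne_zero_and_le_iff (hL : IsPattern N s L) (h : Rep L T) {r c k : ℕ} :
    T (r, c) ≠ 0 ∧ T (r, c) ≤ k ↔ L 0 r ≤ c ∧ c < L k r := by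
  constructor
  · rintro ⟨h0, hk⟩
    obtain ⟨j, hj⟩ := Nat.exists_eq_succ_of_ne_zero h0
    have h1 := (h r c j).1 hj
    have h2 := hL.mono r (Nat.zero_le j)
    have h3 := hL.mono r (show j + 1 ≤ k by omega)
    simp only at h2 h3
    omega
  · rintro ⟨h0, hk⟩
    induction k with
    | zero => omega
    | succ k ih =>
      rcases lt_or_ge c (L k r) with hc | hc
      · have := ih hc
        omega
      · have := (h r c k).2 ⟨hc, hk⟩
        omega

theorem le (hL : IsPattern N s L) (h : Rep L T) (c : ℕ × ℕ) : T c ≤ s := by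
  by_contra hc
  obtain ⟨j, hj⟩ := Nat.exists_eq_succ_of_ne_zero (show T c ≠ 0 by omega)
  have h1 := (h c.1 c.2 j).1 hj
  have h2 := hL.stab j c.1 (by omega)
  have h3 := hL.stab (j + 1) c.1 (by omega)
  omega

theorem ne_zero_iff (hL : IsPattern N s L) (h : Rep L T) {r c : ℕ} :
    T (r, c) ≠ 0 ↔ L 0 r ≤ c ∧ c < L s r := by
  rw [← h.ne_zero_and_le_iff hL]
  exact ⟨fun h0 => ⟨h0, h.le hL _⟩, fun h0 => h0.1⟩

theorem mem_support (hL : IsPattern N s L) (h : Rep L T) {r c : ℕ} :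
    (r, c) ∈ T.support ↔ L 0 r ≤ c ∧ c < L s r := by
  rw [Finsupp.mem_support_iff, h.ne_zero_iff hL]

theorem dropLE (h : Rep L T) (m : ℕ) : Rep (shift m L) (EvacCrystal.dropLE m T) := by
  intro r c k
  simp only [EvacCrystal.dropLE, Finsupp.mapRange_apply, shift,
    show k + 1 + m = k + m + 1 by omega]
  rw [← h r c]
  omega

theorem restrictLE (h : Rep L T) (m : ℕ) : Rep (trunc m L) (EvacCrystal.restrictLE m T) := by
  intro r c k
  rw [EvacCrystal.restrictLE, Finsupp.filter_apply, ite_eq_iff', trunc, trunc]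
  rcases lt_or_ge k m with hk | hk
  · rw [min_eq_left hk.le, min_eq_left (Nat.succ_le_of_lt hk), ← h r c]
    omega
  · rw [min_eq_right hk, min_eq_right (by omega)]
    omega

theorem pattern_unique (hL : IsPattern N s L) (h0 : L 0 = 0) {N' s' : ℕ} (hL' : IsPattern N' s' L')
    (h0' : L' 0 = 0) (h : Rep L T) (h' : Rep L' T) : L = L' := by
  have key : ∀ k r c, c < L k r ↔ c < L' k r := by
    intro k r c
    have h1 := h.ne_zero_and_le_iff hL (r := r) (c := c) (k := k)
    have h2 := h'.ne_zero_and_le_iff hL' (r := r) (c := c) (k := k)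
    simp only [h0, h0', Pi.zero_apply, Nat.zero_le, true_and] at h1 h2
    rw [← h1, h2]
  funext k r
  have h1 := key k r (L k r)
  have h2 := key k r (L' k r)
  omega

/-- The pattern of a straight tableau yields a semistandard filling. -/
theorem mem_tableaux {κ : YoungDiagram} (hL : IsPattern N s L) (h0 : L 0 = 0) (h : Rep L T)
    (hκ : ∀ r, L s r = κ.rowLen r) : T ∈ tableaux κ s := by
  refine ⟨?_, ⟨fun i j₁ j₂ hj m₁ m₂ => ?_, fun i₁ i₂ j hi m₁ m₂ => ?_⟩, h.le hL⟩
  · ext ⟨r, c⟩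
    rw [h.mem_support hL, hκ, YoungDiagram.mem_cells, YoungDiagram.mem_iff_lt_rowLen, h0]
    simp
  · obtain ⟨k₁, e₁⟩ := Nat.exists_eq_succ_of_ne_zero (Finsupp.mem_support_iff.1 m₁)
    obtain ⟨k₂, e₂⟩ := Nat.exists_eq_succ_of_ne_zero (Finsupp.mem_support_iff.1 m₂)
    have g₁ := (h i j₁ k₁).1 e₁
    have g₂ := (h i j₂ k₂).1 e₂
    by_contra! hc
    have := hL.mono i (show k₂ + 1 ≤ k₁ by omega)
    simp only at this
    omega
  · obtain ⟨k₁, e₁⟩ := Nat.exists_eq_succ_of_ne_zero (Finsupp.mem_support_iff.1 m₁)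
    obtain ⟨k₂, e₂⟩ := Nat.exists_eq_succ_of_ne_zero (Finsupp.mem_support_iff.1 m₂)
    have g₁ := (h i₁ j k₁).1 e₁
    have g₂ := (h i₂ j k₂).1 e₂
    by_contra! hc
    have i1 := hL.mono i₁ (show k₂ ≤ k₁ by omega)
    have i2 := hL.antitone (k₂ + 1) (show i₁ + 1 ≤ i₂ by omega)
    have i3 := hL.il k₂ i₁
    simp only at i1
    omega

theorem exists_shape (hL : IsPattern N s L) (h0 : L 0 = 0) (h : Rep L T) :
    ∃ κ : YoungDiagram, (∀ r, L s r = κ.rowLen r) ∧ T ∈ tableaux κ s := by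
  let κ : YoungDiagram := ⟨T.support, by
    rintro ⟨r, c⟩ ⟨r', c'⟩ hle hm
    obtain ⟨h1, h2⟩ := Prod.mk_le_mk.1 hle
    rw [Finset.mem_coe, h.mem_support hL, h0] at hm ⊢
    have := hL.antitone s h1
    exact ⟨Nat.zero_le _, by omega⟩⟩
  have hκ : ∀ r, L s r = κ.rowLen r := by
    intro r
    have key : ∀ c, c < L s r ↔ c < κ.rowLen r := by
      intro c
      have : (r, c) ∈ κ ↔ (r, c) ∈ T.support := Iff.rfl
      rw [← YoungDiagram.mem_iff_lt_rowLen, this, h.mem_support hL, h0]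
      simp
    have h1 := key (L s r)
    have h2 := key (κ.rowLen r)
    omega
  exact ⟨κ, hκ, h.mem_tableaux hL h0 hκ⟩

end Rep

theorem mem_iff_lt_card_of_lower {S : Finset ℕ} (hS : ∀ a b, a ≤ b → b ∈ S → a ∈ S) (c : ℕ) :
    c ∈ S ↔ c < S.card := by
  constructor
  · intro hc
    have : Finset.range (c + 1) ⊆ S := fun a ha => hS a c (by simpa [Nat.lt_succ_iff] using ha) hc
    simpa using Finset.card_le_card this
  · intro hc
    by_contra hn
    have : S ⊆ Finset.range c := by
      intro a ha
      by_contra hac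
      exact hn (hS c a (by simpa using hac) ha)
    have := Finset.card_le_card this
    rw [Finset.card_range] at this
    omega

/-- The pattern of a straight tableau: level `k` counts the entries at most `k` in each row. -/
def toPattern (T : Filling) : Pattern := fun k r =>
  ((T.support.image Prod.snd).filter fun c => T (r, c) ≠ 0 ∧ T (r, c) ≤ k).card

theorem lt_toPattern {κ : YoungDiagram} {s : ℕ} {T : Filling} (hT : T ∈ tableaux κ s)
    (k r c : ℕ) : c < toPattern T k r ↔ T (r, c) ≠ 0 ∧ T (r, c) ≤ k := by
  obtain ⟨hsup, ⟨hrow, -⟩, -⟩ := hT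
  rw [toPattern, ← mem_iff_lt_card_of_lower]
  · simp only [Finset.mem_filter, Finset.mem_image, Prod.exists, exists_eq_right,
      Finsupp.mem_support_iff, and_iff_right_iff_imp]
    exact fun h => ⟨r, h.1⟩
  · intro a b hab hb
    simp only [Finset.mem_filter, Finset.mem_image, Prod.exists, exists_eq_right] at hb ⊢
    have hbs : (r, b) ∈ T.support := Finsupp.mem_support_iff.2 hb.2.1
    have has : (r, a) ∈ T.support := by
      rw [hsup, YoungDiagram.mem_cells] at hbs ⊢
      exact κ.up_left_mem le_rfl hab hbs
    refine ⟨⟨r, has⟩, Finsupp.mem_support_iff.1 has, ?_⟩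
    rcases hab.eq_or_lt with rfl | hlt
    · exact hb.2.2
    · exact (hrow r a b hlt has hbs).trans hb.2.2

theorem toPattern_spec {κ : YoungDiagram} {s : ℕ} {T : Filling} (hT : T ∈ tableaux κ s) :
    IsPattern s s (toPattern T) ∧ toPattern T 0 = 0 ∧ Rep (toPattern T) T ∧
      ∀ r, toPattern T s r = κ.rowLen r := by
  have key := lt_toPattern hT
  have le_of : ∀ {k r k' r'}, (∀ c, T (r, c) ≠ 0 ∧ T (r, c) ≤ k → T (r', c) ≠ 0 ∧ T (r', c) ≤ k') →
      toPattern T k r ≤ toPattern T k' r' := by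
    intro k r k' r' h
    by_contra! hc
    exact lt_irrefl _ ((key _ _ _).2 (h _ ((key _ _ _).1 hc)))
  obtain ⟨hsup, ⟨-, hcol⟩, hle⟩ := hT
  have h0 : toPattern T 0 = 0 := by
    funext r
    by_contra hc
    have := (key 0 r 0).1 (Nat.pos_of_ne_zero hc)
    omega
  have hpat : IsPattern (κ.colLen 0) s (toPattern T) := by
    refine ⟨fun k r => le_of fun c hc => ?_, fun k r => le_of fun c hc => ?_, fun k r hk => ?_,
      fun k r hr => ?_⟩
    · omega
    · have h1 : (r + 1, c) ∈ T.support := Finsupp.mem_support_iff.2 hc.1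
      have h2 : (r, c) ∈ T.support := by
        rw [hsup, YoungDiagram.mem_cells] at h1 ⊢
        exact κ.up_left_mem (Nat.le_succ r) le_rfl h1
      have h3 := hcol r (r + 1) c (Nat.lt_succ_self r) h2 h1
      exact ⟨Finsupp.mem_support_iff.1 h2, by omega⟩
    · refine le_antisymm (le_of fun c hc => ⟨hc.1, hle _⟩) (le_of fun c hc => ⟨hc.1, by omega⟩)
    · by_contra hc
      have h1 := ((key k r 0).1 (Nat.pos_of_ne_zero hc)).1
      have h2 : (r, 0) ∈ κ := by
        rwa [← YoungDiagram.mem_cells, ← hsup, Finsupp.mem_support_iff]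
      rw [YoungDiagram.mem_iff_lt_colLen] at h2
      omega
  refine ⟨⟨hpat.up, hpat.il, hpat.stab, fun k r hr => hpat.eq_zero_row h0 k r hr⟩, h0,
    fun r c k => ?_, fun r => ?_⟩
  · have h1 := key k r c
    have h2 := key (k + 1) r c
    rw [← not_lt, h1, h2]
    omega
  · have hk : ∀ c, c < toPattern T s r ↔ c < κ.rowLen r := by
      intro c
      rw [key, ← YoungDiagram.mem_iff_lt_rowLen, ← YoungDiagram.mem_cells, ← hsup,
        Finsupp.mem_support_iff]
      exact ⟨fun h => h.1, fun h => ⟨h, hle _⟩⟩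
    have h1 := hk (toPattern T s r)
    have h2 := hk (κ.rowLen r)
    omega

/-! ### Slides on fillings -/

/-- The levels below `v` are those after the slide, the others those before the slide. -/
def hybrid (L M : Pattern) (v : ℕ) : Pattern := fun k r => if k < v then M k r else L k r

/-- The state of a slide on a filling: the empty box is `(i, j)`, the entries at most `v` have been
passed, and the last entry moved (if any) was `v`. Outside the empty box the filling is described
by the hybrid of the patterns before and after the slide. -/
structure SlideState (p : ℕ) (L : Pattern) (T : Filling) (i j v : ℕ) : Prop where
  lt : j < L v i
  below : L v (i + 1) ≤ j
  row : slideRow L p v = i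
  passed : ∀ k < v, pSlide p L k i ≤ j
  start : L 0 i ≤ j + 1
  hole : T (i, j) = 0
  rep : ∀ r c, (r, c) ≠ (i, j) → ∀ k, T (r, c) = k + 1 ↔
    hybrid L (pSlide p L) v k r ≤ c ∧ c < hybrid L (pSlide p L) v (k + 1) r

namespace SlideState

variable {N s p : ℕ} {L : Pattern} {T : Filling} {i j v x : ℕ}

/-- While the empty box rests at `(i, j)`, only that box distinguishes the hybrid patterns. -/
theorem lt_hybrid_iff (hx : ∀ k, v ≤ k → k < x → L k i = j + 1 ∧ slideRow L p k = i) (hvx : v ≤ x)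
    {r c k : ℕ} (hne : (r, c) ≠ (i, j)) :
    c < hybrid L (pSlide p L) x k r ↔ c < hybrid L (pSlide p L) v k r := by
  have hne' : r = i → c ≠ j := by
    rintro rfl rfl
    exact hne rfl
  simp only [hybrid, pSlide]
  split_ifs with h1 h2 h3 h4 h4 h5 <;> try omega
  · obtain ⟨e1, e2⟩ := hx k (by omega) h1
    rw [e2] at h2
    subst h2
    have := hne' rfl
    omega

theorem right_level (h : SlideState p L T i j v) (k : ℕ)
    (hk : ∀ k', k' < k → T (i, j + 1) ≠ k' + 1) (hv : v ≤ k) : L k i ≤ j + 1 := by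
  suffices hybrid L (pSlide p L) v k i ≤ j + 1 by
    rwa [hybrid, if_neg (by omega)] at this
  clear hv
  induction k with
  | zero =>
    rw [hybrid]
    split_ifs with h0
    · exact (h.passed 0 h0).trans (Nat.le_succ j)
    · exact h.start
  | succ k ih =>
    have h1 := ih fun k' hk' => hk k' (by omega)
    have h2 := h.rep i (j + 1) (by simp) k
    have h3 := hk k (by omega)
    by_contra! hc
    exact h3 (h2.2 ⟨h1, hc⟩)

theorem below_level (hL : IsPattern N s L) (hp : L 0 (p + 1) < L 0 p) (h : SlideState p L T i j v)
    (k : ℕ) (hk : ∀ k', k' < k → T (i + 1, j) ≠ k' + 1) (hv : v ≤ k) : L k (i + 1) ≤ j := by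
  suffices hybrid L (pSlide p L) v k (i + 1) ≤ j by
    rwa [hybrid, if_neg (by omega)] at this
  clear hv
  induction k with
  | zero =>
    rw [hybrid]
    split_ifs with h0
    · exact ((hL.pSlide hp).anti 0 i).trans (h.passed 0 h0)
    · have := h.below
      rwa [show v = 0 by omega] at this
  | succ k ih =>
    have h1 := ih fun k' hk' => hk k' (by omega)
    have h2 := h.rep (i + 1) j (by simp) k
    have h3 := hk k (by omega)
    by_contra! hc
    exact h3 (h2.2 ⟨h1, hc⟩)

theorem row_eq (hL : IsPattern N s L) (h : SlideState p L T i j v)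
    (hb : ∀ k, v ≤ k → k ≤ x → L k (i + 1) ≤ j) (k : ℕ) (hv : v ≤ k) (hx : k ≤ x) :
    slideRow L p k = i := by
  induction k, hv using Nat.le_induction with
  | base => exact h.row
  | succ k hv ih =>
    have h1 := ih (by omega)
    have h2 := hb (k + 1) (by omega) hx
    have h3 := hL.mono i hv
    have h4 := h.lt
    simp only at h3
    rw [slideRow, h1, if_neg (by omega)]

/-- If there is no entry to the right of the empty box or below it, the slide has ended. -/
theorem rep_of_end (hL : IsPattern N s L) (hp : L 0 (p + 1) < L 0 p) (h : SlideState p L T i j v)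
    (h1 : T (i, j + 1) = 0) (h2 : T (i + 1, j) = 0) : Rep (pSlide p L) T := by
  have hr := fun k => h.right_level k (fun k' _ => by omega)
  have hb := fun k => h.below_level hL hp k (fun k' _ => by omega)
  have hx : ∀ k, v ≤ k → L k i = j + 1 ∧ slideRow L p k = i := by
    intro k hk
    have g1 := hr k hk
    have g2 := hL.mono i hk
    have g3 := h.lt
    simp only at g2
    exact ⟨by omega, h.row_eq (x := k) hL (fun k' hk' _ => hb k' hk') k hk le_rfl⟩
  intro r c k
  have e : ∀ k' x, k' < x → hybrid L (pSlide p L) x k' = pSlide p L k' := by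
    intro k' x hk'
    funext r
    rw [hybrid, if_pos hk']
  by_cases hrc : (r, c) = (i, j)
  · obtain ⟨rfl, rfl⟩ := Prod.mk.inj hrc
    rw [h.hole]
    refine iff_of_false (by omega) ?_
    rcases lt_or_ge (k + 1) v with hk | hk
    · have := h.passed (k + 1) hk
      omega
    · obtain ⟨e1, e2⟩ := hx (k + 1) hk
      simp only [pSlide, e2, if_true, e1]
      omega
  · rw [h.rep r c hrc k]
    have g1 := lt_hybrid_iff (p := p) (L := L) (v := v) (x := max v (k + 2))
      (fun k hk _ => hx k hk) (le_max_left _ _) (k := k) hrc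
    have g2 := lt_hybrid_iff (p := p) (L := L) (v := v) (x := max v (k + 2))
      (fun k hk _ => hx k hk) (le_max_left _ _) (k := k + 1) hrc
    rw [e _ _ (by omega)] at g1 g2
    rw [← not_lt, ← not_lt, g1, g2]

/-- The empty box moves to `(i', j')`, whose entry `x` moves to `(i, j)`. -/
theorem rep_move (hL : IsPattern N s L) (h : SlideState p L T i j v) {i' j' : ℕ}
    (hx : ∀ k, v ≤ k → k < x → L k i = j + 1 ∧ slideRow L p k = i) (hvx : v ≤ x)
    (r c : ℕ) (hrc : (r, c) ≠ (i', j')) (k : ℕ) :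
    ((T.update (i, j) x).update (i', j') 0) (r, c) = k + 1 ↔
      hybrid L (pSlide p L) x k r ≤ c ∧ c < hybrid L (pSlide p L) x (k + 1) r := by
  simp only [Finsupp.coe_update, Function.update_apply, if_neg hrc]
  by_cases hij : (r, c) = (i, j)
  · obtain ⟨rfl, rfl⟩ := Prod.mk.inj hij
    rw [if_pos rfl]
    have hlow : ∀ k < x, hybrid L (pSlide p L) x k r ≤ c := by
      intro k hk
      rw [hybrid, if_pos hk]
      rcases lt_or_ge k v with hkv | hkv
      · exact h.passed k hkv
      · obtain ⟨e1, e2⟩ := hx k hkv hk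
        simp only [pSlide, e2, if_true, e1]
        omega
    have hhigh : ∀ k ≥ x, c < hybrid L (pSlide p L) x k r := by
      intro k hk
      rw [hybrid, if_neg (by omega)]
      exact h.lt.trans_le (hL.mono r (hvx.trans hk))
    rcases lt_trichotomy x (k + 1) with hk | hk | hk
    · have := hhigh k (by omega)
      omega
    · have := hhigh (k + 1) (by omega)
      have := hlow k (by omega)
      omega
    · have := hlow (k + 1) hk
      omega
  · rw [if_neg hij, h.rep r c hij k, ← not_lt, ← not_lt, lt_hybrid_iff hx hvx hij,
      lt_hybrid_iff hx hvx hij]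

end SlideState

theorem rep_slideAux {N s p : ℕ} {L : Pattern} (hL : IsPattern N s L) (hp : L 0 (p + 1) < L 0 p)
    (n : ℕ) {T : Filling} {i j v : ℕ} (h : SlideState p L T i j v)
    (hn : (T.support.filter fun d => i ≤ d.1 ∧ j ≤ d.2).card ≤ n) :
    Rep (pSlide p L) (slideAux n T (i, j)) := by
  induction n generalizing T i j v with
  | zero =>
    rw [Nat.le_zero, Finset.card_eq_zero, Finset.filter_eq_empty_iff] at hn
    refine h.rep_of_end hL hp ?_ ?_
    · by_contra hc
      exact hn (Finsupp.mem_support_iff.2 hc) (by simp)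
    · by_contra hc
      exact hn (Finsupp.mem_support_iff.2 hc) (by simp)
  | succ n ih =>
    -- the number of boxes weakly southeast of the empty box decreases with every move
    have fuel : ∀ i' j' x, i ≤ i' → j ≤ j' → T (i', j') ≠ 0 →
        (((T.update (i, j) x).update (i', j') 0).support.filter
          fun d => i' ≤ d.1 ∧ j' ≤ d.2).card ≤ n := by
      intro i' j' x hi hj hne
      have hne' : (i', j') ≠ (i, j) := by
        intro e
        rw [e] at hne
        exact hne h.hole
      refine Nat.le_of_lt_succ (lt_of_lt_of_le (Finset.card_lt_card ?_) hn)
      rw [Finset.ssubset_iff_of_subset]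
      · refine ⟨(i', j'), ?_, ?_⟩
        · simp [hne, hi, hj]
        · simp
      · rintro ⟨r, c⟩ hd
        simp only [Finset.mem_filter, Finsupp.mem_support_iff, Finsupp.coe_update,
          Function.update_apply, Prod.mk.injEq, ne_eq] at hd ⊢
        obtain ⟨h1, h2, h3⟩ := hd
        split_ifs at h1 with e1 e2
        · exact absurd rfl h1
        · obtain ⟨rfl, rfl⟩ := e2
          exact absurd (by simp; omega) hne'
        · exact ⟨h1, by omega, by omega⟩
    rw [slideAux]
    split_ifs with h1 h2
    · exact h.rep_of_end hL hp h1.2 h1.1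
    · -- the entry below moves up
      obtain ⟨k₁, hk₁⟩ := Nat.exists_eq_succ_of_ne_zero h2.1
      have hb : ∀ k, v ≤ k → k ≤ k₁ → L k (i + 1) ≤ j := fun k hv hk =>
        h.below_level hL hp k (fun k' hk' => by omega) hv
      have hr : ∀ k, v ≤ k → k ≤ k₁ → L k i ≤ j + 1 := fun k hv hk =>
        h.right_level k (fun k' hk' => by omega) hv
      have hentry := (h.rep (i + 1) j (by simp) k₁).1 hk₁
      have hM := hL.pSlide hp
      have hvk : v ≤ k₁ := by
        by_contra! hc
        rcases (Nat.succ_le_of_lt hc).eq_or_lt with e | e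
        · have h3 := hentry.2
          have h4 := h.below
          rw [Nat.succ_eq_add_one] at e
          rw [hybrid, e, if_neg (lt_irrefl v)] at h3
          omega
        · have h3 := hentry.2
          have h4 := h.passed k₁ hc
          have h5 := hM.il k₁ i
          rw [hybrid, if_pos e] at h3
          omega
      have hlow := hb k₁ hvk le_rfl
      have hhigh := hentry.2
      rw [hybrid, if_neg (by omega)] at hhigh
      have hx : ∀ k, v ≤ k → k < T (i + 1, j) → L k i = j + 1 ∧ slideRow L p k = i := by
        intro k hv hk
        have g1 := hr k hv (by omega)
        have g2 := hL.mono i hv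
        have g3 := h.lt
        simp only at g2
        exact ⟨by omega, h.row_eq (x := k₁) hL hb k hv (by omega)⟩
      refine ih (v := T (i + 1, j)) ⟨?_, ?_, ?_, fun k hk => ?_, ?_, ?_,
        h.rep_move hL hx (by omega)⟩ (fuel _ _ _ (by omega) le_rfl h2.1)
      · rw [hk₁]; exact hhigh
      · rw [hk₁]; exact (hL.il k₁ (i + 1)).trans hlow
      · obtain ⟨e1, e2⟩ := hx k₁ hvk (by omega)
        have := hL.il k₁ i
        rw [hk₁, slideRow, e2, if_pos (by omega)]
      · have g1 := hM.mono (i + 1) (show k ≤ k₁ by omega)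
        have g2 := pSlide_le p L k₁ (i + 1)
        simp only at g1
        omega
      · exact (hL.anti 0 i).trans h.start
      · simp
    · -- the entry to the right moves left
      have h3 : T (i, j + 1) ≠ 0 := by
        intro h3
        rw [h3] at h1 h2
        simp only [and_true, true_or] at h1 h2
        exact h2 h1
      obtain ⟨k₀, hk₀⟩ := Nat.exists_eq_succ_of_ne_zero h3
      have hb : ∀ k, v ≤ k → k ≤ k₀ + 1 → L k (i + 1) ≤ j := fun k hv hk =>
        h.below_level hL hp k (fun k' hk' e => h2 ⟨by omega, by omega⟩) hv
      have hr : ∀ k, v ≤ k → k ≤ k₀ → L k i ≤ j + 1 := fun k hv hk =>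
        h.right_level k (fun k' hk' => by omega) hv
      have hentry := (h.rep i (j + 1) (by simp) k₀).1 hk₀
      have hvk : v ≤ k₀ + 1 := by
        by_contra! hc
        have g1 := hentry.2
        have g2 := h.passed (k₀ + 1) hc
        rw [hybrid, if_pos hc] at g1
        omega
      have hhigh := hentry.2
      rw [hybrid, if_neg (by omega)] at hhigh
      have hx : ∀ k, v ≤ k → k < T (i, j + 1) → L k i = j + 1 ∧ slideRow L p k = i := by
        intro k hv hk
        have g1 := hr k hv (by omega)
        have g2 := hL.mono i hv
        have g3 := h.lt
        simp only at g2
        exact ⟨by omega, h.row_eq (x := k₀ + 1) hL hb k hv (by omega)⟩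
      refine ih (v := T (i, j + 1)) ⟨?_, ?_, ?_, fun k hk => ?_, ?_, ?_,
        h.rep_move hL hx (by omega)⟩ (fuel _ _ _ le_rfl (by omega) h3)
      · rw [hk₀]; exact hhigh
      · rw [hk₀]; exact (hb _ hvk le_rfl).trans (Nat.le_succ j)
      · rw [hk₀]; exact h.row_eq (x := k₀ + 1) hL hb _ hvk le_rfl
      · rcases lt_or_ge k v with hkv | hkv
        · exact (h.passed k hkv).trans (Nat.le_succ j)
        · obtain ⟨e1, e2⟩ := hx k hkv hk
          simp only [pSlide, e2, if_true, e1]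
          omega
      · exact h.start.trans (by omega)
      · simp

theorem Rep.slide {N s p : ℕ} {L : Pattern} {T : Filling} (hL : IsPattern N s L) (h : Rep L T)
    (hp : L 0 (p + 1) < L 0 p) : Rep (pSlide p L) (slide T (p, L 0 p - 1)) := by
  refine rep_slideAux hL hp _ (v := 0) ⟨by omega, by omega, rfl, fun k hk => by omega, by omega,
    ?_, fun r c _ k => ?_⟩ (Finset.card_le_card (Finset.filter_subset _ _))
  · by_contra hc
    have := (h.ne_zero_iff hL).1 hc
    omega
  · simpa [hybrid] using h r c k

/-! ### Rectification of fillings -/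

theorem mem_inner {T : Filling} {r c : ℕ} :
    (r, c) ∈ inner T ↔ (∃ r' c', T (r', c') ≠ 0 ∧ r ≤ r' ∧ c ≤ c') ∧ T (r, c) = 0 := by
  simp [inner, Prod.le_def]

theorem Rep.lt_of_mem_inner {N s : ℕ} {L : Pattern} {T : Filling} (hL : IsPattern N s L)
    (h : Rep L T) {r c : ℕ} (hc : (r, c) ∈ inner T) : c < L 0 r := by
  obtain ⟨⟨r', c', h1, h2, h3⟩, h4⟩ := mem_inner.1 hc
  have h5 := (h.ne_zero_iff hL).1 h1
  have h6 := hL.antitone s h2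
  by_contra! h7
  exact (h.ne_zero_iff hL).2 ⟨h7, by omega⟩ h4

theorem Rep.inner_eq_empty {N s : ℕ} {L : Pattern} {T : Filling} (hL : IsPattern N s L)
    (h0 : L 0 = 0) (h : Rep L T) : inner T = ∅ := by
  refine Finset.eq_empty_of_forall_notMem ?_
  rintro ⟨r, c⟩ hc
  have := h.lt_of_mem_inner hL hc
  simp [h0] at this

/-- The chosen inside corner is the end of the lowest row of the inner shape, if that box has a box
of the tableau to its southeast. -/
theorem Rep.corner_eq {N s p : ℕ} {L : Pattern} {T : Filling} (hL : IsPattern N s L) (h : Rep L T)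
    (hp : L 0 (p + 1) = 0) (hmem : (p, L 0 p - 1) ∈ inner T) : corner T = (p, L 0 p - 1) := by
  have hfst : (inner T).sup Prod.fst = p := by
    refine le_antisymm (Finset.sup_le ?_) (Finset.le_sup (f := Prod.fst) hmem)
    rintro ⟨r, c⟩ hc
    have h1 := h.lt_of_mem_inner hL hc
    by_contra! h2
    have := hL.antitone 0 (show p + 1 ≤ r from h2)
    omega
  rw [corner, hfst]
  congr 1
  refine le_antisymm (Finset.sup_le ?_)
    (Finset.le_sup (f := Prod.snd) (b := (p, L 0 p - 1)) (Finset.mem_filter.2 ⟨hmem, rfl⟩))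
  rintro ⟨r, c⟩ hc
  obtain ⟨hc1, rfl⟩ := Finset.mem_filter.1 hc
  have := h.lt_of_mem_inner hL hc1
  simp only
  omega

theorem Rep.rect_aux {N s : ℕ} {L : Pattern} {T : Filling} (hL : IsPattern N s L) (h : Rep L T) :
    ∃ l, Exhausts l (L 0) ∧ ∃ j ≤ (inner T).card, Rep (slides l L) (rectStep^[j] T) := by
  induction hd : size N L 0 using Nat.strong_induction_on generalizing L T with
  | _ d ih =>
    by_cases h0 : L 0 = 0
    · exact ⟨[], h0, 0, Nat.zero_le _, h⟩
    · obtain ⟨p, hp, hp1⟩ := exists_last_row (hL.antitone 0) (hL.fin 0) h0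
      have hcorner : L 0 (p + 1) < L 0 p := by omega
      have hslide := h.slide hL hcorner
      have hL' := hL.pSlide hcorner
      have hsize := size_pSlide hL hcorner 0
      by_cases hmem : (p, L 0 p - 1) ∈ inner T
      · have hstep : rectStep T = EvacCrystal.slide T (p, L 0 p - 1) := by
          rw [rectStep, if_neg (Finset.ne_empty_of_mem hmem), h.corner_eq hL hp1 hmem]
        rw [← hstep] at hslide
        obtain ⟨l, hl, j, hj, hrep⟩ := ih _ (by omega) hL' hslide rfl
        refine ⟨p :: l, ⟨hcorner, hl⟩, j + 1, ?_, ?_⟩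
        · refine hj.trans_lt (Finset.card_lt_card ?_)
          rw [Finset.ssubset_iff_of_subset]
          · refine ⟨_, hmem, fun hc => ?_⟩
            have := hslide.lt_of_mem_inner hL' hc
            simp only [pSlide, slideRow, if_true] at this
            omega
          · rintro ⟨r, c⟩ hrc
            have h1 := hslide.lt_of_mem_inner hL' hrc
            have h2 := pSlide_le p L 0 r
            obtain ⟨⟨r', c', g1, g2, g3⟩, -⟩ := mem_inner.1 hrc
            refine mem_inner.2 ⟨?_, ?_⟩
            · by_cases hT : T (r', c') = 0
              · -- a new box of the tableau lies weakly northwest of the chosen corner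
                have g4 := (hslide.ne_zero_iff hL').1 g1
                have g5 : ¬ (L 0 r' ≤ c' ∧ c' < L s r') := by
                  rw [← h.ne_zero_iff hL]; exact not_not.2 hT
                have g6 := pSlide_le p L s r'
                have g7 : r' = p ∧ c' = L 0 p - 1 := by
                  have := g4.1
                  rw [pSlide, slideRow] at this
                  by_cases e : r' = p
                  · subst e
                    rw [if_pos rfl] at this
                    omega
                  · rw [if_neg e] at this
                    omega
                obtain ⟨⟨r₂, c₂, g8, g9, g10⟩, -⟩ := mem_inner.1 hmem
                exact ⟨r₂, c₂, g8, by omega, by omega⟩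
              · exact ⟨r', c', hT, g2, g3⟩
            · by_contra hT
              have := (h.ne_zero_iff hL).1 hT
              omega
        · rw [Function.iterate_succ_apply]
          exact hrep
      · have hz : T (p, L 0 p - 1) = 0 := by
          by_contra hT
          have := (h.ne_zero_iff hL).1 hT
          omega
        have hz1 : T (p + 1, L 0 p - 1) = 0 := by
          by_contra hT
          exact hmem (mem_inner.2 ⟨⟨_, _, hT, by omega, le_rfl⟩, hz⟩)
        have hz2 : T (p, L 0 p - 1 + 1) = 0 := by
          by_contra hT
          exact hmem (mem_inner.2 ⟨⟨_, _, hT, le_rfl, by omega⟩, hz⟩)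
        have hT : EvacCrystal.slide T (p, L 0 p - 1) = T := by
          rw [EvacCrystal.slide]
          cases T.support.card with
          | zero => rfl
          | succ n => rw [slideAux, if_pos ⟨hz1, hz2⟩]
        rw [hT] at hslide
        obtain ⟨l, hl, j, hj, hrep⟩ := ih _ (by omega) hL' hslide rfl
        exact ⟨p :: l, ⟨hcorner, hl⟩, j, hj, hrep⟩

/-- Rectification of a filling is described by any sequence of slides that exhausts the inner
shape. -/
theorem Rep.rect {N s : ℕ} {L : Pattern} {T : Filling} (hL : IsPattern N s L) (h : Rep L T)
    {l : List ℕ} (hl : Exhausts l (L 0)) : Rep (slides l L) (rect T) := by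
  obtain ⟨l', hl', j, hj, hrep⟩ := h.rect_aux hL
  have e : slides l' L = slides l L :=
    slides_shift_slides (k := 0) (l₁ := []) hL hl' (slides_zero hl') hl
  have hfix : rectStep (rectStep^[j] T) = rectStep^[j] T := by
    rw [rectStep, if_pos (hrep.inner_eq_empty (hL.slides hl') (slides_zero hl'))]
  have hrect : EvacCrystal.rect T = rectStep^[j] T := by
    rw [EvacCrystal.rect, ← Nat.sub_add_cancel hj, Function.iterate_add_apply,
      Function.iterate_fixed hfix]
  rw [hrect, ← e]
  exact hrep

theorem Rep.rect_dropLE {N s : ℕ} {L : Pattern} {T : Filling} (hL : IsPattern N s L)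
    (h0 : L 0 = 0) (h : Rep L T) (j : ℕ) :
    Rep (EvacCrystal.dem^[j] L) (EvacCrystal.rect (EvacCrystal.dropLE j T)) := by
  obtain ⟨l, hl⟩ := exists_exhausts (hL.antitone j) (hL.fin j)
  rw [← slides_shift_eq_dem_iterate hL h0 j hl]
  exact (h.dropLE j).rect hL.shift (by rwa [shift_zero])

/-! ### Evacuation of fillings -/

theorem Rep.demote {N s : ℕ} {L : Pattern} {T : Filling} (hL : IsPattern N (s + 1) L)
    (h0 : L 0 = 0) (h : Rep L T) :
    (demote (s + 1) T).support = T.support ∧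
      Rep (EvacCrystal.dem L) (EvacCrystal.restrictLE s (demote (s + 1) T)) := by
  have hY := h.rect_dropLE hL h0 1
  have hD : IsPattern N s (dem L) := hL.dem h0
  rw [Function.iterate_one] at hY
  have hle : ∀ c, EvacCrystal.rect (EvacCrystal.dropLE 1 T) c ≤ s := hY.le hD
  have hsub : ∀ c, EvacCrystal.rect (EvacCrystal.dropLE 1 T) c ≠ 0 → T c ≠ 0 := by
    rintro ⟨r, c⟩ hc
    have g1 := (hY.ne_zero_iff hD).1 hc
    have g2 := (dem_interlace hL h0 s r).1
    exact (h.ne_zero_iff hL).2 ⟨by simp [h0], by omega⟩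
  have hval : ∀ c, EvacCrystal.demote (s + 1) T c =
      if EvacCrystal.rect (EvacCrystal.dropLE 1 T) c ≠ 0 then
        EvacCrystal.rect (EvacCrystal.dropLE 1 T) c
      else if T c ≠ 0 then s + 1 else 0 := by
    intro c
    simp only [EvacCrystal.demote, Finsupp.add_apply, Finsupp.indicator_apply, Finset.mem_sdiff,
      Finsupp.mem_support_iff, dite_eq_ite]
    split_ifs <;> omega
  constructor
  · ext c
    rw [Finsupp.mem_support_iff, Finsupp.mem_support_iff, hval]
    have := hsub c
    split_ifs <;> simp_all
  · convert hY using 1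
    ext c
    rw [EvacCrystal.restrictLE, Finsupp.filter_apply, hval]
    have := hle c
    split_ifs <;> omega

theorem Rep.evacStage {N s : ℕ} {L : Pattern} {T : Filling} (hL : IsPattern N s L)
    (h0 : L 0 = 0) (h : Rep L T) {k : ℕ} (hk : k < s) :
    ∃ X, Rep (dem^[k] L) X ∧ evacStage s T k = EvacCrystal.demote (s - k) X := by
  induction k with
  | zero => exact ⟨T, h, rfl⟩
  | succ k ih =>
    obtain ⟨X, hX, e⟩ := ih (by omega)
    obtain ⟨h1, h2⟩ := hL.dem_iterate h0 k
    obtain ⟨d, hd⟩ : ∃ d, s - k = d + 1 := ⟨s - k - 1, by omega⟩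
    have hd' : s - (k + 1) = d := by omega
    rw [hd] at h1 e
    refine ⟨EvacCrystal.restrictLE d (EvacCrystal.demote (d + 1) X), ?_, ?_⟩
    · rw [Function.iterate_succ_apply']
      exact (hX.demote h1 h2).2
    · rw [EvacCrystal.evacStage, hd', e]

theorem Rep.mem_evacShape {N s : ℕ} {L : Pattern} {T : Filling} (hL : IsPattern N s L)
    (h0 : L 0 = 0) (h : Rep L T) {i : ℕ} (hi : i ≤ s) (r c : ℕ) :
    (r, c) ∈ evacShape s T i ↔ c < pEvac s L i r := by
  rcases Nat.eq_zero_or_pos i with rfl | hi0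
  · rw [pEvac_zero hL h0]
    simp [evacShape]
  · obtain ⟨X, hX, e⟩ := h.evacStage hL h0 (k := s - i) (by omega)
    obtain ⟨h1, h2⟩ := hL.dem_iterate h0 (s - i)
    obtain ⟨d, rfl⟩ : ∃ d, i = d + 1 := ⟨i - 1, by omega⟩
    rw [show s - (s - (d + 1)) = d + 1 by omega] at h1 e
    rw [evacShape, if_neg (by omega), e, (hX.demote h1 h2).1, hX.mem_support h1, h2, pEvac]
    simp

theorem Rep.evac {N s : ℕ} {L : Pattern} {T : Filling} (hL : IsPattern N s L) (h0 : L 0 = 0)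
    (h : Rep L T) : Rep (pEvac s L) (evac s T) := by
  have hE := hL.pEvac h0
  have hval : ∀ r c, EvacCrystal.evac s T (r, c) = ∑ i ∈ Finset.Icc 1 s,
      if pEvac s L (i - 1) r ≤ c ∧ c < pEvac s L i r then i else 0 := by
    intro r c
    rw [EvacCrystal.evac, Finsupp.finsetSum_apply]
    refine Finset.sum_congr rfl fun i hi => ?_
    obtain ⟨h1, h2⟩ := Finset.mem_Icc.1 hi
    rw [Finsupp.indicator_apply]
    simp only [Finset.mem_sdiff, h.mem_evacShape hL h0 h2,
      h.mem_evacShape hL h0 (show i - 1 ≤ s by omega), dite_eq_ite, not_lt, and_comm]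
  have key : ∀ r c k, pEvac s L k r ≤ c ∧ c < pEvac s L (k + 1) r →
      EvacCrystal.evac s T (r, c) = k + 1 := by
    intro r c k hk
    have hks : k + 1 ≤ s := by
      by_contra! hc
      have h1 := hE.stab k r (by omega)
      have h2 := hE.stab (k + 1) r (by omega)
      omega
    rw [hval, Finset.sum_eq_single (k + 1), if_pos (by simpa using hk)]
    · intro i hi hne
      refine if_neg fun hc => ?_
      obtain ⟨h1, h2⟩ := Finset.mem_Icc.1 hi
      rcases lt_or_gt_of_ne hne with hlt | hlt
      · have := hE.mono r (show i ≤ k by omega)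
        simp only at this
        omega
      · have := hE.mono r (show k + 1 ≤ i - 1 by omega)
        simp only at this
        omega
    · intro hc
      exact absurd (Finset.mem_Icc.2 ⟨by omega, hks⟩) hc
  intro r c k
  refine ⟨fun hk => ?_, key r c k⟩
  have hne : EvacCrystal.evac s T (r, c) ≠ 0 := by omega
  rw [hval] at hne
  obtain ⟨i, hi, hi'⟩ := Finset.exists_ne_zero_of_sum_ne_zero hne
  have hcond : pEvac s L (i - 1) r ≤ c ∧ c < pEvac s L i r := by
    by_contra hc
    exact hi' (if_neg hc)
  obtain ⟨h1, -⟩ := Finset.mem_Icc.1 hi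
  obtain ⟨d, rfl⟩ : ∃ d, i = d + 1 := ⟨i - 1, by omega⟩
  rw [Nat.add_sub_cancel] at hcond
  have := key r c d hcond
  obtain rfl : d = k := by omega
  exact hcond

/-! ### Crystal operators on fillings -/

/-- The column statistic of three consecutive levels: the number of entries `i + 1` minus the number
of entries `i` in column `j` or to the right. -/
def colStat (N : ℕ) (y x b : ℕ → ℕ) (j : ℕ) : ℤ :=
  ∑ r ∈ Finset.range N, ((max (b r) j : ℤ) - 2 * (max (x r) j : ℤ) + (max (y r) j : ℤ))

theorem hRow_eq_sum (y x b : ℕ → ℕ) (r : ℕ) :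
    hRow y x b r = ∑ q ∈ Finset.range r, ((b q : ℤ) - 2 * x q + y q) + b r - x r := by
  induction r with
  | zero => simp [hRow]
  | succ r ih =>
    rw [hRow, ih, Finset.sum_range_succ]
    ring

namespace Strips

variable {N : ℕ} {y x b : ℕ → ℕ}

theorem x_antitone (h : Strips N y x b) : Antitone x :=
  antitone_nat_of_succ_le fun r => (h.xy r).trans (h.yx r)

theorem colStat_eq_sum (h : Strips N y x b) {j M : ℕ} (hM : ∀ q, M ≤ q → b q ≤ j) :
    colStat N y x b j = ∑ r ∈ Finset.range M,
      ((max (b r) j : ℤ) - 2 * (max (x r) j : ℤ) + (max (y r) j : ℤ)) := by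
  have hz : ∀ q, b q ≤ j →
      ((max (b q) j : ℤ) - 2 * (max (x q) j : ℤ) + (max (y q) j : ℤ)) = 0 := by
    intro q hq
    have h1 := h.yx q
    have h2 := h.xb q
    omega
  have key : ∀ A, (∀ q, A ≤ q → b q ≤ j) → ∑ r ∈ Finset.range A,
      ((max (b r) j : ℤ) - 2 * (max (x r) j : ℤ) + (max (y r) j : ℤ)) =
      ∑ r ∈ Finset.range (max A M),
      ((max (b r) j : ℤ) - 2 * (max (x r) j : ℤ) + (max (y r) j : ℤ)) := by
    intro A hA
    refine Finset.sum_subset (Finset.range_mono (le_max_left A M)) fun q _ hq => hz q (hA q ?_)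
    simpa using hq
  rw [colStat, key N fun q hq => by rw [h.fin q hq]; omega]
  refine (Finset.sum_subset (Finset.range_mono (le_max_right N M))
    fun q _ hq => hz q (hM q ?_)).symm
  simpa using hq

theorem colStat_of_le (h : Strips N y x b) {j r : ℕ} (hr : x r ≤ j) :
    colStat N y x b j = ∑ q ∈ Finset.range r,
      ((max (b q) j : ℤ) - 2 * (max (x q) j : ℤ) + (max (y q) j : ℤ)) + (max (b r) j - j) := by
  rw [h.colStat_eq_sum (M := r + 1), Finset.sum_range_succ]
  · have := h.yx r
    omega
  · intro q hq
    obtain ⟨q, rfl⟩ : ∃ p, q = p + 1 := ⟨q - 1, by omega⟩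
    exact (h.bx q).trans ((h.x_antitone (by omega)).trans hr)

/-- The row statistic is the column statistic at the end of the row. -/
theorem colStat_apply (h : Strips N y x b) (r : ℕ) :
    colStat N y x b (x r) = hRow y x b r := by
  rw [h.colStat_of_le le_rfl, hRow_eq_sum]
  have h1 : ∀ q ∈ Finset.range r,
      ((max (b q) (x r) : ℤ) - 2 * (max (x q) (x r) : ℤ) + (max (y q) (x r) : ℤ)) =
      (b q : ℤ) - 2 * x q + y q := by
    intro q hq
    have g1 := h.xy q
    have g2 := h.x_antitone (show q + 1 ≤ r by simpa using hq)
    have g3 := h.yx q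
    have g4 := h.xb q
    omega
  rw [Finset.sum_congr rfl h1]
  have := h.xb r
  omega

/-- The column statistic in terms of the row statistic; `r` is the topmost row in which column `j`
lies beyond the entries `i`. -/
theorem exists_colStat_eq (h : Strips N y x b) (j : ℕ) :
    ∃ r, x r ≤ j ∧ (∀ q < r, j < x q) ∧
      (colStat N y x b j = hRow y x b r - (b r - x r) + (max (b r) j - j) ∨
        ∃ q, r = q + 1 ∧ colStat N y x b j = hRow y x b q - x q + max (b r) j) := by
  have hex : ∃ r, x r ≤ j := ⟨N, by rw [h.xfin le_rfl]; omega⟩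
  classical
  refine ⟨Nat.find hex, Nat.find_spec hex, fun q hq => not_le.1 (Nat.find_min hex hq), ?_⟩
  have hmin := fun q => Nat.find_min hex (m := q)
  have hspec := Nat.find_spec hex
  generalize Nat.find hex = r at *
  rw [h.colStat_of_le hspec]
  cases r with
  | zero => left; simp [hRow]
  | succ r =>
    have h1 : ∀ q ∈ Finset.range r,
        ((max (b q) j : ℤ) - 2 * (max (x q) j : ℤ) + (max (y q) j : ℤ)) =
        (b q : ℤ) - 2 * x q + y q := by
      intro q hq
      have g1 := h.xy q
      have g2 := hmin (q + 1) (by have := Finset.mem_range.1 hq; omega)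
      have g3 := h.yx q
      have g4 := h.xb q
      omega
    have h2 := hmin r (by omega)
    have h3 := h.yx r
    have h4 := h.xb r
    have h5 := h.xb (r + 1)
    rw [hRow_eq_sum y x b (r + 1), Finset.sum_range_succ, Finset.sum_range_succ,
      Finset.sum_congr rfl h1]
    rcases le_total j (y r) with hj | hj
    · left
      omega
    · right
      exact ⟨r, rfl, by rw [hRow_eq_sum]; omega⟩

theorem colStat_le (h : Strips N y x b) (j : ℕ) : ∃ r, colStat N y x b j ≤ hRow y x b r := by
  obtain ⟨r, h1, h2, h3 | ⟨q, rfl, h3⟩⟩ := h.exists_colStat_eq j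
  · have := h.xb r
    exact ⟨r, by omega⟩
  · have g1 := h2 q (by omega)
    have g2 := h.bx q
    exact ⟨q, by omega⟩

theorem raise_colStat (h : Strips N y x b) {r : ℕ} (hr : IsRaiseRow y x b r) :
    0 < colStat N y x b (x r) ∧ (∀ j, colStat N y x b j ≤ colStat N y x b (x r)) ∧
      ∀ j, x r < j → colStat N y x b j < colStat N y x b (x r) := by
  rw [h.colStat_apply]
  refine ⟨hr.1, fun j => ?_, fun j hj => ?_⟩
  · obtain ⟨q, hq⟩ := h.colStat_le j
    exact hq.trans (hr.2.2 q)
  · have hb := (h.raise_bounds hr).1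
    obtain ⟨q, h1, h2, h3 | ⟨q, rfl, h3⟩⟩ := h.exists_colStat_eq j
    · have g1 : q ≤ r := by
        by_contra! hc
        have := h2 r hc
        omega
      have g2 := h.xb q
      rcases g1.eq_or_lt with rfl | hlt
      · omega
      · have := hr.2.1 q hlt
        omega
    · have g1 := h2 q (by omega)
      have g2 := h.bx q
      have g3 : q < r := by
        by_contra! hc
        have := h.x_antitone hc
        omega
      have := hr.2.1 q g3
      omega

theorem lower_colStat (h : Strips N y x b) {r : ℕ} (hr : IsLowerRow y x b r) :
    (∀ j, colStat N y x b j ≤ colStat N y x b (x r)) ∧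
      ∀ j, j < x r → colStat N y x b j < colStat N y x b (x r) := by
  rw [h.colStat_apply]
  refine ⟨fun j => ?_, fun j hj => ?_⟩
  · obtain ⟨q, hq⟩ := h.colStat_le j
    exact hq.trans (hr.1 q)
  · have hb := (h.lower_bounds hr).2
    obtain ⟨q, h1, h2, h3 | ⟨q, rfl, h3⟩⟩ := h.exists_colStat_eq j
    · have g1 : r < q := by
        by_contra! hc
        have := h.x_antitone hc
        omega
      have g2 := h.xb q
      have := hr.2 q g1
      omega
    · have g1 := h2 q (by omega)
      have g2 := h.bx q
      have g3 : r ≤ q := by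
        by_contra! hc
        have := h.x_antitone (show q + 1 ≤ r from hc)
        omega
      rcases g3.eq_or_lt with rfl | hlt
      · omega
      · have := hr.2 q hlt
        omega

end Strips

section Count

variable {N s : ℕ} {L : Pattern} {T : Filling}

theorem Rep.card_filter (hL : IsPattern N s L) (h : Rep L T) (k j : ℕ) :
    ((T.support.filter fun c => j ≤ c.2 ∧ T c = k + 1).card : ℤ) =
      ∑ r ∈ Finset.range N, ((max (L (k + 1) r) j : ℤ) - (max (L k r) j : ℤ)) := by
  have hcard : (T.support.filter fun c => j ≤ c.2 ∧ T c = k + 1).card =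
      ((Finset.range N).sigma fun r => Finset.Ico (max (L k r) j) (max (L (k + 1) r) j)).card := by
    refine Finset.card_nbij' (fun c => ⟨c.1, c.2⟩) (fun c => (c.1, c.2)) ?_ ?_
      (fun _ _ => rfl) (fun _ _ => rfl)
    · rintro ⟨r, c⟩ hc
      obtain ⟨-, h1, h2⟩ := Finset.mem_filter.1 hc
      have h3 := (h r c k).1 h2
      have h4 : r < N := by
        by_contra! hr
        have := hL.fin (k + 1) r hr
        omega
      simp only [Finset.mem_coe, Finset.mem_sigma, Finset.mem_range, Finset.mem_Ico]
      simp only at h1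
      exact ⟨h4, by omega, by omega⟩
    · rintro ⟨r, c⟩ hc
      simp only [Finset.mem_coe, Finset.mem_sigma, Finset.mem_range, Finset.mem_Ico] at hc
      have h2 := (h r c k).2 ⟨by omega, by omega⟩
      simp only [Finset.mem_coe, Finset.mem_filter, Finsupp.mem_support_iff]
      exact ⟨by omega, by omega, h2⟩
  rw [hcard, Finset.card_sigma, Nat.cast_sum]
  refine Finset.sum_congr rfl fun r _ => ?_
  have := hL.up k r
  rw [Nat.card_Ico]
  omega

theorem Rep.hStat_eq (hL : IsPattern N s L) (h : Rep L T) (n j : ℕ) :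
    hStat (n + 1) T j = colStat N (L n) (L (n + 1)) (L (n + 2)) j := by
  rw [hStat, h.card_filter hL, h.card_filter hL, ← Finset.sum_sub_distrib, colStat]
  refine Finset.sum_congr rfl fun r _ => ?_
  have : L (n + 1 + 1) r = L (n + 2) r := rfl
  omega

theorem card_filter_split (T : Filling) (a j : ℕ) :
    ((T.support.filter fun c => c.2 ≤ j ∧ T c = a).card : ℤ) =
      (T.support.filter fun c => 0 ≤ c.2 ∧ T c = a).card -
        (T.support.filter fun c => j + 1 ≤ c.2 ∧ T c = a).card := by
  have h := Finset.card_filter_add_card_filter_not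
    (s := T.support.filter fun c => 0 ≤ c.2 ∧ T c = a) (fun c => c.2 ≤ j)
  rw [Finset.filter_filter, Finset.filter_filter] at h
  have e1 : (T.support.filter fun c => (0 ≤ c.2 ∧ T c = a) ∧ c.2 ≤ j) =
      T.support.filter fun c => c.2 ≤ j ∧ T c = a :=
    Finset.filter_congr fun c _ => by omega
  have e2 : (T.support.filter fun c => (0 ≤ c.2 ∧ T c = a) ∧ ¬ c.2 ≤ j) =
      T.support.filter fun c => j + 1 ≤ c.2 ∧ T c = a :=
    Finset.filter_congr fun c _ => by omega
  rw [e1, e2] at h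
  omega

theorem Rep.kStat_eq (hL : IsPattern N s L) (h : Rep L T) (n j : ℕ) :
    kStat (n + 1) T j = colStat N (L n) (L (n + 1)) (L (n + 2)) (j + 1) -
      colStat N (L n) (L (n + 1)) (L (n + 2)) 0 := by
  rw [← h.hStat_eq hL, ← h.hStat_eq hL, kStat, card_filter_split, card_filter_split, hStat, hStat]
  ring

theorem Rep.isRaisingColumn_iff (hL : IsPattern N s L) (h : Rep L T) (n j : ℕ) :
    IsRaisingColumn (n + 1) T j ↔
      ∃ r, IsRaiseRow (L n) (L (n + 1)) (L (n + 2)) r ∧ j = L (n + 1) r := by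
  have hst := hL.strips n
  simp only [IsRaisingColumn, h.hStat_eq hL]
  constructor
  · rintro ⟨h1, h2, h3⟩
    obtain ⟨q, hq⟩ := hst.colStat_le j
    obtain ⟨r, hr⟩ := hst.exists_raiseRow_iff.2 ⟨q, h1.trans_le hq⟩
    obtain ⟨g1, g2, g3⟩ := hst.raise_colStat hr
    refine ⟨r, hr, ?_⟩
    rcases lt_trichotomy j (L (n + 1) r) with hlt | heq | hlt
    · exact absurd (g2 j) (not_le.2 (h3 _ hlt))
    · exact heq
    · exact absurd (h2 (L (n + 1) r)) (not_le.2 (g3 _ hlt))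
  · rintro ⟨r, hr, rfl⟩
    exact hst.raise_colStat hr

theorem Rep.isLoweringColumn_iff (hL : IsPattern N s L) (h : Rep L T) (n j : ℕ) :
    IsLoweringColumn (n + 1) T j ↔
      ∃ r, IsLowerRow (L n) (L (n + 1)) (L (n + 2)) r ∧ j + 1 = L (n + 1) r := by
  have hst := hL.strips n
  simp only [IsLoweringColumn, h.kStat_eq hL, sub_le_sub_iff_right, sub_lt_sub_iff_right, sub_pos]
  constructor
  · rintro ⟨h1, h2, h3⟩
    obtain ⟨q, hq⟩ := hst.colStat_le (j + 1)
    have hN : colStat N (L n) (L (n + 1)) (L (n + 2)) 0 =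
        hRow (L n) (L (n + 1)) (L (n + 2)) N := by
      rw [← hst.colStat_apply, hst.xfin le_rfl]
    obtain ⟨r, hr⟩ := hst.exists_lowerRow_iff.2 ⟨q, fun q' hq' => by
      rw [hst.hRow_eventually hq', ← hN]
      exact h1.trans_le hq⟩
    obtain ⟨g2, g3⟩ := hst.lower_colStat hr
    have hb := (hst.lower_bounds hr).1
    obtain ⟨c, hc⟩ : ∃ c, L (n + 1) r = c + 1 := ⟨L (n + 1) r - 1, by omega⟩
    refine ⟨r, hr, ?_⟩
    rw [hc] at g2 g3 ⊢
    rcases lt_trichotomy j c with hlt | heq | hlt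
    · exact absurd (h2 c) (not_le.2 (g3 _ (by omega)))
    · rw [heq]
    · exact absurd (g2 (j + 1)) (not_le.2 (h3 _ hlt))
  · rintro ⟨r, hr, hj⟩
    obtain ⟨g2, g3⟩ := hst.lower_colStat hr
    rw [← hj] at g2 g3
    exact ⟨g3 0 (by omega), fun j' => g2 _, fun j' hj' => g3 _ (by omega)⟩

/-- Changing one box of a tableau. -/
theorem Rep.of_change {L' : Pattern} {T' : Filling} {r c v : ℕ} (hL' : IsPattern N s L')
    (h : Rep L T) (hv : L' v r ≤ c ∧ c < L' (v + 1) r) (hT : T' (r, c) = v + 1)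
    (hL : ∀ r' c', (r', c') ≠ (r, c) → ∀ k, (c' < L' k r' ↔ c' < L k r'))
    (hT' : ∀ r' c', (r', c') ≠ (r, c) → T' (r', c') = T (r', c')) : Rep L' T' := by
  intro r' c' k
  by_cases e : (r', c') = (r, c)
  · obtain ⟨rfl, rfl⟩ := Prod.mk.inj e
    rw [hT]
    constructor
    · intro hk
      obtain rfl : v = k := by omega
      exact hv
    · intro hk
      have h1 := hL'.mono r' (a := k + 1) (b := v)
      have h2 := hL'.mono r' (a := v + 1) (b := k)
      simp only at h1 h2
      omega
  · rw [hT' r' c' e, h r' c' k, ← not_lt, ← not_lt, hL _ _ e, hL _ _ e]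

theorem replaceInColumn_apply (j a b : ℕ) (T : Filling) (c : ℕ × ℕ) :
    replaceInColumn j a b T c = if c ∈ T.support ∧ c.2 = j ∧ T c = a then b else T c := rfl

theorem Rep.raise {n r : ℕ} (hL : IsPattern N s L) (hn : n + 1 < s) (h : Rep L T)
    (hr : IsRaiseRow (L n) (L (n + 1)) (L (n + 2)) r) :
    ∃ L', Raise n L L' ∧ Rep L' (replaceInColumn (L (n + 1) r) (n + 2) (n + 1) T) := by
  have hst := hL.strips n
  obtain ⟨b1, b2⟩ := hst.raise_bounds hr
  have hraise : Raise n L _ := ⟨r, hr, rfl⟩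
  refine ⟨_, hraise, h.of_change (hraise.lower hL hn).1 (r := r) (c := L (n + 1) r) (v := n)
    ?_ ?_ ?_ ?_⟩
  · have := hst.yx r
    simp only [show ¬ n = n + 1 by omega, false_and, if_false, true_and, if_true]
    omega
  · have h1 : T (r, L (n + 1) r) = n + 1 + 1 := (h _ _ _).2 ⟨le_rfl, b1⟩
    rw [replaceInColumn_apply, if_pos ⟨Finsupp.mem_support_iff.2 (by omega), rfl, h1⟩]
  · intro r' c' hne k
    split_ifs with hk
    · obtain ⟨rfl, rfl⟩ := hk
      have : c' ≠ L (n + 1) r' := fun e => hne (by rw [e])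
      omega
    · rfl
  · intro r' c' hne
    rw [replaceInColumn_apply, if_neg]
    rintro ⟨-, h1, h2⟩
    have h3 := (h r' c' (n + 1)).1 h2
    simp only at h1
    rcases lt_trichotomy r' r with hlt | rfl | hlt
    · obtain ⟨q, rfl⟩ : ∃ q, r = q + 1 := ⟨r - 1, by omega⟩
      have g1 := hst.bx q
      have g2 := hst.x_antitone (show r' ≤ q by omega)
      omega
    · exact hne (by rw [h1])
    · obtain ⟨q, rfl⟩ : ∃ q, r' = q + 1 := ⟨r' - 1, by omega⟩
      have g1 : L (n + 1 + 1) (q + 1) ≤ L (n + 1) q := hst.bx q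
      have g2 := hst.x_antitone (show r ≤ q by omega)
      omega

theorem Rep.lower {n r : ℕ} (hL : IsPattern N s L) (hn : n + 1 < s) (h : Rep L T)
    (hr : IsLowerRow (L n) (L (n + 1)) (L (n + 2)) r) :
    ∃ L', Lower n L L' ∧ Rep L' (replaceInColumn (L (n + 1) r - 1) (n + 1) (n + 2) T) := by
  have hst := hL.strips n
  obtain ⟨b1, b2⟩ := hst.lower_bounds hr
  have hlower : Lower n L _ := ⟨r, hr, rfl⟩
  refine ⟨_, hlower, h.of_change (hlower.raise hL hn).1 (r := r) (c := L (n + 1) r - 1)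
    (v := n + 1) ?_ ?_ ?_ ?_⟩
  · have := hst.xb r
    simp only [show ¬ n + 1 + 1 = n + 1 by omega, false_and, if_false, true_and, if_true]
    have : L (n + 1 + 1) r = L (n + 2) r := rfl
    omega
  · have h1 : T (r, L (n + 1) r - 1) = n + 1 := (h _ _ _).2 ⟨by omega, by omega⟩
    rw [replaceInColumn_apply, if_pos ⟨Finsupp.mem_support_iff.2 (by omega), rfl, h1⟩]
  · intro r' c' hne k
    split_ifs with hk
    · obtain ⟨rfl, rfl⟩ := hk
      have : c' ≠ L (n + 1) r' - 1 := fun e => hne (by rw [e])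
      omega
    · rfl
  · intro r' c' hne
    rw [replaceInColumn_apply, if_neg]
    rintro ⟨-, h1, h2⟩
    have h3 := (h r' c' n).1 h2
    simp only at h1
    rcases lt_trichotomy r' r with hlt | rfl | hlt
    · have g1 := hst.xy r'
      have g2 := hst.x_antitone (show r' + 1 ≤ r by omega)
      omega
    · exact hne (by rw [h1])
    · have g1 := hst.xy r
      have g2 := hst.x_antitone (show r + 1 ≤ r' by omega)
      omega

end Count

/-- The operators `e_i` (for `true`) and `f_i` (for `false`). -/
noncomputable def op : Bool → ℕ → Filling → Option Filling
  | true => eOp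
  | false => fOp

/-- The operators on tableaux are those on patterns. -/
theorem Rep.op_eq_some_iff {N s n : ℕ} {d : Bool} {L : Pattern} {T T' : Filling}
    (hL : IsPattern N s L) (hn : n + 1 < s) (h : Rep L T) :
    op d (n + 1) T = some T' ↔ ∃ L', Step d n L L' ∧ Rep L' T' := by
  cases d
  · constructor
    · intro he
      simp only [op, fOp] at he
      split_ifs at he with hex
      obtain ⟨r, hr, hj⟩ := (h.isLoweringColumn_iff hL n _).1 hex.choose_spec
      obtain ⟨L', h1, h2⟩ := h.lower hL hn hr
      rw [← hj, Nat.add_sub_cancel] at h2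
      exact ⟨L', h1, Option.some.inj he ▸ h2⟩
    · rintro ⟨L', ⟨r, hr, hL'⟩, hrep⟩
      have hpos := ((hL.strips n).lower_bounds hr).1
      have hex : ∃ j, IsLoweringColumn (n + 1) T j :=
        ⟨L (n + 1) r - 1, (h.isLoweringColumn_iff hL n _).2 ⟨r, hr, by omega⟩⟩
      obtain ⟨r', hr', hj⟩ := (h.isLoweringColumn_iff hL n _).1 hex.choose_spec
      obtain ⟨L'', h1, h2⟩ := h.lower hL hn hr'
      rw [← hj, Nat.add_sub_cancel] at h2
      have e := Lower.unique h1 ⟨r, hr, hL'⟩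
      subst e
      simp only [op, fOp]
      rw [dif_pos hex, h2.unique hrep]
  · constructor
    · intro he
      simp only [op, eOp] at he
      split_ifs at he with hex
      obtain ⟨r, hr, hj⟩ := (h.isRaisingColumn_iff hL n _).1 hex.choose_spec
      obtain ⟨L', h1, h2⟩ := h.raise hL hn hr
      rw [← hj] at h2
      exact ⟨L', h1, Option.some.inj he ▸ h2⟩
    · rintro ⟨L', ⟨r, hr, hL'⟩, hrep⟩
      have hex : ∃ j, IsRaisingColumn (n + 1) T j :=
        ⟨L (n + 1) r, (h.isRaisingColumn_iff hL n _).2 ⟨r, hr, rfl⟩⟩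
      obtain ⟨r', hr', hj⟩ := (h.isRaisingColumn_iff hL n _).1 hex.choose_spec
      obtain ⟨L'', h1, h2⟩ := h.raise hL hn hr'
      rw [← hj] at h2
      have e := Raise.unique h1 ⟨r, hr, hL'⟩
      subst e
      simp only [op, eOp]
      rw [dif_pos hex, h2.unique hrep]

/-- If an operator is defined on the pattern, it is defined on the tableau. -/
theorem Rep.exists_op {N s n : ℕ} {d : Bool} {L L' : Pattern} {T : Filling}
    (hL : IsPattern N s L) (hn : n + 1 < s) (h : Rep L T) (hstep : Step d n L L') :
    ∃ T', op d (n + 1) T = some T' ∧ Rep L' T' := by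
  cases d
  · obtain ⟨r, hr, hL'⟩ := hstep
    obtain ⟨L'', h1, h2⟩ := h.lower hL hn hr
    have e := Lower.unique h1 ⟨r, hr, hL'⟩
    subst e
    exact ⟨_, (h.op_eq_some_iff hL hn).2 ⟨_, h1, h2⟩, h2⟩
  · obtain ⟨r, hr, hL'⟩ := hstep
    obtain ⟨L'', h1, h2⟩ := h.raise hL hn hr
    have e := Raise.unique h1 ⟨r, hr, hL'⟩
    subst e
    exact ⟨_, (h.op_eq_some_iff hL hn).2 ⟨_, h1, h2⟩, h2⟩

/-! ### Operators and evacuation on tableaux of a fixed shape -/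

theorem Step.mem_tableaux {κ : YoungDiagram} {s n : ℕ} {d : Bool} {L' : Pattern} {T T' : Filling}
    (hT : T ∈ tableaux κ s) (hn : n + 1 < s) (h : Step d n (toPattern T) L') (h' : Rep L' T') :
    T' ∈ tableaux κ s := by
  obtain ⟨p1, p2, p3, p4⟩ := toPattern_spec hT
  exact h'.mem_tableaux (h.symm p1 hn).1 (by rw [h.level (by omega), p2])
    fun r => by rw [h.level (by omega), p4]

theorem op_toPattern {κ : YoungDiagram} {s n : ℕ} {d : Bool} {T T' : Filling}
    (hT : T ∈ tableaux κ s) (hn : n + 1 < s) (h : op d (n + 1) T = some T') :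
    T' ∈ tableaux κ s ∧ Step d n (toPattern T) (toPattern T') := by
  obtain ⟨p1, p2, p3, p4⟩ := toPattern_spec hT
  obtain ⟨L', h1, h2⟩ := (p3.op_eq_some_iff p1 hn).1 h
  have hT' := h1.mem_tableaux hT hn h2
  obtain ⟨q1, q2, q3, q4⟩ := toPattern_spec hT'
  refine ⟨hT', ?_⟩
  rwa [← h2.pattern_unique (h1.symm p1 hn).1 (by rw [h1.level (by omega), p2]) q1 q2 q3]

theorem op_mem {κ : YoungDiagram} {s i : ℕ} {d : Bool} {T T' : Filling} (hT : T ∈ tableaux κ s)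
    (hi : 1 ≤ i) (his : i < s) (h : op d i T = some T') : T' ∈ tableaux κ s := by
  obtain ⟨n, rfl⟩ : ∃ n, i = n + 1 := ⟨i - 1, by omega⟩
  exact (op_toPattern hT his h).1

theorem op_symm {κ : YoungDiagram} {s i : ℕ} {d : Bool} {T T' : Filling} (hT : T ∈ tableaux κ s)
    (hi : 1 ≤ i) (his : i < s) (h : op d i T = some T') : op (!d) i T' = some T := by
  obtain ⟨n, rfl⟩ : ∃ n, i = n + 1 := ⟨i - 1, by omega⟩
  obtain ⟨hT', hstep⟩ := op_toPattern hT his h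
  obtain ⟨p1, p2, p3, p4⟩ := toPattern_spec hT
  obtain ⟨q1, q2, q3, q4⟩ := toPattern_spec hT'
  exact (q3.op_eq_some_iff q1 his).2 ⟨_, (hstep.symm p1 his).2, p3⟩

theorem evac_mem {κ : YoungDiagram} {s : ℕ} {T : Filling} (hT : T ∈ tableaux κ s) :
    evac s T ∈ tableaux κ s := by
  obtain ⟨p1, p2, p3, p4⟩ := toPattern_spec hT
  exact (p3.evac p1 p2).mem_tableaux (p1.pEvac p2) (pEvac_zero p1 p2)
    fun r => by rw [pEvac_of_le le_rfl, p4]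

theorem evac_evac {κ : YoungDiagram} {s : ℕ} {T : Filling} (hT : T ∈ tableaux κ s) :
    evac s (evac s T) = T := by
  obtain ⟨p1, p2, p3, p4⟩ := toPattern_spec hT
  have h := (p3.evac p1 p2).evac (p1.pEvac p2) (pEvac_zero p1 p2)
  rw [pEvac_pEvac p1 p2] at h
  exact h.unique p3

theorem op_evac {κ : YoungDiagram} {s i : ℕ} {d : Bool} {T T' : Filling} (hT : T ∈ tableaux κ s)
    (hi : 1 ≤ i) (his : i < s) (h : op d i T = some T') :
    op (!d) (s - i) (evac s T) = some (evac s T') := by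
  obtain ⟨n, rfl⟩ : ∃ n, i = n + 1 := ⟨i - 1, by omega⟩
  obtain ⟨hT', hstep⟩ := op_toPattern hT his h
  obtain ⟨p1, p2, p3, p4⟩ := toPattern_spec hT
  obtain ⟨q1, q2, q3, q4⟩ := toPattern_spec hT'
  rw [show s - (n + 1) = s - 2 - n + 1 by omega]
  exact ((p3.evac p1 p2).op_eq_some_iff (p1.pEvac p2) (by omega)).2
    ⟨_, (step_pEvac_iff p1 p2 q1 q2 his).1 hstep, q3.evac q1 q2⟩

theorem eq_of_mem_tableaux {β γ : YoungDiagram} {s : ℕ} {T : Filling} (h : T ∈ tableaux β s)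
    (h' : T ∈ tableaux γ s) : β = γ :=
  YoungDiagram.ext (h.1.symm.trans h'.1)

theorem colLen_le {κ : YoungDiagram} {s : ℕ} {T : Filling} (hT : T ∈ tableaux κ s) :
    κ.colLen 0 ≤ s := by
  obtain ⟨p1, p2, p3, p4⟩ := toPattern_spec hT
  by_contra! hc
  have h1 := p4 s
  rw [p1.eq_zero p2 s s le_rfl] at h1
  rw [← YoungDiagram.mem_iff_lt_colLen, YoungDiagram.mem_iff_lt_rowLen] at hc
  omega

/-! ### The splitting map and the operators -/

section Split

variable {m : ℕ} {lam : YoungDiagram} {T : Filling}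

theorem phi_rep (hT : T ∈ tableaux lam (2 * m)) :
    IsPattern (2 * m) m (trunc m (toPattern T)) ∧ trunc m (toPattern T) 0 = 0 ∧
      Rep (trunc m (toPattern T)) (phi m T).1 ∧ IsPattern (2 * m) m (dem^[m] (toPattern T)) ∧
      dem^[m] (toPattern T) 0 = 0 ∧ Rep (dem^[m] (toPattern T)) (phi m T).2 := by
  obtain ⟨p1, p2, p3, p4⟩ := toPattern_spec hT
  obtain ⟨q1, q2⟩ := p1.dem_iterate p2 m
  rw [show 2 * m - m = m by omega] at q1
  exact ⟨p1.trunc, by rw [trunc, Nat.zero_min, p2], p3.restrictLE m, q1, q2, p3.rect_dropLE p1 p2 m⟩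

theorem phi_mem (hT : T ∈ tableaux lam (2 * m)) :
    ∃ β γ : YoungDiagram, phi m T ∈ tableaux β m ×ˢ tableaux γ m := by
  obtain ⟨h1, h2, h3, h4, h5, h6⟩ := phi_rep hT
  obtain ⟨β, -, hβ⟩ := h3.exists_shape h1 h2
  obtain ⟨γ, -, hγ⟩ := h6.exists_shape h4 h5
  exact ⟨β, γ, hβ, hγ⟩

theorem phi0_evac (hT : T ∈ tableaux lam (2 * m)) :
    (phi m (evac (2 * m) T)).1 = evac m (phi m T).2 := by
  obtain ⟨p1, p2, p3, p4⟩ := toPattern_spec hT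
  obtain ⟨h1, h2, h3, h4, h5, h6⟩ := phi_rep hT
  have e : trunc m (pEvac (2 * m) (toPattern T)) = pEvac m (dem^[m] (toPattern T)) := by
    funext k r
    rcases le_total k m with hk | hk
    · rw [trunc, min_eq_left hk, pEvac, pEvac, ← Function.iterate_add_apply,
        show 2 * m - k = m - k + m by omega]
    · rw [trunc, min_eq_right hk, pEvac_of_le hk, h4.stab k r hk, pEvac,
        show 2 * m - m = m by omega]
  have h7 : Rep _ (phi m (evac (2 * m) T)).1 := (p3.evac p1 p2).restrictLE m
  rw [e] at h7
  exact h7.unique (h6.evac h4 h5)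

/-- Evacuation interchanges the two halves of a tableau. The second component follows from the
first, because evacuation is an involution. -/
theorem phi_evac (hT : T ∈ tableaux lam (2 * m)) :
    phi m (evac (2 * m) T) = (evac m (phi m T).2, evac m (phi m T).1) := by
  refine Prod.ext (phi0_evac hT) ?_
  have hS := evac_mem hT
  obtain ⟨β, γ, -, hγ⟩ := phi_mem hS
  have h := phi0_evac hS
  rw [evac_evac hT] at h
  rw [h, evac_evac hγ]

theorem Step.exists_congr {n : ℕ} {d : Bool} {L M A : Pattern} (h : Step d n L M)
    (h0 : A n = L n) (h1 : A (n + 1) = L (n + 1)) (h2 : A (n + 2) = L (n + 2)) :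
    ∃ A', Step d n A A' := by
  cases d <;> obtain ⟨r, hr, -⟩ := h <;> exact ⟨_, r, by rwa [h0, h1, h2], rfl⟩

theorem trunc_of_le {k : ℕ} (L : Pattern) (hk : k ≤ m) : trunc m L k = L k := by
  rw [trunc, min_eq_left hk]

/-- The operators with small index act on the part with small entries. -/
theorem phi_op_of_lt {d : Bool} {i : ℕ} (hT : T ∈ tableaux lam (2 * m)) (hi : 1 ≤ i) (him : i < m) :
    (op d i T).map (phi m) = (op d i (phi m T).1).map fun U => (U, (phi m T).2) := by
  obtain ⟨n, rfl⟩ : ∃ n, i = n + 1 := ⟨i - 1, by omega⟩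
  obtain ⟨p1, p2, p3, p4⟩ := toPattern_spec hT
  obtain ⟨h1, h2, h3, -⟩ := phi_rep hT
  rcases hop : op d (n + 1) T with _ | T'
  · rcases hop' : op d (n + 1) (phi m T).1 with _ | U
    · rfl
    · exfalso
      obtain ⟨M, hM, -⟩ := (h3.op_eq_some_iff h1 him).1 hop'
      obtain ⟨L', hL'⟩ := hM.exists_congr (A := toPattern T) (trunc_of_le _ (by omega)).symm
        (trunc_of_le _ (by omega)).symm (trunc_of_le _ (by omega)).symm
      obtain ⟨T', hT', -⟩ := p3.exists_op p1 (by omega) hL'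
      rw [hop] at hT'
      exact absurd hT' (by simp)
  · obtain ⟨hT', hstep⟩ := op_toPattern hT (by omega) hop
    obtain ⟨g1, g2, g3, -⟩ := phi_rep hT'
    obtain ⟨-, -, q3, -⟩ := toPattern_spec hT'
    have h4 : Step d n (trunc m (toPattern T)) (trunc m (toPattern T')) := by
      refine hstep.congr (trunc_of_le _ (by omega)) (trunc_of_le _ (by omega))
        (trunc_of_le _ (by omega)) (trunc_of_le _ (by omega)) fun k hk => ?_
      rw [trunc, trunc, hstep.level (by omega)]
    have h5 : shift m (toPattern T') = shift m (toPattern T) := by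
      funext k
      rw [shift, shift, hstep.level (by omega)]
    have h6 : dropLE m T' = dropLE m T := by
      have := q3.dropLE m
      rw [h5] at this
      exact this.unique (p3.dropLE m)
    have h7 : (phi m T').2 = (phi m T).2 := congrArg rect h6
    rw [(h3.op_eq_some_iff h1 him).2 ⟨_, h4, g3⟩, Option.map_some, Option.map_some, ← h7]

/-- The operators with large index act on the rectification of the part with large entries. -/
theorem phi_op_of_gt {d : Bool} {i : ℕ} (hT : T ∈ tableaux lam (2 * m)) (hi : m < i)
    (him : i < 2 * m) :
    (op d i T).map (phi m) = (op d (i - m) (phi m T).2).map fun V => ((phi m T).1, V) := by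
  obtain ⟨n, rfl⟩ : ∃ n, i = n + m + 1 := ⟨i - m - 1, by omega⟩
  have e : n + m + 1 - m = n + 1 := by omega
  rw [e]
  obtain ⟨p1, p2, p3, p4⟩ := toPattern_spec hT
  obtain ⟨-, -, h1, h4, h5, h6⟩ := phi_rep hT
  obtain ⟨l, hl⟩ := exists_exhausts (p1.antitone m) (p1.fin m)
  have hl' : Exhausts l (shift m (toPattern T) 0) := by rwa [shift_zero]
  have hdem := slides_shift_eq_dem_iterate p1 p2 m hl
  rcases hop : op d (n + m + 1) T with _ | T'
  · rcases hop' : op d (n + 1) (phi m T).2 with _ | V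
    · rfl
    · exfalso
      obtain ⟨M, hM, -⟩ := (h6.op_eq_some_iff h4 (by omega)).1 hop'
      rw [← hdem] at hM
      obtain ⟨X, hX, -⟩ := hM.of_slides p1.shift (by omega) hl'
      obtain ⟨L', hL', -⟩ := hX.of_shift
      obtain ⟨T', hT', -⟩ := p3.exists_op p1 (by omega) hL'
      rw [hop] at hT'
      exact absurd hT' (by simp)
  · obtain ⟨hT', hstep⟩ := op_toPattern hT (by omega) hop
    obtain ⟨q1, q2, q3, q4⟩ := toPattern_spec hT'
    obtain ⟨-, -, g1, g4, g5, g6⟩ := phi_rep hT'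
    have hm : toPattern T' m = toPattern T m := hstep.level (by omega)
    have hdem' := slides_shift_eq_dem_iterate q1 q2 m (l := l) (by rwa [hm])
    have h7 : Step d n (dem^[m] (toPattern T)) (dem^[m] (toPattern T')) := by
      rw [← hdem, ← hdem']
      exact hstep.shift.slides p1.shift (by omega) hl'
    have h8 : trunc m (toPattern T') = trunc m (toPattern T) := by
      funext k
      rw [trunc, trunc, hstep.level (by omega)]
    have h9 : (phi m T').1 = (phi m T).1 := by
      rw [h8] at g1
      exact g1.unique h1
    rw [(h6.op_eq_some_iff h4 (by omega)).2 ⟨_, h7, g6⟩, Option.map_some, Option.map_some, ← h9]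

end Split

/-! ### Extremal tableaux -/

theorem Rep.content_succ {N s : ℕ} {L : Pattern} {T : Filling} (hL : IsPattern N s L)
    (h : Rep L T) (k : ℕ) : content T (k + 1) + size N L k = size N L (k + 1) := by
  have h1 := h.card_filter hL k 0
  have h2 : (T.support.filter fun c => 0 ≤ c.2 ∧ T c = k + 1) =
      T.support.filter fun c => T c = k + 1 :=
    Finset.filter_congr fun c _ => by simp
  rw [h2, Finset.sum_sub_distrib] at h1
  simp only [Nat.cast_zero, max_eq_left (Int.natCast_nonneg _)] at h1
  rw [content, size, size]
  generalize (T.support.filter fun c => T c = k + 1).card = C at *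
  zify
  omega

section Extremal

variable {β : YoungDiagram} {m : ℕ} {U : Filling}

theorem rowLen_eq_zero (hU : U ∈ tableaux β m) {r : ℕ} (hr : m ≤ r) : β.rowLen r = 0 := by
  obtain ⟨p1, p2, p3, p4⟩ := toPattern_spec hU
  rw [← p4, p1.eq_zero p2 m r hr]

/-- The sizes of the levels of the lowest weight pattern. -/
theorem sum_rowLen_lowest (hU : U ∈ tableaux β m) {k : ℕ} (hk : k < m) :
    ∑ r ∈ Finset.range m, β.rowLen (r + (m - (k + 1))) =
      β.rowLen (m - (k + 1)) + ∑ r ∈ Finset.range m, β.rowLen (r + (m - k)) := by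
  obtain ⟨d, rfl⟩ : ∃ d, m = d + 1 := ⟨m - 1, by omega⟩
  rw [Finset.sum_range_succ', Finset.sum_range_succ (fun r => β.rowLen (r + (d + 1 - k))),
    rowLen_eq_zero hU (show d + 1 ≤ d + (d + 1 - k) by omega), zero_add, add_zero, add_comm]
  congr 1
  exact Finset.sum_congr rfl fun r _ => by congr 1; omega

theorem content_of_lowest (hU : U ∈ tableaux β m)
    (h : ∀ i, 1 ≤ i → i < m → fOp i U = none) {a : ℕ} (ha : a ∈ Finset.Icc 1 m) :
    content U a = β.rowLen (m - a) := by
  obtain ⟨p1, p2, p3, p4⟩ := toPattern_spec hU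
  obtain ⟨h1, h2⟩ := Finset.mem_Icc.1 ha
  obtain ⟨k, rfl⟩ : ∃ k, a = k + 1 := ⟨a - 1, by omega⟩
  have hlow : ∀ k ≤ m, ∀ r, toPattern U k r = β.rowLen (r + (m - k)) := by
    intro k hk r
    rw [← p4]
    refine lowest_form p1 p2 (fun n M hn hM => ?_) r hk
    obtain ⟨T', hT', -⟩ := p3.exists_op (d := false) p1 hn hM
    have := h (n + 1) (by omega) hn
    simp only [op] at hT'
    rw [this] at hT'
    exact absurd hT' (by simp)
  have h3 := p3.content_succ p1 k
  simp only [size, hlow k (by omega), hlow (k + 1) h2, sum_rowLen_lowest hU h2] at h3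
  omega

theorem toPattern_of_content_lowest (hU : U ∈ tableaux β m)
    (h : ∀ a ∈ Finset.Icc 1 m, content U a = β.rowLen (m - a)) {k : ℕ} (hk : k ≤ m) (r : ℕ) :
    toPattern U k r = β.rowLen (r + (m - k)) := by
  obtain ⟨p1, p2, p3, p4⟩ := toPattern_spec hU
  have hsize : ∀ k ≤ m, size m (toPattern U) k =
      ∑ r ∈ Finset.range m, β.rowLen (r + (m - k)) := by
    intro k
    induction k with
    | zero =>
      intro _
      rw [size, p2]
      refine Finset.sum_congr rfl fun r _ => ?_
      rw [rowLen_eq_zero hU (by omega)]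
      rfl
    | succ k ih =>
      intro hk
      rw [← p3.content_succ p1, h _ (Finset.mem_Icc.2 ⟨by omega, hk⟩), ih (by omega),
        sum_rowLen_lowest hU hk]
  have hle : ∀ d k r, k + d = m → β.rowLen (r + d) ≤ toPattern U k r := by
    intro d
    induction d with
    | zero => rintro k r rfl; rw [← p4]; exact le_rfl
    | succ d ih =>
      intro k r hkd
      have h1 := ih (k + 1) (r + 1) (by omega)
      rw [show r + 1 + d = r + (d + 1) by omega] at h1
      exact h1.trans (p1.il k r)
  rcases lt_or_ge r m with hr | hr
  · refine ((Finset.sum_eq_sum_iff_of_le fun r _ => hle (m - k) k r (by omega)).1 ?_ r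
      (Finset.mem_range.2 hr)).symm
    exact (hsize k hk).symm
  · rw [p1.fin k r hr, rowLen_eq_zero hU (by omega)]

theorem content_of_highest (hU : U ∈ tableaux β m)
    (h : ∀ i, 1 ≤ i → i < m → eOp i U = none) {a : ℕ} (ha : a ∈ Finset.Icc 1 m) :
    content U a = β.rowLen (a - 1) := by
  obtain ⟨p1, p2, p3, p4⟩ := toPattern_spec hU
  obtain ⟨h1, h2⟩ := Finset.mem_Icc.1 ha
  obtain ⟨k, rfl⟩ : ∃ k, a = k + 1 := ⟨a - 1, by omega⟩
  have h3 := p3.content_succ p1 k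
  rw [size_succ_of_highest p1 p2 (fun k r hr hk => highest_form p1 (fun n M hn hM => by
    obtain ⟨T', hT', -⟩ := p3.exists_op (d := true) p1 hn hM
    have := h (n + 1) (by omega) hn
    simp only [op] at hT'
    rw [this] at hT'
    exact absurd hT' (by simp)) hr hk) h2, p4] at h3
  rw [Nat.add_sub_cancel]
  omega

theorem toPattern_of_content_highest (hU : U ∈ tableaux β m)
    (h : ∀ a ∈ Finset.Icc 1 m, content U a = β.rowLen (a - 1)) {k : ℕ} (hk : k ≤ m) (r : ℕ) :
    toPattern U k r = if r < k then β.rowLen r else 0 := by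
  obtain ⟨p1, p2, p3, p4⟩ := toPattern_spec hU
  have hsize : ∀ k ≤ m, size m (toPattern U) k =
      ∑ r ∈ Finset.range m, if r < k then β.rowLen r else 0 := by
    intro k
    induction k with
    | zero =>
      intro _
      rw [size, p2]
      simp
    | succ k ih =>
      intro hk
      have hsplit : ∀ r, (if r < k + 1 then β.rowLen r else 0) =
          (if r < k then β.rowLen r else 0) + if r = k then β.rowLen k else 0 := by
        intro r
        rcases lt_trichotomy r k with hr | rfl | hr
        · rw [if_pos (by omega), if_pos hr, if_neg hr.ne, add_zero]
        · simp
        · rw [if_neg (by omega), if_neg (by omega), if_neg hr.ne']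
      have hk' : k ∈ Finset.range m := Finset.mem_range.2 hk
      rw [← p3.content_succ p1, h _ (Finset.mem_Icc.2 ⟨by omega, hk⟩), ih (by omega),
        Finset.sum_congr rfl fun r _ => hsplit r, Finset.sum_add_distrib, Finset.sum_ite_eq',
        if_pos hk', Nat.add_sub_cancel, add_comm]
  have hle : ∀ r, toPattern U k r ≤ if r < k then β.rowLen r else 0 := by
    intro r
    split_ifs with hr
    · rw [← p4]; exact p1.mono r hk
    · rw [p1.eq_zero p2 k r (by omega)]
  rcases lt_or_ge r m with hr | hr
  · exact (Finset.sum_eq_sum_iff_of_le fun r _ => hle r).1 (hsize k hk) r (Finset.mem_range.2 hr)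
  · rw [p1.fin k r hr, if_neg (by omega)]

theorem eq_of_toPattern_eq {U' : Filling} (hU : U ∈ tableaux β m) (hU' : U' ∈ tableaux β m)
    (h : ∀ k ≤ m, ∀ r, toPattern U k r = toPattern U' k r) : U = U' := by
  obtain ⟨p1, p2, p3, p4⟩ := toPattern_spec hU
  obtain ⟨q1, q2, q3, q4⟩ := toPattern_spec hU'
  have e : toPattern U = toPattern U' := by
    funext k r
    rcases le_total k m with hk | hk
    · exact h k hk r
    · rw [p1.stab k r hk, q1.stab k r hk, h m le_rfl]
  rw [← e] at q3
  exact p3.unique q3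

/-- The tableau of lowest weight is the only one with reversed content. -/
theorem setOf_content_lowest (hU : U ∈ tableaux β m)
    (h : ∀ i, 1 ≤ i → i < m → fOp i U = none) :
    {V | V ∈ tableaux β m ∧ ∀ a ∈ Finset.Icc 1 m, content V a = β.rowLen (m - a)} = {U} := by
  have hc := fun a (ha : a ∈ Finset.Icc 1 m) => content_of_lowest hU h ha
  refine Set.eq_singleton_iff_unique_mem.2 ⟨⟨hU, hc⟩, fun V hV => ?_⟩
  refine eq_of_toPattern_eq hV.1 hU fun k hk r => ?_
  rw [toPattern_of_content_lowest hV.1 hV.2 hk, toPattern_of_content_lowest hU hc hk]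

/-- The tableau of highest weight is the only one whose content is its shape. -/
theorem setOf_content_highest (hU : U ∈ tableaux β m)
    (h : ∀ i, 1 ≤ i → i < m → eOp i U = none) :
    {V | V ∈ tableaux β m ∧ ∀ a ∈ Finset.Icc 1 m, content V a = β.rowLen (a - 1)} = {U} := by
  have hc := fun a (ha : a ∈ Finset.Icc 1 m) => content_of_highest hU h ha
  refine Set.eq_singleton_iff_unique_mem.2 ⟨⟨hU, hc⟩, fun V hV => ?_⟩
  refine eq_of_toPattern_eq hV.1 hU fun k hk r => ?_
  rw [toPattern_of_content_highest hV.1 hV.2 hk, toPattern_of_content_highest hU hc hk]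

theorem op_extremal_unique {d : Bool} {V : Filling} (hU : U ∈ tableaux β m)
    (hV : V ∈ tableaux β m) (h : ∀ i, 1 ≤ i → i < m → op d i U = none)
    (h' : ∀ i, 1 ≤ i → i < m → op d i V = none) : U = V := by
  cases d
  · exact Set.singleton_injective
      ((setOf_content_lowest hU h).symm.trans (setOf_content_lowest hV h'))
  · exact Set.singleton_injective
      ((setOf_content_highest hU h).symm.trans (setOf_content_highest hV h'))

/-- An arrow labelled `e_i` or `f_i` of the crystal of tableaux of shape `β`. -/
def OpEdge (β : YoungDiagram) (m : ℕ) (d : Bool) (A B : Filling) : Prop :=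
  A ∈ tableaux β m ∧ ∃ i, 1 ≤ i ∧ i < m ∧ op d i A = some B

theorem OpEdge.symm {d : Bool} {A B : Filling} (h : OpEdge β m d A B) : OpEdge β m (!d) B A := by
  obtain ⟨hA, i, hi, him, h⟩ := h
  exact ⟨op_mem hA hi him h, i, hi, him, op_symm hA hi him h⟩

/-- Every tableau is connected to an extremal one. -/
theorem exists_extremal (d : Bool) (hU : U ∈ tableaux β m) :
    ∃ H ∈ tableaux β m, (∀ i, 1 ≤ i → i < m → op d i H = none) ∧
      Relation.ReflTransGen (OpEdge β m d) U H := by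
  have hpot : ∀ {V : Filling}, V ∈ tableaux β m →
      potential m m (toPattern V) ≤ m * ∑ r ∈ Finset.range m, β.rowLen r := by
    intro V hV
    obtain ⟨p1, -, -, p4⟩ := toPattern_spec hV
    have := potential_le p1
    simp only [size] at this
    rwa [Finset.sum_congr rfl fun r _ => p4 r] at this
  induction hμ : (if d then m * (∑ r ∈ Finset.range m, β.rowLen r) - potential m m (toPattern U)
    else potential m m (toPattern U)) using Nat.strong_induction_on generalizing U with
  | _ μ ih =>
    by_cases hex : ∃ i V, 1 ≤ i ∧ i < m ∧ op d i U = some V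
    · obtain ⟨i, V, hi, him, hV⟩ := hex
      have hVm := op_mem hU hi him hV
      have hedge : OpEdge β m d U V := ⟨hU, i, hi, him, hV⟩
      obtain ⟨n, rfl⟩ : ∃ n, i = n + 1 := ⟨i - 1, by omega⟩
      have hstep := (op_toPattern hU him hV).2
      obtain ⟨p1, -⟩ := toPattern_spec hU
      obtain ⟨q1, -⟩ := toPattern_spec hVm
      have b1 := hpot hU
      have b2 := hpot hVm
      obtain ⟨H, h1, h2, h3⟩ := ih _ (by
        rw [← hμ]
        cases d
        · have := Raise.potential q1 him (hstep.symm p1 him).2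
          simp only [Bool.false_eq_true, if_false]
          omega
        · have := Raise.potential p1 him hstep
          simp only [if_true]
          omega) hVm rfl
      exact ⟨H, h1, h2, h3.head hedge⟩
    · refine ⟨U, hU, fun i hi him => ?_, Relation.ReflTransGen.refl⟩
      rw [Option.eq_none_iff_forall_ne_some]
      exact fun V hV => hex ⟨i, V, hi, him, hV⟩

end Extremal

/-! ### Connected components and the splitting map -/

section Components

variable {m : ℕ} {lam : YoungDiagram} {T T' : Filling}

/-- The raising operators (`true`) and the lowering operators (`false`) of a crystal. -/
def CrystalOps.arrow {I X : Type} (K : CrystalOps I X) : Bool → I → X → Option X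
  | true => K.raising
  | false => K.lowering

theorem blockCrystal_arrow_of_lt (d : Bool) {i : BlockIndex m} (hi : i.1 < m) (T : Filling) :
    (blockCrystal m lam).arrow d i T = op (!d) i.1 T := by
  cases d <;> simp [CrystalOps.arrow, blockCrystal, op, hi]

theorem blockCrystal_arrow_of_gt (d : Bool) {i : BlockIndex m} (hi : m < i.1) (T : Filling) :
    (blockCrystal m lam).arrow d i T = op d i.1 T := by
  cases d <;> simp [CrystalOps.arrow, blockCrystal, op, hi.le]

theorem prodCrystal_arrow_of_lt {β γ : YoungDiagram} (d : Bool) {i : BlockIndex m} (hi : i.1 < m)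
    (P : Filling × Filling) :
    (prodCrystal m β γ).arrow d i P = (op (!d) i.1 P.1).map fun U => (U, P.2) := by
  cases d <;> simp [CrystalOps.arrow, prodCrystal, op, hi]

theorem prodCrystal_arrow_of_gt {β γ : YoungDiagram} (d : Bool) {i : BlockIndex m} (hi : m < i.1)
    (P : Filling × Filling) :
    (prodCrystal m β γ).arrow d i P = (op d (i.1 - m) P.2).map fun V => (P.1, V) := by
  cases d <;> simp [CrystalOps.arrow, prodCrystal, op, hi.le]

/-- The splitting map commutes with all operators. -/
theorem phi_arrow (β γ : YoungDiagram) (d : Bool) (i : BlockIndex m)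
    (hT : T ∈ tableaux lam (2 * m)) :
    ((blockCrystal m lam).arrow d i T).map (phi m) = (prodCrystal m β γ).arrow d i (phi m T) := by
  rcases i.2 with ⟨h1, h2⟩ | ⟨h1, h2⟩
  · rw [blockCrystal_arrow_of_lt d h2, prodCrystal_arrow_of_lt d h2, phi_op_of_lt hT h1 h2]
  · rw [blockCrystal_arrow_of_gt d h1, prodCrystal_arrow_of_gt d h1, phi_op_of_gt hT h1 h2]

theorem arrow_eq_op (d : Bool) (i : BlockIndex m) :
    ∃ d', ∀ T, (blockCrystal m lam).arrow d i T = op d' i.1 T ∧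
      (blockCrystal m lam).arrow (!d) i T = op (!d') i.1 T := by
  rcases i.2 with ⟨h1, h2⟩ | ⟨h1, h2⟩
  · exact ⟨!d, fun T => ⟨blockCrystal_arrow_of_lt d h2 T, blockCrystal_arrow_of_lt _ h2 T⟩⟩
  · exact ⟨d, fun T => ⟨blockCrystal_arrow_of_gt d h1 T, blockCrystal_arrow_of_gt _ h1 T⟩⟩

theorem blockIndex_bounds (i : BlockIndex m) : 1 ≤ i.1 ∧ i.1 < 2 * m := by
  rcases i.2 with h | h <;> omega

theorem arrow_mem {d : Bool} {i : BlockIndex m} (hT : T ∈ tableaux lam (2 * m))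
    (h : (blockCrystal m lam).arrow d i T = some T') : T' ∈ tableaux lam (2 * m) := by
  obtain ⟨d', hd⟩ := arrow_eq_op (lam := lam) d i
  obtain ⟨h1, h2⟩ := blockIndex_bounds i
  exact op_mem hT h1 h2 ((hd T).1 ▸ h)

theorem arrow_symm {d : Bool} {i : BlockIndex m} (hT : T ∈ tableaux lam (2 * m))
    (h : (blockCrystal m lam).arrow d i T = some T') :
    (blockCrystal m lam).arrow (!d) i T' = some T := by
  obtain ⟨d', hd⟩ := arrow_eq_op (lam := lam) d i
  obtain ⟨h1, h2⟩ := blockIndex_bounds i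
  rw [(hd T').2]
  exact op_symm hT h1 h2 ((hd T).1 ▸ h)

/-- Evacuation permutes the raising operators: the index `i` goes to `2m - i`, in the other block,
where the roles of `e` and `f` are exchanged. -/
theorem arrow_evac {i : BlockIndex m} (hT : T ∈ tableaux lam (2 * m))
    (h : (blockCrystal m lam).raising i T = some T') :
    ∃ j, (blockCrystal m lam).raising j (evac (2 * m) T) = some (evac (2 * m) T') := by
  obtain ⟨h1, h2⟩ := blockIndex_bounds i
  change (blockCrystal m lam).arrow true i T = some T' at h
  change ∃ j, (blockCrystal m lam).arrow true j _ = _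
  rcases i.2 with hi | hi
  · refine ⟨⟨2 * m - i.1, by omega⟩, ?_⟩
    rw [blockCrystal_arrow_of_lt _ hi.2] at h
    rw [blockCrystal_arrow_of_gt _ (by simp only; omega)]
    exact op_evac hT h1 h2 h
  · refine ⟨⟨2 * m - i.1, by omega⟩, ?_⟩
    rw [blockCrystal_arrow_of_gt _ hi.1] at h
    rw [blockCrystal_arrow_of_lt _ (by simp only; omega)]
    exact op_evac hT h1 h2 h

/-- Lying in the same connected component. -/
abbrev Connected (m : ℕ) (lam : YoungDiagram) : Filling → Filling → Prop :=
  Relation.EqvGen (blockCrystal m lam).Edge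

theorem Connected.of_arrow {d : Bool} {i : BlockIndex m} (hT : T ∈ tableaux lam (2 * m))
    (h : (blockCrystal m lam).arrow d i T = some T') : Connected m lam T T' := by
  have hT' := arrow_mem hT h
  cases d
  · exact (Relation.EqvGen.rel _ _ ⟨hT', hT, i, arrow_symm hT h⟩).symm
  · exact Relation.EqvGen.rel _ _ ⟨hT, hT', i, h⟩

theorem Connected.mem_iff (h : Connected m lam T T') :
    T ∈ tableaux lam (2 * m) ↔ T' ∈ tableaux lam (2 * m) := by
  induction h with
  | rel _ _ h => exact iff_of_true h.1 h.2.1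
  | refl _ => exact Iff.rfl
  | symm _ _ _ ih => exact ih.symm
  | trans _ _ _ _ _ ih ih' => exact ih.trans ih'

theorem Connected.evac (h : Connected m lam T T') :
    Connected m lam (evac (2 * m) T) (evac (2 * m) T') := by
  induction h with
  | rel _ _ h =>
    obtain ⟨hA, hB, i, h⟩ := h
    exact Relation.EqvGen.rel _ _ ⟨evac_mem hA, evac_mem hB, arrow_evac hA h⟩
  | refl _ => exact Relation.EqvGen.refl _
  | symm _ _ _ ih => exact ih.symm
  | trans _ _ _ _ _ ih ih' => exact ih.trans _ _ _ ih'

theorem phi_arrow_mem {β γ : YoungDiagram} {d : Bool} {i : BlockIndex m}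
    (hT : T ∈ tableaux lam (2 * m)) (h : (blockCrystal m lam).arrow d i T = some T')
    (hP : phi m T ∈ tableaux β m ×ˢ tableaux γ m) :
    phi m T' ∈ tableaux β m ×ˢ tableaux γ m := by
  have key := phi_arrow β γ d i hT
  rw [h, Option.map_some] at key
  rcases i.2 with ⟨h1, h2⟩ | ⟨h1, h2⟩
  · rw [prodCrystal_arrow_of_lt d h2, eq_comm, Option.map_eq_some_iff] at key
    obtain ⟨U, hU, e⟩ := key
    rw [← e]
    exact ⟨op_mem hP.1 h1 h2 hU, hP.2⟩
  · rw [prodCrystal_arrow_of_gt d h1, eq_comm, Option.map_eq_some_iff] at key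
    obtain ⟨V, hV, e⟩ := key
    rw [← e]
    exact ⟨hP.1, op_mem hP.2 (by omega) (by omega) hV⟩

/-- The shapes of the two halves are constant on a connected component. -/
theorem Connected.phi_mem_iff (h : Connected m lam T T') (β γ : YoungDiagram) :
    phi m T ∈ tableaux β m ×ˢ tableaux γ m ↔ phi m T' ∈ tableaux β m ×ˢ tableaux γ m := by
  induction h with
  | rel A B h =>
    obtain ⟨hA, hB, i, h⟩ := h
    change (blockCrystal m lam).arrow true i A = some B at h
    exact ⟨phi_arrow_mem hA h, phi_arrow_mem hB (arrow_symm hA h)⟩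
  | refl _ => exact Iff.rfl
  | symm _ _ _ ih => exact ih.symm
  | trans _ _ _ _ _ ih ih' => exact ih.trans ih'

theorem Connected.eqvGen_shift (h : Connected m lam T T') :
    Relation.EqvGen (fun A B => IsPattern (2 * m) m A ∧ ∃ d n, n + 1 < m ∧ Step d n A B)
      (shift m (toPattern T)) (shift m (toPattern T')) := by
  induction h with
  | rel A B h =>
    obtain ⟨hA, hB, i, h⟩ := h
    change (blockCrystal m lam).arrow true i A = some B at h
    rcases i.2 with ⟨h1, h2⟩ | ⟨h1, h2⟩
    · obtain ⟨n, hn⟩ : ∃ n, i.1 = n + 1 := ⟨i.1 - 1, by omega⟩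
      rw [blockCrystal_arrow_of_lt _ h2, hn] at h
      have hstep := (op_toPattern hA (by omega) h).2
      have e : shift m (toPattern B) = shift m (toPattern A) := by
        funext k
        rw [shift, shift, hstep.level (by omega)]
      rw [e]
      exact Relation.EqvGen.refl _
    · obtain ⟨n, hn⟩ : ∃ n, i.1 = n + m + 1 := ⟨i.1 - m - 1, by omega⟩
      rw [blockCrystal_arrow_of_gt _ h1, hn] at h
      have hstep := (op_toPattern hA (by omega) h).2
      have p := (toPattern_spec hA).1.shift (k := m)
      rw [show 2 * m - m = m by omega] at p
      exact Relation.EqvGen.rel _ _ ⟨p, true, n, by omega, hstep.shift⟩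
  | refl _ => exact Relation.EqvGen.refl _
  | symm _ _ _ ih => exact ih.symm
  | trans _ _ _ _ _ ih ih' => exact ih.trans _ _ _ ih'

/-- The splitting map is injective on each connected component: along a component the slides of the
rectification leave the same boxes, so they can be undone. -/
theorem Connected.phi_injective (h : Connected m lam T T') (hT : T ∈ tableaux lam (2 * m))
    (e : phi m T = phi m T') : T = T' := by
  have hT' := h.mem_iff.1 hT
  obtain ⟨p1, p2, p3, p4⟩ := toPattern_spec hT
  obtain ⟨q1, q2, q3, q4⟩ := toPattern_spec hT'
  obtain ⟨a1, a2, a3, a4, a5, a6⟩ := phi_rep hT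
  obtain ⟨b1, b2, b3, b4, b5, b6⟩ := phi_rep hT'
  rw [← e] at b3 b6
  have e1 := a3.pattern_unique a1 a2 b1 b2 b3
  have e2 := a6.pattern_unique a4 a5 b4 b5 b6
  have em : toPattern T m = toPattern T' m := by
    have := congrFun e1 m
    rwa [trunc_of_le _ le_rfl, trunc_of_le _ le_rfl] at this
  obtain ⟨l, hl⟩ := exists_exhausts (p1.antitone m) (p1.fin m)
  have s1 : IsPattern (2 * m) m (shift m (toPattern T)) := by
    have p := p1.shift (k := m)
    rwa [show 2 * m - m = m by omega] at p
  have e3 := slides_injective (by rwa [shift_zero]) h.eqvGen_shift s1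
    (by rw [slides_shift_eq_dem_iterate p1 p2 m hl, e2,
          slides_shift_eq_dem_iterate q1 q2 m (em ▸ hl)])
  have e4 : toPattern T = toPattern T' := by
    funext k
    rcases le_total k m with hk | hk
    · have := congrFun e1 k
      rwa [trunc_of_le _ hk, trunc_of_le _ hk] at this
    · have := congrFun e3 (k - m)
      rwa [shift, shift, Nat.sub_add_cancel hk] at this
  rw [← e4] at q3
  exact p3.unique q3

/-- Arrows between first components lift to the connected component of a tableau. -/
theorem exists_lift_fst {β : YoungDiagram} {d : Bool} {U : Filling}
    (hT : T ∈ tableaux lam (2 * m)) (h : Relation.ReflTransGen (OpEdge β m d) (phi m T).1 U) :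
    ∃ T', Connected m lam T T' ∧ phi m T' = (U, (phi m T).2) := by
  induction h with
  | refl => exact ⟨T, Relation.EqvGen.refl _, rfl⟩
  | tail _ h ih =>
    obtain ⟨A, hA, eA⟩ := ih
    obtain ⟨-, i, hi, him, h⟩ := h
    have hAm := hA.mem_iff.1 hT
    have key := phi_op_of_lt (d := d) hAm hi him
    rw [eA, h, Option.map_some, Option.map_eq_some_iff] at key
    obtain ⟨B, hB, eB⟩ := key
    refine ⟨B, hA.trans _ _ _ (Connected.of_arrow (d := !d) (i := ⟨i, .inl ⟨hi, him⟩⟩) hAm ?_), eB⟩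
    rw [blockCrystal_arrow_of_lt _ him, Bool.not_not, hB]

/-- Arrows between second components lift to the connected component of a tableau. -/
theorem exists_lift_snd {γ : YoungDiagram} {d : Bool} {V : Filling}
    (hT : T ∈ tableaux lam (2 * m)) (h : Relation.ReflTransGen (OpEdge γ m d) (phi m T).2 V) :
    ∃ T', Connected m lam T T' ∧ phi m T' = ((phi m T).1, V) := by
  induction h with
  | refl => exact ⟨T, Relation.EqvGen.refl _, rfl⟩
  | tail _ h ih =>
    obtain ⟨A, hA, eA⟩ := ih
    obtain ⟨-, i, hi, him, h⟩ := h
    have hAm := hA.mem_iff.1 hT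
    have key := phi_op_of_gt (d := d) (i := i + m) hAm (by omega) (by omega)
    rw [eA, Nat.add_sub_cancel, h, Option.map_some, Option.map_eq_some_iff] at key
    obtain ⟨B, hB, eB⟩ := key
    refine ⟨B, hA.trans _ _ _
      (Connected.of_arrow (d := d) (i := ⟨i + m, .inr (by omega)⟩) hAm ?_), eB⟩
    rw [blockCrystal_arrow_of_gt _ (by simp only; omega), hB]

/-- `P` is a pair of a lowest and a highest weight tableau, that is, a highest weight element of
the product crystal. -/
def IsExtremalPair (m : ℕ) (P : Filling × Filling) : Prop :=
  ∀ i, 1 ≤ i → i < m → fOp i P.1 = none ∧ eOp i P.2 = none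

theorem isHighestWeight_iff (hT : T ∈ tableaux lam (2 * m)) :
    (blockCrystal m lam).IsHighestWeight T ↔ IsExtremalPair m (phi m T) := by
  constructor
  · intro h i hi him
    have h1 := phi_op_of_lt (d := false) hT hi him
    have h2 := phi_op_of_gt (d := true) (i := i + m) hT (by omega) (by omega)
    have g1 : (blockCrystal m lam).arrow true ⟨i, .inl ⟨hi, him⟩⟩ T = none := h.2 _
    have g2 : (blockCrystal m lam).arrow true ⟨i + m, .inr (by omega)⟩ T = none := h.2 _
    rw [blockCrystal_arrow_of_lt _ him, Bool.not_true] at g1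
    rw [blockCrystal_arrow_of_gt _ (by simp only; omega)] at g2
    rw [g1, Option.map_none, eq_comm, Option.map_eq_none_iff] at h1
    rw [g2, Option.map_none, eq_comm, Option.map_eq_none_iff, Nat.add_sub_cancel] at h2
    exact ⟨h1, h2⟩
  · intro h
    refine ⟨hT, fun i => ?_⟩
    change (blockCrystal m lam).arrow true i T = none
    rw [← Option.map_eq_none_iff (f := phi m), phi_arrow lam lam true i hT]
    rcases i.2 with ⟨h1, h2⟩ | ⟨h1, h2⟩
    · rw [prodCrystal_arrow_of_lt _ h2, Option.map_eq_none_iff]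
      exact (h _ h1 h2).1
    · rw [prodCrystal_arrow_of_gt _ h1, Option.map_eq_none_iff]
      exact (h _ (by omega) (by omega)).2

theorem IsExtremalPair.unique {β γ : YoungDiagram} {P Q : Filling × Filling}
    (hP : P ∈ tableaux β m ×ˢ tableaux γ m) (hQ : Q ∈ tableaux β m ×ˢ tableaux γ m)
    (h : IsExtremalPair m P) (h' : IsExtremalPair m Q) : P = Q :=
  Prod.ext
    (op_extremal_unique (d := false) hP.1 hQ.1 (fun i hi him => (h i hi him).1)
      fun i hi him => (h' i hi him).1)
    (op_extremal_unique (d := true) hP.2 hQ.2 (fun i hi him => (h i hi him).2)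
      fun i hi him => (h' i hi him).2)

/-- Every connected component has a highest weight element. -/
theorem exists_isHighestWeight (hT : T ∈ tableaux lam (2 * m)) :
    ∃ b, Connected m lam T b ∧ (blockCrystal m lam).IsHighestWeight b := by
  obtain ⟨β, γ, hβ, hγ⟩ := phi_mem hT
  obtain ⟨U, -, hU, hpU⟩ := exists_extremal false hβ
  obtain ⟨V, -, hV, hpV⟩ := exists_extremal true hγ
  obtain ⟨A, hA, eA⟩ := exists_lift_fst hT hpU
  have hAm := hA.mem_iff.1 hT
  obtain ⟨b, hb, eb⟩ := exists_lift_snd (V := V) (γ := γ) hAm (by rw [eA]; exact hpV)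
  refine ⟨b, hA.trans _ _ _ hb, (isHighestWeight_iff (hb.mem_iff.1 hAm)).2 ?_⟩
  rw [eb, eA]
  exact fun i hi him => ⟨hU i hi him, hV i hi him⟩

theorem Connected.eq_of_isHighestWeight (h : Connected m lam T T')
    (hT : (blockCrystal m lam).IsHighestWeight T)
    (hT' : (blockCrystal m lam).IsHighestWeight T') : T = T' := by
  obtain ⟨β, γ, hP⟩ := phi_mem hT.1
  exact h.phi_injective hT.1 (((isHighestWeight_iff hT.1).1 hT).unique hP
    ((h.phi_mem_iff β γ).1 hP) ((isHighestWeight_iff hT'.1).1 hT'))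

/-- Evacuation preserves highest weight elements, because it permutes the raising operators. -/
theorem isHighestWeight_evac (hT : (blockCrystal m lam).IsHighestWeight T) :
    (blockCrystal m lam).IsHighestWeight (evac (2 * m) T) := by
  refine ⟨evac_mem hT.1, fun i => ?_⟩
  rw [Option.eq_none_iff_forall_ne_some]
  intro X hX
  obtain ⟨j, hj⟩ := arrow_evac (evac_mem hT.1) hX
  rw [evac_evac hT.1, hT.2 j] at hj
  exact absurd hj (by simp)

/-- The operators connect any two tableaux of the same shape, through an extremal one. -/
theorem exists_path_extremal {β : YoungDiagram} {U H : Filling} (d : Bool) (hU : U ∈ tableaux β m)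
    (hH : H ∈ tableaux β m) (h : ∀ i, 1 ≤ i → i < m → op d i H = none) :
    Relation.ReflTransGen (OpEdge β m (!d)) H U := by
  obtain ⟨H', hH', h', hp⟩ := exists_extremal d hU
  rw [op_extremal_unique hH hH' h h']
  exact Relation.ReflTransGen.mono (fun A B hAB => OpEdge.symm hAB) _ _
    (Relation.reflTransGen_swap.2 hp)

/-- The splitting map takes the connected component of a highest weight element onto the pairs of
tableaux of the appropriate shapes. -/
theorem exists_connected_phi_eq {β γ : YoungDiagram} {P : Filling × Filling}
    (hT : (blockCrystal m lam).IsHighestWeight T) (hTP : phi m T ∈ tableaux β m ×ˢ tableaux γ m)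
    (hP : P ∈ tableaux β m ×ˢ tableaux γ m) : ∃ T', Connected m lam T T' ∧ phi m T' = P := by
  have hE := (isHighestWeight_iff hT.1).1 hT
  obtain ⟨A, hA, eA⟩ := exists_lift_fst hT.1
    (exists_path_extremal false hP.1 hTP.1 fun i hi him => (hE i hi him).1)
  obtain ⟨B, hB, eB⟩ := exists_lift_snd (V := P.2) (γ := γ) (d := !true) (hA.mem_iff.1 hT.1) (by
    rw [eA]
    exact exists_path_extremal true hP.2 hTP.2 fun i hi him => (hE i hi him).2)
  exact ⟨B, hA.trans _ _ _ hB, by rw [eB, eA]⟩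

end Components

end EvacCrystal

theorem mainTheorem4 (m : ℕ) (lam : YoungDiagram) :
    -- evacuation and the splitting map, on all tableaux
    (∀ T ∈ tableaux lam (2 * m),
      evac (2 * m) T ∈ tableaux lam (2 * m) ∧
      (∃ β γ : YoungDiagram, phi m T ∈ tableaux β m ×ˢ tableaux γ m) ∧
      phi m (evac (2 * m) T) = (evac m (rect (phi1 m T)), evac m (phi0 m T))) ∧
    -- the fixed points of evacuation in a connected component
    (∀ C : Set Filling, (blockCrystal m lam).IsComponent C →
      ∃ b ∈ C, (blockCrystal m lam).IsHighestWeight b ∧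
        (∀ b' ∈ C, (blockCrystal m lam).IsHighestWeight b' → b' = b) ∧
        (evac (2 * m) b ≠ b → {T | T ∈ C ∧ evac (2 * m) T = T} = ∅) ∧
        (evac (2 * m) b = b →
          ∃ β : YoungDiagram, β.colLen 0 ≤ m ∧
            -- the two components of `phi m b` are the unique tableaux of shape `β` with contents
            -- `(β_m, …, β_1)` and `(β_1, …, β_m)`
            {U | U ∈ tableaux β m ∧ ∀ a ∈ Finset.Icc 1 m, content U a = β.rowLen (m - a)}
              = {(phi m b).1} ∧
            {U | U ∈ tableaux β m ∧ ∀ a ∈ Finset.Icc 1 m, content U a = β.rowLen (a - 1)}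
              = {(phi m b).2} ∧
            ((blockCrystal m lam).restrict C).IsIso (prodCrystal m β β) (phi m) ∧
            Set.BijOn (phi m) {T | T ∈ C ∧ evac (2 * m) T = T}
              {P | P ∈ tableaux β m ×ˢ tableaux β m ∧ evac m P.1 = P.2})) := by
  refine ⟨fun T hT => ⟨evac_mem hT, phi_mem hT, phi_evac hT⟩, ?_⟩
  rintro C ⟨a, ha, rfl⟩
  change a ∈ tableaux lam (2 * m) at ha
  obtain ⟨b, hab, hb⟩ := exists_isHighestWeight ha
  refine ⟨b, hab, hb, fun b' hab' hb' =>
    Connected.eq_of_isHighestWeight (hab'.symm.trans _ _ _ hab) hb' hb, fun hne => ?_,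
    fun hfix => ?_⟩
  · refine Set.eq_empty_iff_forall_notMem.2 ?_
    rintro T ⟨haT, hT⟩
    have hTb : Connected m lam T b := (Relation.EqvGen.symm _ _ haT).trans _ _ _ hab
    have h := hTb.evac
    rw [hT] at h
    exact hne (Connected.eq_of_isHighestWeight (h.symm.trans _ _ _ hTb)
      (isHighestWeight_evac hb) hb)
  have hE := (isHighestWeight_iff hb.1).1 hb
  obtain ⟨β, γ, hP⟩ := phi_mem hb.1
  -- The halves of a tableau fixed by evacuation are interchanged by it, so they have one shape.
  have hγ : γ = β := by
    have h1 := phi_evac hb.1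
    rw [hfix] at h1
    have h2 : (phi m b).2 = evac m (phi m b).1 := congrArg Prod.snd h1
    exact eq_of_mem_tableaux hP.2 (by rw [h2]; exact evac_mem hP.1)
  subst hγ
  have hC : ∀ {T}, Relation.EqvGen (blockCrystal m lam).Edge a T ↔ Connected m lam b T :=
    ⟨fun h => hab.symm.trans _ _ _ h, fun h => hab.trans _ _ _ h⟩
  have hinj : Set.InjOn (phi m) {T | Relation.EqvGen (blockCrystal m lam).Edge a T} :=
    fun T hT T' hT' e => Connected.phi_injective (hT.symm.trans _ _ _ hT')
      ((Connected.mem_iff hT).1 ha) e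
  have hmaps : ∀ {T}, Connected m lam b T → phi m T ∈ tableaux γ m ×ˢ tableaux γ m :=
    fun h => (h.phi_mem_iff γ γ).1 hP
  refine ⟨γ, colLen_le hP.1, setOf_content_lowest hP.1 fun i hi him => (hE i hi him).1,
    setOf_content_highest hP.2 fun i hi him => (hE i hi him).2, ⟨⟨?_, hinj, ?_⟩, ?_⟩,
    ?_, hinj.mono fun T hT => hT.1, ?_⟩
  · exact fun T hT => hmaps (hC.1 hT)
  · intro P hP'
    obtain ⟨T, hT, e⟩ := exists_connected_phi_eq hb hP hP'
    exact ⟨T, hC.2 hT, e⟩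
  · intro i T hT
    have hTm := (Connected.mem_iff hT).1 ha
    exact ⟨phi_arrow γ γ true i hTm, phi_arrow γ γ false i hTm⟩
  · rintro T ⟨hT, hfT⟩
    refine ⟨hmaps (hC.1 hT), ?_⟩
    have h1 := phi_evac ((Connected.mem_iff hT).1 ha)
    rw [hfT] at h1
    exact (congrArg Prod.snd h1).symm
  · rintro P ⟨hP', hev⟩
    obtain ⟨T, hT, e⟩ := exists_connected_phi_eq hb hP hP'
    refine ⟨T, ⟨hC.2 hT, ?_⟩, e⟩
    -- The component of `b` is stable under evacuation, and both `T` and its image lie over `P`.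
    have hTe : Connected m lam b (evac (2 * m) T) := by
      have h := hT.evac
      rwa [hfix] at h
    refine hinj (hC.2 hTe) (hC.2 hT) ?_
    rw [phi_evac (hT.mem_iff.1 hb.1), e, ← hev, evac_evac hP'.1]
    exact Prod.ext rfl hev
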